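/- Conventions. An interval exchange map (i.e.m.) $T$ on an alphabet $\mathcal A$ with $d$ letters is given by bijections $\pi_0,\pi_1:\mathcal A\to\{1,\dots,d\}$ and lengths $\lambda_\alpha>0$: on $I=[0,\sum_\alpha\lambda_\alpha)$, $T$ translates the interval $[\ell_0(\alpha),\ell_0(\alpha)+\lambda_\alpha)$ onto $[\ell_1(\alpha),\ell_1(\alpha)+\lambda_\alpha)$, where $\ell_\varepsilon(\alpha)=\sum_{\pi_\varepsilon(\beta)<\pi_\varepsilon(\alpha)}\lambda_\beta$. It has the Keane property if $T^m(\ell_0(\alpha))=\ell_0(\beta)$ never holds with $m\ge1$ and $\pi_0(\beta)>1$. Let $\alpha_\varepsilon$ be the letter with $\pi_\varepsilon(\alpha_\varepsilon)=d$. The basic (Rauzy) operation of type $\varepsilon$ applies when $\lambda_{\alpha_\varepsilon}>\lambda_{\alpha_{1-\varepsilon}}$; it replaces $\lambda_{\alpha_\varepsilon}$ by $\lambda_{\alpha_\varepsilon}-\lambda_{\alpha_{1-\varepsilon}}$ and, in the row $\pi_{1-\varepsilon}$, moves $\alpha_{1-\varepsilon}$ to the place immediately after $\alpha_\varepsilon$.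 The corresponding arrow of the Rauzy diagram has name $\alpha_\varepsilon$ and matrix $V=\mathbf I+E_{\alpha_\varepsilon\alpha_{1-\varepsilon}}$, so that $\lambda=V\hat\lambda$ (old lengths from new). Under the Keane property this can be iterated forever and gives the Rauzy path of $T$. Group its arrows into successive maximal blocks taking at most $d-1$ names; $Z(k)$ is the product of the $V$ matrices in the $k$-th block ($k\ge1$) and $Q(k)=Z(1)\cdots Z(k)$, $Q(0)=\mathbf I$. $\|M\|$ is the sum of the absolute values of the entries of $M$. Condition (a): for every $\varepsilon>0$ there is $C_\varepsilon>0$ with $\|Z(k+1)\|\le C_\varepsilon\|Q(k)\|^\varepsilon$ for all $k\ge0$. Condition (b): there are $\theta,C>0$ such that for all $k\ge0$ the restriction of ${}^tQ(k)$ to $\{\varphi\in\mathbb R^{\mathcal A}:\sum_\alpha\lambda_\alpha\varphi_\alpha=0\}$ has norm at most $C\|Q(k)\|^{1-\theta}$. $T$ is uniquely ergodic if it has exactly one invariant Borel probability measure on $I$. Statement. Let $\pi=\begin{pmatrix}A&B&C&D\\D&C&B&A\end{pmatrix}$ (rows: the orders given by $\pi_0$ and $\pi_1$). (1) For all integers $m,n,p\ge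 0$, the arrow names $D^{3m+1}BC^nBDC^pD$ define a loop $\gamma_0(m,n,p)$ at $\pi$ in the Rauzy diagram and the names $A^{3m+1}CB^nCAB^pA$ define a loop $\gamma_1(m,n,p)$ at $\pi$; the products of the $V$ matrices along them are respectively $$Z_0(m,n,p)=\begin{pmatrix}1&0&0&0\\0&2&p+2&p+1\\0&n&(n+1)(p+1)&p(n+1)\\m+1&m(n+2)+1&m(n+2)(p+1)+m+1&pm(n+2)+m+1\end{pmatrix},$$ $$Z_1(m,n,p)=\begin{pmatrix}pm(n+2)+m+1&m(n+2)(p+1)+m+1&m(n+2)+1&m+1\\p(n+1)&(n+1)(p+1)&n&0\\p+1&p+2&2&0\\0&0&0&1\end{pmatrix}.$$ (2) Given $n_0\ge1$, put $m_0=0$, $m_1=n_0^3$ and, for $l\ge0$, $p_l=(n_0+3l)^2(n_0+3l+1)^2$, $n_{l+1}=(n_0+3l+1)^2(n_0+3l+2)^2$, $m_{l+2}=(n_0+3l+2)^2(n_0+3l+3)^2$. Let $\Gamma$ be the infinite path $\gamma_0(m_0,n_0,p_0)\gamma_1(m_1,n_1,p_1)\gamma_0(m_2,n_2,p_2)\cdots$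 from $\pi$; let $Z(k+1)=Z_\varepsilon(m_k,n_k,p_k)$ with $\varepsilon\equiv k$ mod $2$, let $Q(k)=Z(1)\cdots Z(k)$, and let $e_A(k),\dots,e_D(k)$ be the columns of $Q(k)$. Put $c_{-2}=1$ and $c_k=n_0^3[(n_0+k)!/n_0!]^2$ for $k\ge-1$. There are constants $N\ge 1$ and $K>0$ such that the following holds for every $n_0\ge N$, where $O(n_0^{-1})$ denotes a vector with all coordinates bounded by $K/n_0$, and where $v={}^t(1,0,0,1)$, $w={}^t(0,0,1,0)$. (i) For all $l\ge1$: $e_A(2l-1)=c_{6l-8}[v+O(n_0^{-1})]$, $e_B(2l-1)=c_{6l-7}[w+O(n_0^{-1})]$, $e_C(2l-1)$ and $e_D(2l-1)$ are $c_{6l-5}[w+O(n_0^{-1})]$, $e_D(2l)=c_{6l-5}[w+O(n_0^{-1})]$, $e_C(2l)=c_{6l-4}[v+O(n_0^{-1})]$, $e_B(2l)$ and $e_A(2l)$ are $c_{6l-2}[v+O(n_0^{-1})]$. (ii) As $k\to\infty$, with $n_0$ fixed, $\|Z(k+1)\|\asymp(n_0+3k)^{12}$, $\|Q(k)\|\asymp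 c_{3k-2}$ and $\|Z(k+1)\|=o\big((\log\|Q(k)\|)^{12}\big)$. (iii) There are vectors $u_A\ne u_D$ of $\ell^1$ norm $1$ with $u_A={}^t(\tfrac12,0,0,\tfrac12)+O(n_0^{-1})$ and $u_D={}^t(0,0,1,0)+O(n_0^{-1})$ such that, as $l\to\infty$, the $\ell^1$-normalized vectors $e_A(l)$, $e_B(2l)$, $e_C(2l)$ converge to $u_A$ and the $\ell^1$-normalized vectors $e_D(l)$, $e_C(2l+1)$, $e_B(2l+1)$ converge to $u_D$. (iv) The set of positive length vectors $u$ with $\sum_\alpha u_\alpha=1$ for which the i.e.m. $T_u$ with data $(\pi,u)$ has the Keane property and Rauzy path $\Gamma$ is exactly the segment $[u_A,u_D]$. (v) For every $u\in[u_A,u_D]$, the blocks defining the matrices $Z(k)$ of $T_u$ are exactly the successive loops of $\Gamma$, so that the matrices $Z(k)$ and $Q(k)$ of $T_u$ are those above; $T_u$ satisfies condition (a), is not uniquely ergodic, and does not satisfy condition (b). In particular condition (b) does not follow from condition (a). (vi) Any two of the maps $T_u$, $u\in[u_A,u_D]$, are topologically conjugate. -/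

import Mathlib

open MeasureTheory Filter Topology Asymptotics

noncomputable section

namespace IEM

/-- The permutation `σ` of the positions `0, …, d-1` used by the basic operation at position `p`:
positions `≤ p` are fixed, positions strictly between `p` and `d-1` are shifted by one to the right,
and the last position `d-1` goes to `p+1` (if `p = d-1`, this is the identity). -/
def insertAfter {d : ℕ} (p : Fin d) : Fin d ≃ Fin d where
  toFun i :=
    if h : i ≤ p then i
    else if h' : (i : ℕ) + 1 < d then ⟨i + 1, h'⟩
    else ⟨p + 1, by have := i.isLt; have h2 : (p : ℕ) < i := not_le.mp h; omega⟩
  invFun j :=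
    if j ≤ p then j
    else if (j : ℕ) = p + 1 then ⟨d - 1, by have := p.isLt; omega⟩
    else ⟨j - 1, by have := j.isLt; omega⟩
  left_inv i := by
    have hi := i.isLt
    have hp := p.isLt
    apply Fin.ext
    by_cases h : (i : ℕ) ≤ p
    · simp [Fin.le_def, h]
    · by_cases h' : (i : ℕ) + 1 < d
      · have h1 : ¬ ((i : ℕ) + 1 ≤ p) := by omega
        have h2 : (i : ℕ) ≠ p := by omega
        simp [Fin.le_def, h, h', h1, h2]
      · simp [Fin.le_def, h, h']
        omega
  right_inv j := by
    have hj := j.isLt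
    have hp := p.isLt
    apply Fin.ext
    by_cases h : (j : ℕ) ≤ p
    · simp [Fin.le_def, h]
    · by_cases h' : (j : ℕ) = p + 1
      · have h1 : ¬ (d - 1 ≤ (p : ℕ)) := by omega
        have h2 : ¬ (d - 1 + 1 < d) := by omega
        simp [Fin.le_def, h', h1, h2]
      · have h1 : ¬ ((j : ℕ) - 1 ≤ p) := by omega
        have h2 : (j : ℕ) - 1 + 1 < d := by omega
        simp [Fin.le_def, h, h', h1, h2]
        omega

variable {𝒜 : Type*} [Fintype 𝒜] [DecidableEq 𝒜] {d : ℕ} [NeZero d]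

/-- Combinatorial data `(π₀, π₁)`: two bijections from the alphabet onto the `d` positions
(numbered `0, …, d-1`). -/
abbrev Comb (𝒜 : Type*) (d : ℕ) := Fin 2 → (𝒜 ≃ Fin d)

/-- The letter `α_ε` in last position for `π_ε`. -/
def Comb.lastLetter (π : Comb 𝒜 d) (ε : Fin 2) : 𝒜 := (π ε).symm ⊤

/-- The Rauzy operation `R_ε`. -/
def Comb.rauzy (π : Comb 𝒜 d) (ε : Fin 2) : Comb 𝒜 d :=
  Function.update π (1 - ε)
    ((π (1 - ε)).trans (insertAfter (π (1 - ε) (π.lastLetter ε))))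

/-- The matrix `V = I + E_{α_ε α_{1-ε}}` of the arrow of type `ε` starting at `π`. -/
def Comb.V (π : Comb 𝒜 d) (ε : Fin 2) : Matrix 𝒜 𝒜 ℝ :=
  1 + Matrix.single (π.lastLetter ε) (π.lastLetter (1 - ε)) 1

/-- `RauzyPath π w π' M`: there is a path in the Rauzy diagram from `π` to `π'` whose successive
arrows have the names listed in `w`, and `M` is the product of the `V` matrices along this path. -/
inductive RauzyPath : Comb 𝒜 d → List 𝒜 → Comb 𝒜 d → Matrix 𝒜 𝒜 ℝ → Prop
  | nil (π : Comb 𝒜 d) : RauzyPath π [] π 1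
  | cons (π π' : Comb 𝒜 d) (ε : Fin 2) (w : List 𝒜) (M : Matrix 𝒜 𝒜 ℝ) :
      RauzyPath (π.rauzy ε) w π' M → RauzyPath π (π.lastLetter ε :: w) π' (π.V ε * M)

/-- The norm of a matrix: the sum of the absolute values of its coefficients. -/
def sumNorm (M : Matrix 𝒜 𝒜 ℝ) : ℝ := ∑ i, ∑ j, |M i j|

/-- Combinatorial and length data of an interval exchange map. (Positivity of the lengths is
required separately.) -/
structure Data (𝒜 : Type*) (d : ℕ) where
  comb : Comb 𝒜 d
  len : 𝒜 → ℝ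

namespace Data

/-- The total length `λ*`. -/
def total (T : Data 𝒜 d) : ℝ := ∑ α, T.len α

/-- The interval `I = [0, λ*)`. -/
def dom (T : Data 𝒜 d) : Set ℝ := Set.Ico 0 T.total

/-- `j_ε(0, α)`, the left endpoint of `j_ε(I_α)`. -/
def left (T : Data 𝒜 d) (ε : Fin 2) (α : 𝒜) : ℝ :=
  ∑ β with T.comb ε β < T.comb ε α, T.len β

/-- The interval exchange map: the point `j₀(x, α)`, `0 ≤ x < λ_α`, is sent to `j₁(x, α)`.
It is extended by the identity outside `I`. -/
def map (T : Data 𝒜 d) (y : ℝ) : ℝ :=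
  y + ∑ α, (Set.Ico (T.left 0 α) (T.left 0 α + T.len α)).indicator
    (fun _ => T.left 1 α - T.left 0 α) y

/-- The Keane property: there is no connexion `(α, β, m)`. -/
def Keane (T : Data 𝒜 d) : Prop :=
  ∀ (α β : 𝒜) (m : ℕ), T.comb 0 β ≠ ⊥ → 0 < m → T.map^[m] (T.left 0 α) ≠ T.left 0 β

/-- Unique ergodicity: there is exactly one invariant Borel probability measure on `I`. -/
def UniquelyErgodic (T : Data 𝒜 d) : Prop :=
  ∃! μ : Measure ℝ, IsProbabilityMeasure μ ∧ μ (T.dom)ᶜ = 0 ∧ MeasurePreserving T.map μ μ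

/-- Topological conjugacy of two interval exchange maps on their domains. -/
def TopConj (T T' : Data 𝒜 d) : Prop :=
  ∃ h : PartialEquiv ℝ ℝ, h.source = T.dom ∧ h.target = T'.dom ∧
    ContinuousOn h T.dom ∧ ContinuousOn h.symm T'.dom ∧
    ∀ y ∈ T.dom, h (T.map y) = T'.map (h y)

/-- The type of the basic operation applied to `T` (meaningful if `λ_{α₀} ≠ λ_{α₁}`, which holds
under the Keane property). -/
def type (T : Data 𝒜 d) : Fin 2 :=
  if T.len (T.comb.lastLetter 1) < T.len (T.comb.lastLetter 0) then 0 else 1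

/-- The basic operation. -/
def step (T : Data 𝒜 d) : Data 𝒜 d where
  comb := T.comb.rauzy T.type
  len := fun α =>
    if α = T.comb.lastLetter T.type then
      T.len (T.comb.lastLetter T.type) - T.len (T.comb.lastLetter (1 - T.type))
    else T.len α

/-- `n` iterations of the basic operation. -/
def iter (T : Data 𝒜 d) (n : ℕ) : Data 𝒜 d := step^[n] T

/-- The name of the arrow from the `n`-th to the `(n+1)`-st combinatorial data
(so these arrows are numbered from `0`). -/
def arrowName (T : Data 𝒜 d) (n : ℕ) : 𝒜 := (T.iter n).comb.lastLetter (T.iter n).type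

/-- The matrix `V` of the arrow from the `n`-th to the `(n+1)`-st combinatorial data. -/
def arrowV (T : Data 𝒜 d) (n : ℕ) : Matrix 𝒜 𝒜 ℝ := (T.iter n).comb.V (T.iter n).type

/-- The sequence `n_{d-1}(k)`, grouping successive arrows into maximal blocks in which no more than
`d - 1` names are taken. -/
def zorichTime (T : Data 𝒜 d) : ℕ → ℕ
  | 0 => 0
  | k + 1 => sSup {N | T.zorichTime k ≤ N ∧
      ((Finset.Ico (T.zorichTime k) N).image T.arrowName).card ≤ d - 1}

/-- The matrix usually denoted `Z(k+1)`: the product of the `V` matrices over the block of arrows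
number `n_{d-1}(k), …, n_{d-1}(k+1) - 1`. -/
def zorichZ (T : Data 𝒜 d) (k : ℕ) : Matrix 𝒜 𝒜 ℝ :=
  ((List.range' (T.zorichTime k) (T.zorichTime (k + 1) - T.zorichTime k)).map T.arrowV).prod

/-- `Q(k) = Z(1) ⋯ Z(k)`. -/
def zorichQ (T : Data 𝒜 d) (k : ℕ) : Matrix 𝒜 𝒜 ℝ := ((List.range k).map T.zorichZ).prod

/-- Condition (a): for every `ε > 0`, `‖Z(k+1)‖ ≤ C_ε ‖Q(k)‖ ^ ε` for all `k ≥ 0`. -/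
def CondA (T : Data 𝒜 d) : Prop :=
  ∀ ε : ℝ, 0 < ε → ∃ C : ℝ, 0 < C ∧
    ∀ k, sumNorm (T.zorichZ k) ≤ C * sumNorm (T.zorichQ k) ^ ε

/-- Condition (b): the operators `S(k) = ᵗQ(k)` restricted to the hyperplane
`Γ_* = {φ | ∑ λ_α φ_α = 0}` have norm at most `C ‖Q(k)‖ ^ (1 - θ)`
(`ℝ^𝒜` carries the supremum norm). -/
def CondB (T : Data 𝒜 d) : Prop :=
  ∃ θ C : ℝ, 0 < θ ∧ 0 < C ∧ ∀ (k : ℕ) (φ : 𝒜 → ℝ), ∑ α, T.len α * φ α = 0 →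
    ‖Matrix.mulVec (T.zorichQ k).transpose φ‖ ≤ C * sumNorm (T.zorichQ k) ^ (1 - θ) * ‖φ‖

/-- The path of `T` in the Rauzy diagram starts with the arrows named in `w`. -/
def StartsWith (T : Data 𝒜 d) (w : List 𝒜) : Prop :=
  (List.range w.length).map T.arrowName = w

end Data

/-! The four-letter example; the letters `A, B, C, D` are `0, 1, 2, 3`. -/

abbrev lA : Fin 4 := 0
abbrev lB : Fin 4 := 1
abbrev lC : Fin 4 := 2
abbrev lD : Fin 4 := 3

/-- The combinatorial data `(A B C D / D C B A)`. -/
def abcd : Comb (Fin 4) 4 := ![Equiv.refl _, Fin.revPerm]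

/-- Names of the arrows of `γ₀(m,n,p)`: `D^{3m+1} B C^n B D C^p D`. -/
def word0 (m n p : ℕ) : List (Fin 4) :=
  List.replicate (3 * m + 1) lD ++ [lB] ++ List.replicate n lC ++ [lB, lD] ++
    List.replicate p lC ++ [lD]

/-- Names of the arrows of `γ₁(m,n,p)`: `A^{3m+1} C B^n C A B^p A`. -/
def word1 (m n p : ℕ) : List (Fin 4) :=
  List.replicate (3 * m + 1) lA ++ [lC] ++ List.replicate n lB ++ [lC, lA] ++
    List.replicate p lB ++ [lA]

def Z0 (m n p : ℕ) : Matrix (Fin 4) (Fin 4) ℝ :=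
  (!![1, 0, 0, 0;
      0, 2, p + 2, p + 1;
      0, n, (n + 1) * (p + 1), p * (n + 1);
      m + 1, m * (n + 2) + 1, m * (n + 2) * (p + 1) + m + 1, p * m * (n + 2) + m + 1] :
    Matrix (Fin 4) (Fin 4) ℕ).map (fun x => (x : ℝ))

def Z1 (m n p : ℕ) : Matrix (Fin 4) (Fin 4) ℝ :=
  (!![p * m * (n + 2) + m + 1, m * (n + 2) * (p + 1) + m + 1, m * (n + 2) + 1, m + 1;
      p * (n + 1), (n + 1) * (p + 1), n, 0;
      p + 1, p + 2, 2, 0;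
      0, 0, 0, 1] :
    Matrix (Fin 4) (Fin 4) ℕ).map (fun x => (x : ℝ))

/-- The parameters `m_k`, as functions of `n₀`. -/
def mPar (n₀ : ℕ) : ℕ → ℕ
  | 0 => 0
  | 1 => n₀ ^ 3
  | l + 2 => (n₀ + 3 * l + 2) ^ 2 * (n₀ + 3 * l + 3) ^ 2

/-- The parameters `n_k`. -/
def nPar (n₀ : ℕ) : ℕ → ℕ
  | 0 => n₀
  | l + 1 => (n₀ + 3 * l + 1) ^ 2 * (n₀ + 3 * l + 2) ^ 2

/-- The parameters `p_k`. -/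
def pPar (n₀ : ℕ) (l : ℕ) : ℕ := (n₀ + 3 * l) ^ 2 * (n₀ + 3 * l + 1) ^ 2

/-- The `k`-th loop of the path: `γ₀` for even `k`, `γ₁` for odd `k`. -/
def loopWord (n₀ k : ℕ) : List (Fin 4) :=
  if Even k then word0 (mPar n₀ k) (nPar n₀ k) (pPar n₀ k)
  else word1 (mPar n₀ k) (nPar n₀ k) (pPar n₀ k)

/-- The names of the arrows in the first `k` loops of the infinite path `Γ`. -/
def gammaWord (n₀ k : ℕ) : List (Fin 4) := (List.range k).flatMap (loopWord n₀)

/-- The matrix of the `k`-th loop. -/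
def loopZ (n₀ k : ℕ) : Matrix (Fin 4) (Fin 4) ℝ :=
  if Even k then Z0 (mPar n₀ k) (nPar n₀ k) (pPar n₀ k)
  else Z1 (mPar n₀ k) (nPar n₀ k) (pPar n₀ k)

/-- `Q(k)`, the product of the matrices of the first `k` loops. -/
def loopQ (n₀ k : ℕ) : Matrix (Fin 4) (Fin 4) ℝ := ((List.range k).map (loopZ n₀)).prod

/-- `c_k = n₀³ [(n₀+k)!/n₀!]²` for `k ≥ -1`, and `c_{-2} = 1`. -/
def cScale (n₀ : ℕ) (k : ℤ) : ℝ :=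
  if k = -2 then 1
  else (n₀ : ℝ) ^ 3 * ((((n₀ : ℤ) + k).toNat.factorial : ℝ) / (n₀.factorial : ℝ)) ^ 2

/-- The column `j` of `Q(k)` equals `c · (v + r)` with `|r_i| ≤ K / n₀` for all `i`. -/
def ColApprox (K : ℝ) (n₀ k : ℕ) (j : Fin 4) (c : ℝ) (v : Fin 4 → ℝ) : Prop :=
  ∀ i, |loopQ n₀ k i j - c * v i| ≤ c * (K / n₀)

/-- The column `j` of `Q(k)` divided by its `ℓ¹` norm. -/
def normCol (n₀ k : ℕ) (j : Fin 4) : Fin 4 → ℝ :=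
  fun i => loopQ n₀ k i j / ∑ i', |loopQ n₀ k i' j|

end IEM

end

set_option linter.unusedSectionVars false

noncomputable section

namespace IEM

/-! The lengths whose Rauzy path is `Γ` are, up to scale, the intersection of the cones spanned by
the columns of `Q(k)`, so everything rests on the behaviour of these columns. The parameters are
quotients of the scales: `m_{k+1} = c_{3k}/c_{3k-2}`, `n_{k+1} = c_{3k+2}/c_{3k}`, `p_k =
c_{3k+1}/c_{3k-1}`. With the columns listed alternately as `A, B, C, D` and `D, C, B, A` (`altCol`),
both kinds of loop give the same recursion. In it the first three new columns are dominated by the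
old fourth one and the new fourth column by the old first one. After division by the expected sizes
(`nrm`), each step therefore copies directions up to an error `28/(n₀+3k)²`. These errors are
summable with sum `O(1/n₀)`, so the two directions `v` and `w` never mix (`nrm_sub_tgt`), and the
columns accumulate on exactly two directions `limDir n₀ 0` and `limDir n₀ 1`.

The intersection of the cones is then a segment (`mem_segment_of_startsWith`,
`gammaLengths_of_mem_segment`). The sizes of the columns grow faster than factorials while
`‖Z(k+1)‖` is polynomial in `k`, whence condition (a) (`exists_loopZ_le`). A vector of the
hyperplane that does not vanish on both limit directions is stretched by `ᵗQ(k)` as much as `‖Q(k)‖`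
allows along a subsequence, which contradicts (b) (`not_loop_bound`).

The dynamical statements come from a general principle. One basic operation is a first return map,
so an infinite Rauzy path with lengths tending to zero cuts the interval into Rokhlin floors of
vanishing width, whose order and transitions depend on the path alone. This gives the Keane property
(`keane_of_steppable`) and a conjugacy between any two maps with the same path (`Parallel.topConj`).
Carrying Lebesgue measure through the conjugacy from another point of the segment produces a second
invariant measure (`Parallel.not_uniquelyErgodic`). -/

lemma fin_two_one_sub_ne (t : Fin 2) : 1 - t ≠ t := by fin_cases t <;> decide

lemma fin_two_cases (t ε : Fin 2) : ε = t ∨ ε = 1 - t := by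
  fin_cases t <;> fin_cases ε <;> decide

/-! ### Geometry of one interval exchange and of one basic operation as a first return map. -/

section General

variable {𝒜 : Type*} [Fintype 𝒜] [DecidableEq 𝒜] {d : ℕ} [NeZero d]

namespace Data

/-- The interval `j_ε(I_α)`. -/
def piece (T : Data 𝒜 d) (ε : Fin 2) (α : 𝒜) : Set ℝ :=
  Set.Ico (T.left ε α) (T.left ε α + T.len α)

lemma left_add_len (T : Data 𝒜 d) (ε : Fin 2) (α : 𝒜) :
    T.left ε α + T.len α = ∑ β with T.comb ε β ≤ T.comb ε α, T.len β := by
  have : (Finset.univ.filter fun β => T.comb ε β ≤ T.comb ε α) =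
      insert α (Finset.univ.filter fun β => T.comb ε β < T.comb ε α) := by
    ext β
    simp only [Finset.mem_filter, Finset.mem_univ, true_and, Finset.mem_insert, le_iff_eq_or_lt,
      EmbeddingLike.apply_eq_iff_eq]
  rw [this, Finset.sum_insert (by simp), add_comm]
  rfl

lemma left_add_len_le_left {T : Data 𝒜 d} (hT : ∀ α, 0 < T.len α) {ε : Fin 2} {α β : 𝒜}
    (h : T.comb ε α < T.comb ε β) : T.left ε α + T.len α ≤ T.left ε β := by
  rw [left_add_len]
  refine Finset.sum_le_sum_of_subset_of_nonneg (fun γ hγ => ?_) fun γ _ _ => (hT γ).le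
  simp only [Finset.mem_filter, Finset.mem_univ, true_and] at hγ ⊢
  exact hγ.trans_lt h

lemma left_add_len_le_total {T : Data 𝒜 d} (hT : ∀ α, 0 < T.len α) (ε : Fin 2) (α : 𝒜) :
    T.left ε α + T.len α ≤ T.total := by
  rw [left_add_len]
  exact Finset.sum_le_sum_of_subset_of_nonneg (Finset.subset_univ _) fun γ _ _ => (hT γ).le

lemma left_nonneg {T : Data 𝒜 d} (hT : ∀ α, 0 < T.len α) (ε : Fin 2) (α : 𝒜) :
    0 ≤ T.left ε α :=
  Finset.sum_nonneg fun γ _ => (hT γ).le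

lemma left_lt_left {T : Data 𝒜 d} (hT : ∀ α, 0 < T.len α) {ε : Fin 2} {α β : 𝒜}
    (h : T.comb ε α < T.comb ε β) : T.left ε α < T.left ε β := by
  have := left_add_len_le_left hT h
  have := hT α
  linarith

lemma left_injective {T : Data 𝒜 d} (hT : ∀ α, 0 < T.len α) (ε : Fin 2) :
    Function.Injective (T.left ε) := by
  intro α β h
  rcases lt_trichotomy (T.comb ε α) (T.comb ε β) with h' | h' | h'
  · exact absurd h (left_lt_left hT h').ne
  · exact (T.comb ε).injective h'
  · exact absurd h (left_lt_left hT h').ne'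

lemma left_pos {T : Data 𝒜 d} (hT : ∀ α, 0 < T.len α) {ε : Fin 2} {α : 𝒜}
    (h : T.comb ε α ≠ ⊥) : 0 < T.left ε α := by
  have h1 : T.comb ε ((T.comb ε).symm ⊥) < T.comb ε α := by
    simpa using bot_lt_iff_ne_bot.2 h
  exact (left_nonneg hT ε _).trans_lt (left_lt_left hT h1)

lemma piece_subset_dom {T : Data 𝒜 d} (hT : ∀ α, 0 < T.len α) (ε : Fin 2) (α : 𝒜) :
    T.piece ε α ⊆ T.dom := fun _ hx =>
  ⟨(left_nonneg hT ε α).trans hx.1, hx.2.trans_le (left_add_len_le_total hT ε α)⟩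

lemma left_mem_piece {T : Data 𝒜 d} (hT : ∀ α, 0 < T.len α) (ε : Fin 2) (α : 𝒜) :
    T.left ε α ∈ T.piece ε α := ⟨le_rfl, by have := hT α; linarith⟩

lemma eq_of_mem_piece {T : Data 𝒜 d} (hT : ∀ α, 0 < T.len α) {ε : Fin 2} {α β : 𝒜} {x : ℝ}
    (hα : x ∈ T.piece ε α) (hβ : x ∈ T.piece ε β) : α = β := by
  obtain ⟨h1, h2⟩ := hα
  obtain ⟨h3, h4⟩ := hβ
  rcases lt_trichotomy (T.comb ε α) (T.comb ε β) with h' | h' | h'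
  · have := left_add_len_le_left hT h'
    linarith
  · exact (T.comb ε).injective h'
  · have := left_add_len_le_left hT h'
    linarith

lemma left_add_len_last (T : Data 𝒜 d) (ε : Fin 2) :
    T.left ε (T.comb.lastLetter ε) + T.len (T.comb.lastLetter ε) = T.total := by
  rw [left_add_len]
  simp [Comb.lastLetter, total]

lemma exists_mem_piece (T : Data 𝒜 d) (ε : Fin 2) {x : ℝ}
    (hx : x ∈ T.dom) : ∃ α, x ∈ T.piece ε α := by
  -- The piece containing `x` is the rightmost one whose left endpoint does not exceed `x`.
  let S := Finset.univ.filter fun α => T.left ε α ≤ x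
  have hS : S.Nonempty := by
    refine ⟨(T.comb ε).symm ⊥, ?_⟩
    simp only [S, Finset.mem_filter, Finset.mem_univ, true_and]
    refine le_trans (le_of_eq ?_) hx.1
    simp [left]
  obtain ⟨α, hα, hmax⟩ := S.exists_max_image (fun α => T.comb ε α) hS
  simp only [S, Finset.mem_filter, Finset.mem_univ, true_and] at hα hmax
  refine ⟨α, hα, ?_⟩
  by_contra! hlt
  by_cases htop : (T.comb ε α : ℕ) + 1 < d
  · let β := (T.comb ε).symm ⟨T.comb ε α + 1, htop⟩
    have hβ : T.comb ε β = ⟨T.comb ε α + 1, htop⟩ := by simp [β]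
    have h1 : T.left ε β = T.left ε α + T.len α := by
      rw [left_add_len, left, hβ]
      congr 1
      ext γ
      simp only [Finset.mem_filter, Finset.mem_univ, true_and, Fin.lt_def, Fin.le_def]
      omega
    have h2 := hmax β (h1.le.trans hlt)
    have h3 : (T.comb ε α : ℕ) + 1 ≤ T.comb ε α := by
      rw [hβ] at h2
      exact h2
    omega
  · have h1 : T.left ε α + T.len α = T.total := by
      rw [left_add_len, total]
      congr 1
      ext γ
      have := (T.comb ε γ).isLt
      simp only [Finset.mem_filter, Finset.mem_univ, true_and, Fin.le_def, iff_true]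
      omega
    have := hx.2
    linarith

lemma map_of_mem_piece {T : Data 𝒜 d} (hT : ∀ α, 0 < T.len α) {α : 𝒜} {x : ℝ}
    (hx : x ∈ T.piece 0 α) : T.map x = x + (T.left 1 α - T.left 0 α) := by
  rw [map, Finset.sum_eq_single α]
  · rw [Set.indicator_of_mem (by exact hx)]
  · intro β _ hβ
    exact Set.indicator_of_notMem (fun h => hβ (eq_of_mem_piece hT h hx)) _
  · simp

lemma map_mem_piece {T : Data 𝒜 d} (hT : ∀ α, 0 < T.len α) {α : 𝒜} {x : ℝ}
    (hx : x ∈ T.piece 0 α) : T.map x ∈ T.piece 1 α := by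
  rw [map_of_mem_piece hT hx]
  obtain ⟨h1, h2⟩ := hx
  constructor <;> linarith

lemma map_mem_dom {T : Data 𝒜 d} (hT : ∀ α, 0 < T.len α) {x : ℝ} (hx : x ∈ T.dom) :
    T.map x ∈ T.dom := by
  obtain ⟨α, hα⟩ := T.exists_mem_piece 0 hx
  exact piece_subset_dom hT 1 α (map_mem_piece hT hα)

lemma map_injOn {T : Data 𝒜 d} (hT : ∀ α, 0 < T.len α) : Set.InjOn T.map T.dom := by
  intro x hx y hy h
  obtain ⟨α, hα⟩ := T.exists_mem_piece 0 hx
  obtain ⟨β, hβ⟩ := T.exists_mem_piece 0 hy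
  have h1 := map_mem_piece hT hα
  rw [h] at h1
  obtain rfl := eq_of_mem_piece hT h1 (map_mem_piece hT hβ)
  rw [map_of_mem_piece hT hα, map_of_mem_piece hT hβ] at h
  linarith

/-- The winner of the basic operation. -/
abbrev win (T : Data 𝒜 d) : 𝒜 := T.comb.lastLetter T.type

/-- The loser of the basic operation. -/
abbrev lose (T : Data 𝒜 d) : 𝒜 := T.comb.lastLetter (1 - T.type)

/-- The basic operation applies to `T`, and gives positive lengths. -/
structure Steppable (T : Data 𝒜 d) : Prop where
  ne : T.comb.lastLetter 0 ≠ T.comb.lastLetter 1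
  pos : ∀ α, 0 < T.len α
  lt : T.len T.lose < T.len T.win

lemma Steppable.win_ne_lose {T : Data 𝒜 d} (h : T.Steppable) : T.win ≠ T.lose := by
  have := h.ne
  unfold win lose
  generalize T.type = t
  fin_cases t
  · exact this
  · exact this.symm

lemma step_len_win (T : Data 𝒜 d) : T.step.len T.win = T.len T.win - T.len T.lose := by
  simp [step, win, lose]

lemma step_len_of_ne (T : Data 𝒜 d) {α : 𝒜} (h : α ≠ T.win) : T.step.len α = T.len α := by
  simp [step, h]

lemma Steppable.step_len_lose {T : Data 𝒜 d} (h : T.Steppable) :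
    T.step.len T.lose = T.len T.lose := T.step_len_of_ne h.win_ne_lose.symm

lemma Steppable.step_pos {T : Data 𝒜 d} (h : T.Steppable) (α : 𝒜) : 0 < T.step.len α := by
  by_cases hα : α = T.win
  · rw [hα, step_len_win]
    linarith [h.lt]
  · rw [T.step_len_of_ne hα]
    exact h.pos α

lemma sum_step_len (T : Data 𝒜 d) (s : Finset 𝒜) :
    ∑ α ∈ s, T.step.len α = ∑ α ∈ s, T.len α - if T.win ∈ s then T.len T.lose else 0 := by
  rw [eq_sub_iff_add_eq, ← Finset.sum_ite_eq' s T.win fun _ => T.len T.lose,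
    ← Finset.sum_add_distrib]
  refine Finset.sum_congr rfl fun α _ => ?_
  by_cases hα : α = T.win
  · simp [hα, step_len_win]
  · simp [hα, step_len_of_ne]

lemma step_total (T : Data 𝒜 d) : T.step.total = T.total - T.len T.lose := by
  simp [total, sum_step_len]

lemma step_comb_type (T : Data 𝒜 d) : T.step.comb T.type = T.comb T.type := by
  simp only [step, Comb.rauzy]
  rw [Function.update_of_ne (fin_two_one_sub_ne _).symm]

lemma step_comb_other (T : Data 𝒜 d) : T.step.comb (1 - T.type) =
    (T.comb (1 - T.type)).trans (insertAfter (T.comb (1 - T.type) T.win)) := by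
  simp [step, Comb.rauzy]

lemma comb_lastLetter (T : Data 𝒜 d) (ε : Fin 2) : (T.comb ε (T.comb.lastLetter ε) : ℕ) = d - 1 := by
  obtain ⟨n, rfl⟩ := Nat.exists_eq_succ_of_ne_zero (NeZero.ne d)
  simp [Comb.lastLetter, Fin.top_eq_last]

lemma comb_lt_last (T : Data 𝒜 d) {ε : Fin 2} {α : 𝒜} (h : α ≠ T.comb.lastLetter ε) :
    (T.comb ε α : ℕ) < d - 1 := by
  have h1 := (T.comb ε α).isLt
  have h2 : (T.comb ε α : ℕ) ≠ d - 1 := by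
    rw [← comb_lastLetter T ε]
    exact fun h' => h ((T.comb ε).injective (Fin.ext h'))
  omega

/-- In this row the winner comes last, so its shortening is never counted in a left endpoint. -/
lemma step_left_type (T : Data 𝒜 d) (α : 𝒜) : T.step.left T.type α = T.left T.type α := by
  rw [left, left, step_comb_type, sum_step_len, if_neg, sub_zero]
  simp only [Finset.mem_filter, Finset.mem_univ, true_and, not_lt, Fin.le_def]
  rw [comb_lastLetter]
  have := (T.comb T.type α).isLt
  omega

lemma _root_.IEM.insertAfter_val (p i : Fin d) : (insertAfter p i : ℕ) =
    if (i : ℕ) ≤ p then (i : ℕ) else if (i : ℕ) + 1 < d then i + 1 else p + 1 := by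
  simp only [insertAfter, Equiv.coe_fn_mk, Fin.le_def]
  split_ifs <;> rfl

lemma step_comb_other_val (T : Data 𝒜 d) (α : 𝒜) : (T.step.comb (1 - T.type) α : ℕ) =
    if (T.comb (1 - T.type) α : ℕ) ≤ T.comb (1 - T.type) T.win then
      (T.comb (1 - T.type) α : ℕ) else if (T.comb (1 - T.type) α : ℕ) + 1 < d then
      T.comb (1 - T.type) α + 1 else T.comb (1 - T.type) T.win + 1 := by
  rw [step_comb_other, Equiv.trans_apply, insertAfter_val]

/-- Letters up to the winner see no change. For the letters after it, the inserted loser adds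
exactly the length that the winner has lost. -/
lemma Steppable.step_left_other {T : Data 𝒜 d} (h : T.Steppable) {α : 𝒜} (hα : α ≠ T.lose) :
    T.step.left (1 - T.type) α = T.left (1 - T.type) α := by
  have hl : (T.comb (1 - T.type) T.lose : ℕ) = d - 1 := comb_lastLetter T (1 - T.type)
  have hα' := comb_lt_last T hα
  have hw := comb_lt_last T h.win_ne_lose
  by_cases hle : (T.comb (1 - T.type) α : ℕ) ≤ T.comb (1 - T.type) T.win
  · have hS : (Finset.univ.filter fun β => T.step.comb (1 - T.type) β < T.step.comb (1 - T.type) α)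
        = Finset.univ.filter fun β => T.comb (1 - T.type) β < T.comb (1 - T.type) α := by
      ext β
      have := (T.comb (1 - T.type) β).isLt
      simp only [Finset.mem_filter, Finset.mem_univ, true_and, Fin.lt_def, step_comb_other_val]
      split_ifs <;> omega
    rw [left, left, hS, sum_step_len, if_neg, sub_zero]
    simp only [Finset.mem_filter, Finset.mem_univ, true_and, Fin.lt_def]
    omega
  · have hS : (Finset.univ.filter fun β => T.step.comb (1 - T.type) β < T.step.comb (1 - T.type) α)
        = insert T.lose
          (Finset.univ.filter fun β => T.comb (1 - T.type) β < T.comb (1 - T.type) α) := by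
      ext β
      have h1 := (T.comb (1 - T.type) β).isLt
      have h2 : β = T.lose ↔ (T.comb (1 - T.type) β : ℕ) = d - 1 := by
        constructor
        · rintro rfl; exact hl
        · intro h'; by_contra h3; exact (comb_lt_last T h3).ne h'
      simp only [Finset.mem_filter, Finset.mem_univ, true_and, Fin.lt_def, step_comb_other_val,
        Finset.mem_insert, h2]
      split_ifs <;> omega
    rw [left, left, hS, sum_step_len, if_pos, Finset.sum_insert]
    · ring
    · simp only [Finset.mem_filter, Finset.mem_univ, true_and, Fin.lt_def]
      omega
    · simp only [Finset.mem_insert, Finset.mem_filter, Finset.mem_univ, true_and, Fin.lt_def]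
      omega

lemma Steppable.step_left_lose {T : Data 𝒜 d} (h : T.Steppable) :
    T.step.left (1 - T.type) T.lose =
      T.left (1 - T.type) T.win + T.len T.win - T.len T.lose := by
  have hl : (T.comb (1 - T.type) T.lose : ℕ) = d - 1 := comb_lastLetter T (1 - T.type)
  have hw := comb_lt_last T h.win_ne_lose
  have hS : (Finset.univ.filter fun β =>
        T.step.comb (1 - T.type) β < T.step.comb (1 - T.type) T.lose)
      = Finset.univ.filter fun β => T.comb (1 - T.type) β ≤ T.comb (1 - T.type) T.win := by
    ext β
    have := (T.comb (1 - T.type) β).isLt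
    simp only [Finset.mem_filter, Finset.mem_univ, true_and, Fin.lt_def, Fin.le_def,
      step_comb_other_val]
    split_ifs <;> omega
  rw [left_add_len, left, hS, sum_step_len, if_pos]
  simp

/-- The displacement of the loser interval of `T.step` under `T`. -/
def shift (T : Data 𝒜 d) : ℝ := T.step.total - T.step.left 0 T.lose

/-- Both endpoints of such a letter are unchanged, hence so is its translation; only the winner's
interval has been shortened. -/
lemma Steppable.step_map_of_ne {T : Data 𝒜 d} (h : T.Steppable) {α : 𝒜} (hα : α ≠ T.lose)
    {x : ℝ} (hx : x ∈ T.step.piece 0 α) : x ∈ T.piece 0 α ∧ T.map x = T.step.map x := by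
  have h0 : ∀ ε, T.step.left ε α = T.left ε α := fun ε => by
    rcases fin_two_cases T.type ε with h1 | h1 <;> rw [h1]
    · exact step_left_type T α
    · exact h.step_left_other hα
  have h1 : x ∈ T.piece 0 α := by
    obtain ⟨h1, h2⟩ := hx
    rw [h0] at h1 h2
    refine ⟨h1, h2.trans_le ?_⟩
    gcongr
    by_cases hw : α = T.win
    · rw [hw, step_len_win]
      linarith [h.pos T.lose]
    · rw [step_len_of_ne _ hw]
  refine ⟨h1, ?_⟩
  rw [map_of_mem_piece h.pos h1, map_of_mem_piece h.step_pos hx, h0, h0]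

lemma Steppable.mem_piece_last {T : Data 𝒜 d} (h : T.Steppable) {x : ℝ}
    (h1 : T.step.total ≤ x) (h2 : x < T.total) : x ∈ T.piece 0 (T.comb.lastLetter 0) := by
  have h3 := left_add_len_last T 0
  rw [step_total] at h1
  refine ⟨?_, by linarith⟩
  have h4 : T.len T.lose ≤ T.len (T.comb.lastLetter 0) := by
    rcases fin_two_cases T.type 0 with h5 | h5
    · rw [h5]; exact h.lt.le
    · rw [h5]
  linarith

/-- The letter of the interval of `T` that contains the loser interval of `T.step`. -/
def loseIn (T : Data 𝒜 d) : 𝒜 := T.comb.lastLetter 1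

/-- On the loser's interval the first return to the shortened domain takes two iterates: the first
is the translation onto the removed piece on the right, the second brings the point back. The two
types differ in which row holds the loser and need separate bookkeeping. -/
lemma Steppable.step_map_lose {T : Data 𝒜 d} (h : T.Steppable)
    {x : ℝ} (hx : x ∈ T.step.piece 0 T.lose) :
    x ∈ T.piece 0 T.loseIn ∧ T.map x = x + T.shift ∧ T.map (x + T.shift) = T.step.map x := by
  have hlt := h.lt
  have hp := h.pos T.lose
  have hmap := map_of_mem_piece h.step_pos hx
  obtain ⟨h1, h2⟩ := hx
  rw [h.step_len_lose] at h2
  have htot := step_total T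
  have hlast : x + T.shift ∈ T.piece 0 (T.comb.lastLetter 0) := by
    apply h.mem_piece_last
    · rw [shift]; linarith
    · rw [shift]; linarith
  have hA := step_left_type T T.lose
  have hB := h.step_left_lose
  have hL0 := left_add_len_last T 0
  have hL1 := left_add_len_last T 1
  have hm2 := map_of_mem_piece h.pos hlast
  rcases (by omega : T.type = 0 ∨ T.type = 1) with ht | ht
  · have e1 : T.lose = T.comb.lastLetter 1 := by simp [lose, ht]
    have e2 : T.win = T.comb.lastLetter 0 := by simp [win, ht]
    have e3 : (1 - T.type) = 1 := by simp [ht]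
    rw [ht] at hA
    rw [e3] at hB
    have hx : x ∈ T.piece 0 T.loseIn := by
      rw [loseIn, ← e1]
      exact ⟨by linarith, by linarith⟩
    have hm1 := map_of_mem_piece h.pos hx
    rw [loseIn] at hm1
    refine ⟨hx, ?_, ?_⟩
    · rw [hm1, shift]
      rw [e1] at hA htot ⊢
      linarith
    · rw [hm2, hmap, shift]
      rw [e1] at hA hB htot ⊢
      rw [e2] at hB
      linarith
  · have e1 : T.lose = T.comb.lastLetter 0 := by simp [lose, ht]
    have e2 : T.win = T.comb.lastLetter 1 := by simp [win, ht]
    have e3 : (1 - T.type) = 0 := by simp [ht]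
    rw [ht] at hA
    rw [e3] at hB
    have hx : x ∈ T.piece 0 T.loseIn := by
      rw [loseIn, ← e2]
      exact ⟨by linarith, by linarith⟩
    have hm1 := map_of_mem_piece h.pos hx
    rw [loseIn] at hm1
    refine ⟨hx, ?_, ?_⟩
    · rw [hm1, shift]
      rw [e2] at hB
      linarith
    · rw [hm2, hmap, shift]
      rw [e1] at hA hB htot ⊢
      rw [e2] at hB
      linarith

/-- The removed piece has the length of the loser and is the translate of the loser's new interval,
so each removed point belongs to a unique floor above that interval. -/
lemma Steppable.sub_shift_mem {T : Data 𝒜 d} (h : T.Steppable) {x : ℝ}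
    (h1 : T.step.total ≤ x) (h2 : x < T.total) : x - T.shift ∈ T.step.piece 0 T.lose := by
  have h3 := step_total T
  have h4 := h.step_len_lose
  rw [shift]
  constructor <;> linarith

lemma Steppable.step_total_le_map_lose {T : Data 𝒜 d} (h : T.Steppable)
    {x : ℝ} (hx : x ∈ T.step.piece 0 T.lose) : T.step.total ≤ T.map x := by
  rw [(h.step_map_lose hx).2.1, shift]
  linarith [hx.1]

lemma Steppable.step_dom_subset {T : Data 𝒜 d} (h : T.Steppable) : T.step.dom ⊆ T.dom := by
  intro x hx
  refine ⟨hx.1, hx.2.trans_le ?_⟩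
  rw [step_total]
  linarith [h.pos T.lose]

end Data
end General

/-! ### Rokhlin towers and the conjugacy between two maps with the same Rauzy path. -/

section Parallel

variable {𝒜 : Type*} [Fintype 𝒜] [DecidableEq 𝒜] {d : ℕ} [NeZero d]

namespace Data

lemma Steppable.shift_bounds {T : Data 𝒜 d} (h : T.Steppable) {x : ℝ}
    (hx : x ∈ T.step.piece 0 T.lose) :
    T.step.total ≤ x + T.shift ∧ x + T.shift < T.total := by
  have h3 := step_total T
  have h4 := h.step_len_lose
  obtain ⟨h1, h2⟩ := hx
  rw [shift]
  constructor <;> linarith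

/-- Two interval exchange maps with the same infinite Rauzy path. -/
structure Parallel (T S : Data 𝒜 d) : Prop where
  left : ∀ n, (T.iter n).Steppable
  right : ∀ n, (S.iter n).Steppable
  comb : ∀ n, (T.iter n).comb = (S.iter n).comb
  type : ∀ n, (T.iter n).type = (S.iter n).type

variable {T S : Data 𝒜 d}

lemma Parallel.symm (h : Parallel T S) : Parallel S T :=
  ⟨h.right, h.left, fun n => (h.comb n).symm, fun n => (h.type n).symm⟩

lemma Parallel.step (h : Parallel T S) : Parallel T.step S.step :=
  ⟨fun n => h.left (n + 1), fun n => h.right (n + 1), fun n => h.comb (n + 1),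
    fun n => h.type (n + 1)⟩

lemma Parallel.lose_eq (h : Parallel T S) : T.lose = S.lose := by
  have h1 := h.comb 0
  have h2 := h.type 0
  simp only [iter, Function.iterate_zero, id] at h1 h2
  rw [lose, lose, h1, h2]

lemma Parallel.comb_eq (h : Parallel T S) : T.comb = S.comb := h.comb 0

lemma iter_step (T : Data 𝒜 d) (n : ℕ) : T.step.iter n = T.iter (n + 1) := rfl

/-- `Rel n T S x y`: the points `x` and `y` lie in corresponding floors of the Rokhlin towers over
the intervals of the `n`-th iterates of `T` and `S`. -/
def Rel : ℕ → Data 𝒜 d → Data 𝒜 d → ℝ → ℝ → Prop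
  | 0, T, S, x, y => ∃ α, x ∈ T.piece 0 α ∧ y ∈ S.piece 0 α
  | n + 1, T, S, x, y => Rel n T.step S.step x y ∨
      ∃ x' ∈ T.step.piece 0 T.lose, ∃ y' ∈ S.step.piece 0 S.lose,
        x = x' + T.shift ∧ y = y' + S.shift ∧ Rel n T.step S.step x' y'

lemma Rel.symm {n : ℕ} {T S : Data 𝒜 d} {x y : ℝ} (h : Rel n T S x y) : Rel n S T y x := by
  induction n generalizing T S x y with
  | zero =>
    obtain ⟨α, h1, h2⟩ := h
    exact ⟨α, h2, h1⟩
  | succ n ih =>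
    rcases h with h | ⟨x', hx', y', hy', hx, hy, h⟩
    · exact Or.inl (ih h)
    · exact Or.inr ⟨y', hy', x', hx', hy, hx, ih h⟩

/-- Every floor of the towers lies in a single interval of continuity, and corresponding floors lie
in intervals with the same letter. -/
lemma Rel.exists_piece {n : ℕ} {T S : Data 𝒜 d} {x y : ℝ} (hP : Parallel T S)
    (h : Rel n T S x y) : ∃ α, x ∈ T.piece 0 α ∧ y ∈ S.piece 0 α := by
  induction n generalizing T S x y with
  | zero => exact h
  | succ n ih =>
    have hT : T.Steppable := hP.left 0
    have hS : S.Steppable := hP.right 0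
    rcases h with h | ⟨x', hx', y', hy', rfl, rfl, h⟩
    · obtain ⟨α, h1, h2⟩ := ih hP.step h
      by_cases hα : α = T.lose
      · refine ⟨T.loseIn, (hT.step_map_lose (hα ▸ h1)).1, ?_⟩
        rw [loseIn, hP.comb_eq]
        exact (hS.step_map_lose (hP.lose_eq ▸ hα ▸ h2)).1
      · exact ⟨α, (hT.step_map_of_ne hα h1).1, (hS.step_map_of_ne (hP.lose_eq ▸ hα) h2).1⟩
    · refine ⟨T.comb.lastLetter 0, ?_, ?_⟩
      · exact hT.mem_piece_last (hT.shift_bounds hx').1 (hT.shift_bounds hx').2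
      · rw [hP.comb_eq]
        exact hS.mem_piece_last (hS.shift_bounds hy').1 (hS.shift_bounds hy').2

lemma Rel.mem_dom_left {n : ℕ} {T S : Data 𝒜 d} {x y : ℝ} (hP : Parallel T S)
    (h : Rel n T S x y) : x ∈ T.dom := by
  obtain ⟨α, h1, -⟩ := h.exists_piece hP
  exact piece_subset_dom (hP.left 0).pos 0 α h1

lemma Rel.mem_dom_right {n : ℕ} {T S : Data 𝒜 d} {x y : ℝ} (hP : Parallel T S)
    (h : Rel n T S x y) : y ∈ S.dom := h.symm.mem_dom_left hP.symm

lemma exists_rel (n : ℕ) {T S : Data 𝒜 d} {x : ℝ} (hP : Parallel T S) (hx : x ∈ T.dom) :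
    ∃ y, Rel n T S x y := by
  induction n generalizing T S x with
  | zero =>
    obtain ⟨α, hα⟩ := T.exists_mem_piece 0 hx
    exact ⟨S.left 0 α, α, hα, left_mem_piece (hP.right 0).pos 0 α⟩
  | succ n ih =>
    have hT : T.Steppable := hP.left 0
    by_cases hlt : x < T.step.total
    · obtain ⟨y, hy⟩ := ih hP.step ⟨hx.1, hlt⟩
      exact ⟨y, Or.inl hy⟩
    · have h1 := hT.sub_shift_mem (not_lt.1 hlt) hx.2
      obtain ⟨y, hy⟩ := ih hP.step (piece_subset_dom hT.step_pos 0 _ h1)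
      obtain ⟨α, h2, h3⟩ := hy.exists_piece hP.step
      obtain rfl := eq_of_mem_piece hT.step_pos h1 h2
      exact ⟨y + S.shift, Or.inr ⟨_, h1, y, hP.lose_eq ▸ h3, by ring, rfl, hy⟩⟩

lemma total_nonneg {T : Data 𝒜 d} (h : ∀ α, 0 < T.len α) : 0 ≤ T.total :=
  Finset.sum_nonneg fun α _ => (h α).le

/-- Floors occur in the same order for both maps, and a floor is no wider than the `n`-th domain;
points this far apart are thus in different floors. In the induction, the removed piece lies to the
right of the remaining domain for both maps, which settles the mixed cases. -/
lemma Rel.lt_of_add_le {n : ℕ} {T S : Data 𝒜 d} {x y x' y' : ℝ} (hP : Parallel T S)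
    (h : Rel n T S x y) (h' : Rel n T S x' y') (hle : x + (T.iter n).total ≤ x') : y < y' := by
  induction n generalizing T S x y x' y' with
  | zero =>
    have h1 := h.mem_dom_left hP
    have h2 := h'.mem_dom_left hP
    have : (T.iter 0).total = T.total := rfl
    linarith [h1.1, h2.2]
  | succ n ih =>
    have hT : T.Steppable := hP.left 0
    have hS : S.Steppable := hP.right 0
    have hpos := total_nonneg (hP.left (n + 1)).pos
    rw [← iter_step] at hle hpos
    rcases h with h | ⟨a, ha, b, hb, rfl, rfl, h⟩ <;>
      rcases h' with h' | ⟨a', ha', b', hb', rfl, rfl, h'⟩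
    · exact ih hP.step h h' hle
    · exact (h.mem_dom_right hP.step).2.trans_le (hS.shift_bounds hb').1
    · have h1 := (h'.mem_dom_left hP.step).2
      have h2 := (hT.shift_bounds ha).1
      linarith
    · have := ih hP.step h h' (by linarith)
      linarith

lemma Rel.of_succ {n : ℕ} {T S : Data 𝒜 d} {x y : ℝ} (hP : Parallel T S)
    (h : Rel (n + 1) T S x y) : Rel n T S x y := by
  induction n generalizing T S x y with
  | zero => exact h.exists_piece hP
  | succ n ih =>
    rcases h with h | ⟨x', hx', y', hy', hx, hy, h⟩
    · exact Or.inl (ih hP.step h)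
    · exact Or.inr ⟨x', hx', y', hy', hx, hy, ih hP.step h⟩

lemma Rel.of_le {n m : ℕ} (hnm : n ≤ m) {T S : Data 𝒜 d} {x y : ℝ} (hP : Parallel T S)
    (h : Rel m T S x y) : Rel n T S x y := by
  induction hnm with
  | refl => exact h
  | step _ ih => exact ih (h.of_succ hP)

/-- The condition on `T.map x` says that the image is outside the base of the towers, so `x` is not
in a top floor and both points climb to the next floor. At level zero there is nothing above the
base. -/
lemma Rel.map {n : ℕ} {T S : Data 𝒜 d} {x y : ℝ} (hP : Parallel T S)
    (h : Rel n T S x y) (hx : (T.iter n).total ≤ T.map x) :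
    Rel n T S (T.map x) (S.map y) := by
  induction n generalizing T S x y with
  | zero =>
    have h1 := map_mem_dom (hP.left 0).pos (h.mem_dom_left hP)
    exact absurd h1.2 (not_lt.2 hx)
  | succ n ih =>
    have hT : T.Steppable := hP.left 0
    have hS : S.Steppable := hP.right 0
    rw [← iter_step] at hx
    rcases h with h | ⟨x', hx', y', hy', rfl, rfl, h⟩
    · obtain ⟨α, h1, h2⟩ := h.exists_piece hP.step
      by_cases hα : α = T.lose
      · subst hα
        have h3 : y ∈ S.step.piece 0 S.lose := hP.lose_eq ▸ h2
        exact Or.inr ⟨x, h1, y, h3, (hT.step_map_lose h1).2.1, (hS.step_map_lose h3).2.1, h⟩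
      · have h3 := (hT.step_map_of_ne hα h1).2
        rw [h3, (hS.step_map_of_ne (hP.lose_eq ▸ hα) h2).2]
        exact Or.inl (ih hP.step h (by rwa [← h3]))
    · have h3 := (hT.step_map_lose hx').2.2
      rw [h3, (hS.step_map_lose hy').2.2]
      exact Or.inl (ih hP.step h (by rwa [← h3]))

/-- Both points lie in the floor corresponding to that of `x`. If they were too far apart,
`Rel.lt_of_add_le` with the roles of the maps exchanged would give `x < x`. -/
lemma Rel.abs_sub_lt {n : ℕ} {T S : Data 𝒜 d} {x y y' : ℝ} (hP : Parallel T S)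
    (h : Rel n T S x y) (h' : Rel n T S x y') : |y - y'| ≤ (S.iter n).total := by
  rw [abs_sub_le_iff]
  constructor
  · by_contra! h1
    exact lt_irrefl x (h'.symm.lt_of_add_le hP.symm h.symm (by linarith))
  · by_contra! h1
    exact lt_irrefl x (h.symm.lt_of_add_le hP.symm h'.symm (by linarith))

/-- An approximation of the conjugacy: some point related to `x` at level `n`. -/
def approx (T S : Data 𝒜 d) (n : ℕ) (x : ℝ) : ℝ := Classical.epsilon fun y => Rel n T S x y

lemma rel_approx (hP : Parallel T S) (n : ℕ) {x : ℝ} (hx : x ∈ T.dom) :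
    Rel n T S x (approx T S n x) :=
  Classical.epsilon_spec (p := fun y => Rel n T S x y) (exists_rel n hP hx)

/-- The conjugacy between two interval exchange maps with the same Rauzy path. -/
def conj (T S : Data 𝒜 d) (x : ℝ) : ℝ := limUnder atTop fun n => approx T S n x

lemma tendsto_approx (hP : Parallel T S) (hS : Tendsto (fun n => (S.iter n).total) atTop (𝓝 0))
    {x : ℝ} (hx : x ∈ T.dom) : Tendsto (fun n => approx T S n x) atTop (𝓝 (conj T S x)) := by
  refine CauchySeq.tendsto_limUnder (cauchySeq_of_le_tendsto_0' _ (fun n m hnm => ?_) hS)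
  exact (rel_approx hP n hx).abs_sub_lt hP ((rel_approx hP m hx).of_le hnm hP)

lemma approx_lt (hP : Parallel T S) {n m k : ℕ} (hn : k ≤ n) (hm : k ≤ m) {x x' : ℝ}
    (hx : x ∈ T.dom) (hx' : x' ∈ T.dom) (h : x + (T.iter k).total ≤ x') :
    approx T S n x < approx T S m x' :=
  ((rel_approx hP n hx).of_le hn hP).lt_of_add_le hP ((rel_approx hP m hx').of_le hm hP) h

lemma conj_strictMonoOn (hP : Parallel T S)
    (hT : Tendsto (fun n => (T.iter n).total) atTop (𝓝 0))
    (hS : Tendsto (fun n => (S.iter n).total) atTop (𝓝 0)) :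
    StrictMonoOn (conj T S) T.dom := by
  intro x hx x' hx' hlt
  obtain ⟨k, hk⟩ := (hT.eventually (gt_mem_nhds (show (0 : ℝ) < (x' - x) / 3 by linarith))).exists
  set δ := (x' - x) / 3 with hδ
  -- Two intermediate points at a fixed level provide a strict inequality that survives the passage
  -- to the limit.
  have h1 : x + δ ∈ T.dom := ⟨by linarith [hx.1], by linarith [hx'.2]⟩
  have h2 : x + 2 * δ ∈ T.dom := ⟨by linarith [hx.1], by linarith [hx'.2]⟩
  have h3 : conj T S x ≤ approx T S k (x + δ) :=
    le_of_tendsto (tendsto_approx hP hS hx) (eventually_atTop.2 ⟨k, fun m hm =>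
      (approx_lt hP hm le_rfl hx h1 (by linarith)).le⟩)
  have h4 : approx T S k (x + 2 * δ) ≤ conj T S x' :=
    ge_of_tendsto (tendsto_approx hP hS hx') (eventually_atTop.2 ⟨k, fun m hm =>
      (approx_lt hP le_rfl hm h2 hx' (by linarith)).le⟩)
  exact h3.trans_lt ((approx_lt hP le_rfl le_rfl h1 h2 (by linarith)).trans_le h4)

lemma conj_mem_closed (hP : Parallel T S)
    (hS : Tendsto (fun n => (S.iter n).total) atTop (𝓝 0)) {α : 𝒜} {x : ℝ}
    (hx : x ∈ T.piece 0 α) : conj T S x ∈ Set.Icc (S.left 0 α) (S.left 0 α + S.len α) := by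
  have hpos := (hP.left 0).pos
  have hx' := piece_subset_dom hpos 0 α hx
  refine isClosed_Icc.mem_of_tendsto (tendsto_approx hP hS hx') (Eventually.of_forall fun n => ?_)
  obtain ⟨β, h1, h2⟩ := (rel_approx hP n hx').exists_piece hP
  obtain rfl := eq_of_mem_piece hpos hx h1
  exact Set.Ico_subset_Icc_self h2

lemma conj_mem_piece (hP : Parallel T S)
    (hT : Tendsto (fun n => (T.iter n).total) atTop (𝓝 0))
    (hS : Tendsto (fun n => (S.iter n).total) atTop (𝓝 0)) {α : 𝒜} {x : ℝ}
    (hx : x ∈ T.piece 0 α) : conj T S x ∈ S.piece 0 α := by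
  have hpos := (hP.left 0).pos
  -- Limits only stay in the closed interval; a point further right in the same piece, with strict
  -- monotonicity, excludes the right endpoint.
  obtain ⟨x', h1, h2⟩ := exists_between hx.2
  have hx' : x' ∈ T.piece 0 α := ⟨hx.1.trans h1.le, h2⟩
  have h3 := conj_strictMonoOn hP hT hS (piece_subset_dom hpos 0 α hx)
    (piece_subset_dom hpos 0 α hx') h1
  exact ⟨(conj_mem_closed hP hS hx).1, h3.trans_le (conj_mem_closed hP hS hx').2⟩

lemma conj_mem_dom (hP : Parallel T S)
    (hT : Tendsto (fun n => (T.iter n).total) atTop (𝓝 0))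
    (hS : Tendsto (fun n => (S.iter n).total) atTop (𝓝 0)) {x : ℝ}
    (hx : x ∈ T.dom) : conj T S x ∈ S.dom := by
  obtain ⟨α, hα⟩ := T.exists_mem_piece 0 hx
  exact piece_subset_dom (hP.right 0).pos 0 α (conj_mem_piece hP hT hS hα)

/-- Together with `le_conj_of_lt`, this order relation between the two candidate maps shows that
they are mutually inverse before any continuity is known. -/
lemma conj_le_of_lt (hP : Parallel T S)
    (hT : Tendsto (fun n => (T.iter n).total) atTop (𝓝 0))
    (hS : Tendsto (fun n => (S.iter n).total) atTop (𝓝 0)) {x y : ℝ}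
    (hx : x ∈ T.dom) (hy : y ∈ S.dom) (h : x < conj S T y) : conj T S x ≤ y := by
  have h1 := (tendsto_approx hP.symm hT hy).sub hT
  rw [sub_zero] at h1
  refine le_of_tendsto (tendsto_approx hP hS hx) ?_
  filter_upwards [h1.eventually (lt_mem_nhds h)] with n hn
  exact ((rel_approx hP n hx).lt_of_add_le hP (rel_approx hP.symm n hy).symm (by linarith)).le

lemma le_conj_of_lt (hP : Parallel T S)
    (hT : Tendsto (fun n => (T.iter n).total) atTop (𝓝 0))
    (hS : Tendsto (fun n => (S.iter n).total) atTop (𝓝 0)) {x y : ℝ}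
    (hx : x ∈ T.dom) (hy : y ∈ S.dom) (h : conj S T y < x) : y ≤ conj T S x := by
  have h1 := (tendsto_approx hP.symm hT hy).add hT
  rw [add_zero] at h1
  refine ge_of_tendsto (tendsto_approx hP hS hx) ?_
  filter_upwards [h1.eventually (gt_mem_nhds h)] with n hn
  exact ((rel_approx hP.symm n hy).symm.lt_of_add_le hP (rel_approx hP n hx) hn.le).le

lemma conj_conj (hP : Parallel T S)
    (hT : Tendsto (fun n => (T.iter n).total) atTop (𝓝 0))
    (hS : Tendsto (fun n => (S.iter n).total) atTop (𝓝 0)) {y : ℝ}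
    (hy : y ∈ S.dom) : conj T S (conj S T y) = y := by
  have hmono := conj_strictMonoOn hP.symm hS hT
  have hx := conj_mem_dom hP.symm hS hT hy
  have hz := conj_mem_dom hP hT hS hx
  rcases lt_trichotomy (conj T S (conj S T y)) y with h | h | h
  · obtain ⟨z, h1, h2⟩ := exists_between h
    have hz' : z ∈ S.dom := ⟨hz.1.trans h1.le, h2.trans hy.2⟩
    have h3 := le_conj_of_lt hP.symm hS hT hz' hx h1
    exact absurd (hmono hz' hy h2) (not_lt.2 h3)
  · exact h
  · obtain ⟨z, h1, h2⟩ := exists_between h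
    have hz' : z ∈ S.dom := ⟨hy.1.trans h1.le, h2.trans hz.2⟩
    have h3 := conj_le_of_lt hP.symm hS hT hz' hx h2
    exact absurd (hmono hy hz' h1) (not_lt.2 h3)

/-- An increasing bijection that respects the pieces must carry the least point of each piece to the
least point of the corresponding one. -/
lemma conj_left (hP : Parallel T S)
    (hT : Tendsto (fun n => (T.iter n).total) atTop (𝓝 0))
    (hS : Tendsto (fun n => (S.iter n).total) atTop (𝓝 0)) (α : 𝒜) :
    conj T S (T.left 0 α) = S.left 0 α := by
  have hposT : ∀ α, 0 < T.len α := (hP.left 0).pos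
  have hposS : ∀ α, 0 < S.len α := (hP.right 0).pos
  have h1 := left_mem_piece hposT 0 α
  have h2 := left_mem_piece hposS 0 α
  have h3 := conj_mem_piece hP.symm hS hT h2
  refine le_antisymm ?_ (conj_mem_piece hP hT hS h1).1
  have h4 := (conj_strictMonoOn hP hT hS).monotoneOn (piece_subset_dom hposT 0 α h1)
    (piece_subset_dom hposT 0 α h3) h3.1
  rwa [conj_conj hP hT hS (piece_subset_dom hposS 0 α h2)] at h4

lemma left_eq_zero (T : Data 𝒜 d) {ε : Fin 2} {α : 𝒜} (h : T.comb ε α = ⊥) :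
    T.left ε α = 0 := by
  simp [left, h]

/-- A point sent to `0` lands in the base at every level, so `Rel.map` never applies to it. It is a
left endpoint, and the matching endpoint for `S` is also sent to `0`. -/
lemma conj_map_of_map_eq_zero (hP : Parallel T S)
    (hT : Tendsto (fun n => (T.iter n).total) atTop (𝓝 0))
    (hS : Tendsto (fun n => (S.iter n).total) atTop (𝓝 0)) {x : ℝ}
    (hx : x ∈ T.dom) (h0 : T.map x = 0) : conj T S (T.map x) = S.map (conj T S x) := by
  have hposT : ∀ α, 0 < T.len α := (hP.left 0).pos
  have hposS : ∀ α, 0 < S.len α := (hP.right 0).pos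
  obtain ⟨α, hα⟩ := T.exists_mem_piece 0 hx
  have h1 := map_of_mem_piece hposT hα
  have h2 := left_nonneg hposT 1 α
  have h3 : T.comb 1 α = ⊥ := by
    by_contra h
    linarith [left_pos hposT h, hα.1]
  have h4 := left_eq_zero T h3
  have h5 : x = T.left 0 α := by linarith
  have h6 : conj T S 0 = 0 := by
    have h7 := conj_left hP hT hS ((T.comb 0).symm ⊥)
    rwa [left_eq_zero T (by simp), left_eq_zero S (by simp [hP.comb_eq])] at h7
  rw [h0, h6, h5, conj_left hP hT hS, map_of_mem_piece hposS (left_mem_piece hposS 0 α),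
    left_eq_zero S (ε := 1) (by rw [← hP.comb_eq, h3])]
  ring

lemma conj_map (hP : Parallel T S)
    (hT : Tendsto (fun n => (T.iter n).total) atTop (𝓝 0))
    (hS : Tendsto (fun n => (S.iter n).total) atTop (𝓝 0)) {x : ℝ}
    (hx : x ∈ T.dom) : conj T S (T.map x) = S.map (conj T S x) := by
  have hposT : ∀ α, 0 < T.len α := (hP.left 0).pos
  have hposS : ∀ α, 0 < S.len α := (hP.right 0).pos
  by_cases h0 : T.map x = 0
  · exact conj_map_of_map_eq_zero hP hT hS hx h0
  have hTx := map_mem_dom hposT hx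
  obtain ⟨α, hα⟩ := T.exists_mem_piece 0 hx
  rw [map_of_mem_piece hposS (conj_mem_piece hP hT hS hα)]
  refine tendsto_nhds_unique_of_eventuallyEq
    (f := fun n => approx T S n (T.map x))
    (g := fun n => approx T S n (T.map x)) (tendsto_approx hP hS hTx) ?_ EventuallyEq.rfl
  have h1 := (tendsto_approx hP hS hx).add_const (S.left 1 α - S.left 0 α)
  refine h1.congr_dist (squeeze_zero' (Eventually.of_forall fun _ => dist_nonneg) ?_ hS)
  -- Once the base is shorter than `T.map x`, both `S.map` of the approximation of `x` and the
  -- approximation of `T.map x` are related to `T.map x`, hence are close.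
  filter_upwards [hT.eventually (gt_mem_nhds (lt_of_le_of_ne hTx.1 (Ne.symm h0)))] with n hn
  have h2 := rel_approx hP n hx
  obtain ⟨β, h3, h4⟩ := h2.exists_piece hP
  obtain rfl := eq_of_mem_piece hposT hα h3
  rw [← map_of_mem_piece hposS h4]
  exact (h2.map hP hn.le).abs_sub_lt hP (rel_approx hP n hTx)

/-- A strictly increasing bijection between two intervals is an order isomorphism, hence continuous
for the order topologies. -/
lemma continuousOn_conj (hP : Parallel T S)
    (hT : Tendsto (fun n => (T.iter n).total) atTop (𝓝 0))
    (hS : Tendsto (fun n => (S.iter n).total) atTop (𝓝 0)) :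
    ContinuousOn (conj T S) T.dom := by
  have himg : conj T S '' T.dom = S.dom := by
    ext y
    constructor
    · rintro ⟨x, hx, rfl⟩
      exact conj_mem_dom hP hT hS hx
    · intro hy
      exact ⟨_, conj_mem_dom hP.symm hS hT hy, conj_conj hP hT hS hy⟩
  have : S.dom.OrdConnected := Set.ordConnected_Ico
  have : T.dom.OrdConnected := Set.ordConnected_Ico
  have : (conj T S '' T.dom).OrdConnected := himg ▸ Set.ordConnected_Ico
  rw [continuousOn_iff_continuous_domRestrict]
  exact continuous_subtype_val.comp
    ((conj_strictMonoOn hP hT hS).orderIso (conj T S) T.dom).continuous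

/-- The conjugacy as a partial equivalence. -/
def conjEquiv (hP : Parallel T S)
    (hT : Tendsto (fun n => (T.iter n).total) atTop (𝓝 0))
    (hS : Tendsto (fun n => (S.iter n).total) atTop (𝓝 0)) : PartialEquiv ℝ ℝ where
  toFun := conj T S
  invFun := conj S T
  source := T.dom
  target := S.dom
  map_source' _ hx := conj_mem_dom hP hT hS hx
  map_target' _ hy := conj_mem_dom hP.symm hS hT hy
  left_inv' _ hx := conj_conj hP.symm hS hT hx
  right_inv' _ hy := conj_conj hP hT hS hy

theorem Parallel.topConj (hP : Parallel T S)
    (hT : Tendsto (fun n => (T.iter n).total) atTop (𝓝 0))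
    (hS : Tendsto (fun n => (S.iter n).total) atTop (𝓝 0)) : TopConj T S :=
  ⟨conjEquiv hP hT hS, rfl, rfl, continuousOn_conj hP hT hS, continuousOn_conj hP.symm hS hT,
    fun _ hy => conj_map hP hT hS hy⟩

/-! ### Invariant measures and transport of Lebesgue measure. -/

lemma measurable_map (T : Data 𝒜 d) : Measurable T.map := by
  refine measurable_id.add (Finset.measurable_sum _ fun α _ => ?_)
  exact measurable_const.indicator measurableSet_Ico

lemma measurableSet_dom (T : Data 𝒜 d) : MeasurableSet T.dom := measurableSet_Ico

lemma measurableSet_piece (T : Data 𝒜 d) (ε : Fin 2) (α : 𝒜) : MeasurableSet (T.piece ε α) :=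
  measurableSet_Ico

lemma restrict_dom_eq_sum {T : Data 𝒜 d} (hT : ∀ α, 0 < T.len α) (ε : Fin 2) :
    volume.restrict T.dom = ∑ α, volume.restrict (T.piece ε α) := by
  have h1 : T.dom = ⋃ α, T.piece ε α := by
    ext x
    rw [Set.mem_iUnion]
    exact ⟨T.exists_mem_piece ε, fun ⟨α, h⟩ => piece_subset_dom hT ε α h⟩
  rw [h1, Measure.restrict_iUnion _ fun α => T.measurableSet_piece ε α, Measure.sum_fintype]
  intro α β hαβ
  rw [Function.onFun, Set.disjoint_left]
  exact fun x h1 h2 => hαβ (eq_of_mem_piece hT h1 h2)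

lemma measurePreserving_map {T : Data 𝒜 d} (hT : ∀ α, 0 < T.len α) :
    MeasurePreserving T.map (volume.restrict T.dom) (volume.restrict T.dom) := by
  refine ⟨T.measurable_map, ?_⟩
  conv_lhs => rw [restrict_dom_eq_sum hT 0]
  rw [restrict_dom_eq_sum hT 1, ← Measure.sum_fintype, ← Measure.sum_fintype,
    Measure.map_sum T.measurable_map.aemeasurable]
  congr 1
  ext1 α
  have h1 : (volume.restrict (T.piece 0 α)).map T.map =
      (volume.restrict (T.piece 0 α)).map (fun x => x + (T.left 1 α - T.left 0 α)) := by
    refine Measure.map_congr ?_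
    filter_upwards [ae_restrict_mem measurableSet_Ico] with x hx
    exact map_of_mem_piece hT hx
  have h2 : T.piece 0 α = (fun x => x + (T.left 1 α - T.left 0 α)) ⁻¹' T.piece 1 α := by
    ext x
    simp only [piece, Set.mem_preimage, Set.mem_Ico]
    constructor <;> rintro ⟨h1, h2⟩ <;> constructor <;> linarith
  rw [h1, h2]
  exact ((measurePreserving_add_right volume _).restrict_preimage measurableSet_Ico).map_eq

/-- Lebesgue measure gives the piece `α` mass `T.len α`. The Lebesgue measure of `S`, transported by
the conjugacy, is also `T`-invariant and gives it mass `S.len α`. -/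
theorem Parallel.not_uniquelyErgodic (hP : Parallel T S)
    (hT : Tendsto (fun n => (T.iter n).total) atTop (𝓝 0))
    (hS : Tendsto (fun n => (S.iter n).total) atTop (𝓝 0))
    (hT1 : T.total = 1) (hS1 : S.total = 1) (hne : T.len ≠ S.len) : ¬ T.UniquelyErgodic := by
  have hposT : ∀ α, 0 < T.len α := (hP.left 0).pos
  have hposS : ∀ α, 0 < S.len α := (hP.right 0).pos
  have hvol : ∀ R : Data 𝒜 d, R.total = 1 → IsProbabilityMeasure (volume.restrict R.dom) :=
    fun R hR => ⟨by simp [dom, hR]⟩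
  have hpT := hvol T hT1
  have hpS := hvol S hS1
  have hg : AEMeasurable (conj S T) (volume.restrict S.dom) :=
    (continuousOn_conj hP.symm hS hT).aemeasurable measurableSet_Ico
  have hpre : ∀ α, S.dom ∩ conj S T ⁻¹' T.piece 0 α = S.piece 0 α := by
    intro α
    ext y
    constructor
    · rintro ⟨h1, h2⟩
      have := conj_mem_piece hP hT hS h2
      rwa [conj_conj hP hT hS h1] at this
    · intro h
      exact ⟨piece_subset_dom hposS 0 α h, conj_mem_piece hP.symm hS hT h⟩
  rintro ⟨μ, -, huniq⟩
  have h1 := huniq (volume.restrict T.dom) ⟨hpT, by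
    rw [Measure.restrict_apply T.measurableSet_dom.compl]; simp, measurePreserving_map hposT⟩
  have h2 := huniq ((volume.restrict S.dom).map (conj S T)) ⟨Measure.isProbabilityMeasure_map hg, by
      rw [Measure.map_apply_of_aemeasurable hg T.measurableSet_dom.compl,
        Measure.restrict_apply' S.measurableSet_dom]
      convert measure_empty (μ := (volume : Measure ℝ))
      ext y
      simp only [Set.mem_inter_iff, Set.mem_preimage, Set.mem_compl_iff, Set.mem_empty_iff_false,
        iff_false, not_and]
      exact fun h1 h2 => h1 (conj_mem_dom hP.symm hS hT h2), T.measurable_map, by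
      rw [AEMeasurable.map_map_of_aemeasurable T.measurable_map.aemeasurable hg]
      conv_rhs => rw [← (measurePreserving_map hposS).map_eq]
      rw [AEMeasurable.map_map_of_aemeasurable
        (by rwa [(measurePreserving_map hposS).map_eq]) S.measurable_map.aemeasurable]
      refine Measure.map_congr ?_
      filter_upwards [ae_restrict_mem measurableSet_Ico] with y hy
      exact (conj_map hP.symm hS hT hy).symm⟩
  apply hne
  ext α
  have h3 := DFunLike.congr_fun (h1.trans h2.symm) (T.piece 0 α)
  rw [Measure.map_apply_of_aemeasurable hg (T.measurableSet_piece 0 α),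
    Measure.restrict_apply' T.measurableSet_dom, Measure.restrict_apply' S.measurableSet_dom, Set.inter_comm _ S.dom, hpre,
    Set.inter_eq_left.2 (piece_subset_dom hposT 0 α), piece, piece, Real.volume_Ico,
    Real.volume_Ico, add_sub_cancel_left, add_sub_cancel_left,
    ENNReal.ofReal_eq_ofReal_iff (hposT α).le (hposS α).le] at h3
  exact h3

end Data
end Parallel

/-! ### Connexions under the basic operation and the Keane property. -/

section Keane

variable {𝒜 : Type*} [Fintype 𝒜] [DecidableEq 𝒜] {d : ℕ} [NeZero d]

namespace Data

lemma Steppable.step_map_cases {T : Data 𝒜 d} (h : T.Steppable) {x : ℝ} (hx : x ∈ T.step.dom) :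
    T.map x = T.step.map x ∨
      (T.step.total ≤ T.map x ∧ T.map (T.map x) = T.step.map x) := by
  obtain ⟨α, hα⟩ := T.step.exists_mem_piece 0 hx
  by_cases h1 : α = T.lose
  · subst h1
    have h2 := h.step_map_lose hα
    exact Or.inr ⟨h.step_total_le_map_lose hα, by rw [h2.2.1, h2.2.2]⟩
  · exact Or.inl (h.step_map_of_ne h1 hα).2

/-- A first return map visits the same points of its domain, skipping at most the intermediate ones,
so the time can only decrease. -/
lemma Steppable.exists_step_iterate {T : Data 𝒜 d} (h : T.Steppable) {m : ℕ} (hm : 0 < m) {x : ℝ}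
    (hx : x ∈ T.step.dom) (hmx : T.map^[m] x ∈ T.step.dom) :
    ∃ m', 0 < m' ∧ m' ≤ m ∧ T.step.map^[m'] x = T.map^[m] x := by
  induction m using Nat.strong_induction_on generalizing x with
  | _ m ih =>
    have hx' := map_mem_dom h.step_pos hx
    have key : ∀ k, k < m → T.map^[k] (T.step.map x) = T.map^[m] x →
        ∃ m', 0 < m' ∧ m' ≤ m ∧ T.step.map^[m'] x = T.map^[m] x := by
      intro k hk hkx
      rcases Nat.eq_zero_or_pos k with rfl | hk0
      · exact ⟨1, one_pos, by omega, hkx⟩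
      · obtain ⟨m', h1, h2, h3⟩ := ih k hk hk0 hx' (hkx ▸ hmx)
        exact ⟨m' + 1, by omega, by omega, by rw [Function.iterate_succ_apply, h3, hkx]⟩
    obtain ⟨k, rfl⟩ := Nat.exists_eq_succ_of_ne_zero hm.ne'
    rcases h.step_map_cases hx with h1 | ⟨h1, h2⟩
    · exact key k (by omega) (by rw [← h1, Function.iterate_succ_apply])
    · rcases Nat.eq_zero_or_pos k with rfl | hk0
      · exact absurd hmx.2 (not_lt.2 h1)
      · obtain ⟨j, rfl⟩ := Nat.exists_eq_succ_of_ne_zero hk0.ne'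
        exact key j (by omega) (by
          rw [← h2, Function.iterate_succ_apply, Function.iterate_succ_apply])

/-- A connexion for `T` gives a connexion for `T.step`, which is strictly shorter unless the
endpoint has not changed. -/
lemma Steppable.exists_connexion_step {T : Data 𝒜 d} (h : T.Steppable) {m : ℕ} (hm : 0 < m)
    {α β : 𝒜} (hc : T.map^[m] (T.left 0 α) = T.left 0 β) (hβ : 0 < T.left 0 β) :
    ∃ m', 0 < m' ∧ T.step.map^[m'] (T.step.left 0 α) = T.step.left 0 β ∧ 0 < T.step.left 0 β ∧
      (m' < m ∨ m' ≤ m ∧ T.step.left 0 β = T.left 0 β) := by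
  have hdom : ∀ γ, T.step.left 0 γ ∈ T.step.dom := fun γ =>
    piece_subset_dom h.step_pos 0 γ (left_mem_piece h.step_pos 0 γ)
  -- For type `0` all endpoints in the top row are unchanged. For type `1` only the loser's endpoint
  -- moves, and its old position is the `T`-image of the new one (`hlast`).
  rcases (by omega : T.type = 0 ∨ T.type = 1) with ht | ht
  · have h0 : ∀ γ, T.step.left 0 γ = T.left 0 γ := fun γ => by
      have := step_left_type T γ
      rwa [ht] at this
    rw [← h0, ← h0 β] at hc
    obtain ⟨m', h1, h2, h3⟩ := h.exists_step_iterate hm (hdom α) (hc ▸ hdom β)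
    exact ⟨m', h1, h3.trans hc, by rwa [h0], Or.inr ⟨h2, h0 β⟩⟩
  · have e3 : (1 - T.type) = 0 := by simp [ht]
    have h0 : ∀ γ, γ ≠ T.lose → T.step.left 0 γ = T.left 0 γ := fun γ hγ => by
      have := h.step_left_other hγ
      rwa [e3] at this
    have hlose : T.step.left 0 T.lose ∈ T.step.piece 0 T.lose := left_mem_piece h.step_pos 0 _
    obtain ⟨-, hs1, hs2⟩ := h.step_map_lose hlose
    have hlast : T.map (T.step.left 0 T.lose) = T.left 0 T.lose := by
      have h1 := left_add_len_last T 0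
      have h2 : T.lose = T.comb.lastLetter 0 := by rw [lose, e3]
      rw [← h2] at h1
      rw [hs1, shift, step_total]
      linarith
    have hposl : 0 < T.step.left 0 T.lose := by
      have h1 := h.step_left_lose
      rw [e3] at h1
      rw [h1]
      linarith [h.lt, left_nonneg h.pos 0 T.win]
    have hout : T.step.total ≤ T.left 0 T.lose := by
      rw [← hlast]
      exact h.step_total_le_map_lose hlose
    have hs3 : T.map (T.left 0 T.lose) = T.step.map (T.step.left 0 T.lose) := by
      rw [← hs2, ← hs1, hlast]
    have hs3d : T.step.map (T.step.left 0 T.lose) ∈ T.step.dom :=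
      map_mem_dom h.step_pos (hdom _)
    have key : ∀ k y, y ∈ T.step.dom → T.map^[k] (T.step.map (T.step.left 0 T.lose)) = y →
        ∃ m', 0 < m' ∧ m' ≤ k + 1 ∧ T.step.map^[m'] (T.step.left 0 T.lose) = y := by
      intro k y hy hk
      rcases Nat.eq_zero_or_pos k with rfl | hk0
      · exact ⟨1, one_pos, le_rfl, hk⟩
      · obtain ⟨m', h1, h2, h3⟩ := h.exists_step_iterate hk0 hs3d (hk ▸ hy)
        exact ⟨m' + 1, by omega, by omega, by rw [Function.iterate_succ_apply, h3, hk]⟩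
    obtain ⟨k, rfl⟩ := Nat.exists_eq_succ_of_ne_zero hm.ne'
    by_cases hβl : β = T.lose
    · subst hβl
      have hdl : T.left 0 α ∈ T.dom := piece_subset_dom h.pos 0 α (left_mem_piece h.pos 0 α)
      -- By injectivity the last iterate of the connexion can be dropped, which makes it strictly
      -- shorter.
      have hk : T.map^[k] (T.left 0 α) = T.step.left 0 T.lose := by
        rw [Function.iterate_succ_apply', ← hlast] at hc
        refine map_injOn h.pos ?_ (h.step_dom_subset (hdom _)) hc
        exact Set.MapsTo.iterate (s := T.dom) (fun x hx => map_mem_dom h.pos hx) k hdl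
      by_cases hα : α = T.lose
      · subst hα
        rcases Nat.eq_zero_or_pos k with rfl | hk0
        · have : T.left 0 T.lose = T.step.left 0 T.lose := hk
          exact absurd (hdom T.lose).2 (not_lt.2 (this ▸ hout))
        · obtain ⟨j, rfl⟩ := Nat.exists_eq_succ_of_ne_zero hk0.ne'
          rw [Function.iterate_succ_apply, hs3] at hk
          obtain ⟨m', h1, h2, h3⟩ := key j _ (hdom _) hk
          exact ⟨m', h1, h3, hposl, Or.inl (by omega)⟩
      · rw [← h0 α hα] at hk
        rcases Nat.eq_zero_or_pos k with rfl | hk0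
        · exact absurd (left_injective h.step_pos 0 hk) hα
        · obtain ⟨m', h1, h2, h3⟩ := h.exists_step_iterate hk0 (hdom α) (hk ▸ hdom _)
          exact ⟨m', h1, h3.trans hk, hposl, Or.inl (by omega)⟩
    · have hβ' := h0 β hβl
      rw [← hβ'] at hc
      by_cases hα : α = T.lose
      · subst hα
        rw [Function.iterate_succ_apply, hs3] at hc
        obtain ⟨m', h1, h2, h3⟩ := key k _ (hdom _) hc
        exact ⟨m', h1, h3, by rwa [hβ'], Or.inr ⟨by omega, hβ'⟩⟩
      · rw [← h0 α hα] at hc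
        obtain ⟨m', h1, h2, h3⟩ := h.exists_step_iterate hm (hdom α) (hc ▸ hdom β)
        exact ⟨m', h1, h3.trans hc, by rwa [hβ'], Or.inr ⟨h2, hβ'⟩⟩

/-- Consider a connexion of minimal length among all iterates. It cannot shorten, so its endpoint
stays at the same positive place forever; but that endpoint lies in domains whose lengths tend to
zero. -/
theorem keane_of_steppable {T : Data 𝒜 d} (h : ∀ n, (T.iter n).Steppable)
    (hT : Tendsto (fun n => (T.iter n).total) atTop (𝓝 0)) : T.Keane := by
  have main : ∀ (m : ℕ), 0 < m → ∀ (α β : 𝒜) (n : ℕ),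
      (T.iter n).map^[m] ((T.iter n).left 0 α) = (T.iter n).left 0 β →
      ¬ 0 < (T.iter n).left 0 β := by
    intro m
    induction m using Nat.strong_induction_on with
    | _ m ih =>
      intro hm α β n hc hpos
      have hstab : ∀ k, (T.iter (n + k)).map^[m] ((T.iter (n + k)).left 0 α) =
          (T.iter (n + k)).left 0 β ∧ (T.iter (n + k)).left 0 β = (T.iter n).left 0 β := by
        intro k
        induction k with
        | zero => exact ⟨hc, rfl⟩
        | succ k ihk =>
          obtain ⟨m', h1, h2, h3, h4⟩ :=
            (h (n + k)).exists_connexion_step hm ihk.1 (ihk.2 ▸ hpos)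
          have hs : (T.iter (n + k)).step = T.iter (n + (k + 1)) := by
            rw [iter, iter, ← add_assoc, Function.iterate_succ_apply']
          rw [hs] at h2 h3 h4
          have h5 : ¬ m' < m := fun h5 => ih m' h5 h1 α β _ h2 h3
          obtain ⟨h6, h7⟩ := h4.resolve_left h5
          obtain rfl : m' = m := by omega
          exact ⟨h2, h7.trans ihk.2⟩
      obtain ⟨N, hN⟩ := eventually_atTop.1 (hT.eventually (gt_mem_nhds hpos))
      have h1 := hN (n + N) (by omega)
      rw [← (hstab N).2] at h1
      have hp := (h (n + N)).pos
      exact absurd (piece_subset_dom hp 0 β (left_mem_piece hp 0 β)).2 (not_lt.2 h1.le)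
  intro α β m hβ hm hc
  exact main m hm α β 0 hc (left_pos (h 0).pos hβ)

end Data
end Keane

/-! ### Matrices along paths, as row operations. -/

section Paths

variable {𝒜 : Type*} [Fintype 𝒜] [DecidableEq 𝒜] {d : ℕ} [NeZero d]

lemma RauzyPath.append {π π' π'' : Comb 𝒜 d} {w w' : List 𝒜} {M M' : Matrix 𝒜 𝒜 ℝ}
    (h : RauzyPath π w π' M) (h' : RauzyPath π' w' π'' M') :
    RauzyPath π (w ++ w') π'' (M * M') := by
  induction h with
  | nil => simpa using h'
  | cons π π' ε w M _ ih =>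
    rw [Matrix.mul_assoc]
    exact RauzyPath.cons _ _ _ _ _ (ih h')

/-- Adds `t` times the row `b` to the row `a`. -/
def rowAdd (a b : 𝒜) (t : ℝ) (M : Matrix 𝒜 𝒜 ℝ) : Matrix 𝒜 𝒜 ℝ :=
  fun i j => M i j + if i = a then t * M b j else 0

lemma V_apply (a b i j : 𝒜) :
    (1 + Matrix.single a b 1 : Matrix 𝒜 𝒜 ℝ) i j =
      (if i = j then 1 else 0) + if i = a then (if j = b then 1 else 0) else 0 := by
  rw [Matrix.add_apply, Matrix.one_apply, Matrix.single_apply]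
  congr 1
  simp only [eq_comm (a := a), eq_comm (a := b)]
  split_ifs <;> simp_all

lemma rowAdd_zero (a b : 𝒜) (M : Matrix 𝒜 𝒜 ℝ) : rowAdd a b 0 M = M := by
  ext i j
  simp [rowAdd]

lemma rowAdd_one (a b : 𝒜) (M : Matrix 𝒜 𝒜 ℝ) :
    (1 + Matrix.single a b 1) * M = rowAdd a b 1 M := by
  ext i j
  simp only [Matrix.mul_apply, V_apply, rowAdd, add_mul, Finset.sum_add_distrib]
  by_cases h : i = a <;> simp [h]

/-- `π.Arrow ε a b π'`: the arrow of type `ε` from `π` ends at `π'`, has winner `a`, loser `b`. -/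
structure Comb.Arrow (π : Comb 𝒜 d) (ε : Fin 2) (a b : 𝒜) (π' : Comb 𝒜 d) : Prop where
  win : π.lastLetter ε = a
  lose : π.lastLetter (1 - ε) = b
  target : π.rauzy ε = π'

lemma RauzyPath.cons_arrow {π π₁ π' : Comb 𝒜 d} {ε : Fin 2} {a b : 𝒜} {w : List 𝒜}
    {M : Matrix 𝒜 𝒜 ℝ} (ha : π.Arrow ε a b π₁) (h : RauzyPath π₁ w π' M) :
    RauzyPath π (a :: w) π' (rowAdd a b 1 M) := by
  obtain ⟨rfl, rfl, rfl⟩ := ha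
  rw [← rowAdd_one]
  exact RauzyPath.cons _ _ _ _ _ h

lemma RauzyPath.replicate_arrow {π π' : Comb 𝒜 d} {ε : Fin 2} {a b : 𝒜} {w : List 𝒜}
    {M : Matrix 𝒜 𝒜 ℝ} (ha : π.Arrow ε a b π) (hab : b ≠ a) (h : RauzyPath π w π' M) (n : ℕ) :
    RauzyPath π (List.replicate n a ++ w) π' (rowAdd a b n M) := by
  induction n with
  | zero =>
    simp only [Nat.cast_zero, rowAdd_zero]
    exact h
  | succ n ih =>
    rw [List.replicate_succ, List.cons_append]
    have hM : rowAdd a b (n + 1 : ℕ) M = rowAdd a b 1 (rowAdd a b n M) := by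
      ext i j
      simp only [rowAdd, hab, if_false]
      push_cast
      split_ifs <;> ring
    rw [hM]
    exact ih.cons_arrow ha

/-- Only the row `a` is ever modified and the added rows are different from it, so the row additions
of successive turns around the triangle commute and can be collected. -/
lemma RauzyPath.replicate_three {π π₁ π₂ π' : Comb 𝒜 d} {ε : Fin 2} {a b₀ b₁ b₂ : 𝒜} {w : List 𝒜}
    {M : Matrix 𝒜 𝒜 ℝ} (h₀ : π.Arrow ε a b₀ π₁) (h₁ : π₁.Arrow ε a b₁ π₂)
    (h₂ : π₂.Arrow ε a b₂ π) (ha₀ : b₀ ≠ a) (ha₁ : b₁ ≠ a) (ha₂ : b₂ ≠ a)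
    (h : RauzyPath π w π' M) (n : ℕ) :
    RauzyPath π (List.replicate (3 * n) a ++ w) π'
      (rowAdd a b₀ n (rowAdd a b₁ n (rowAdd a b₂ n M))) := by
  induction n with
  | zero =>
    simp only [Nat.cast_zero, rowAdd_zero]
    exact h
  | succ n ih =>
    rw [show 3 * (n + 1) = 3 * n + 1 + 1 + 1 by ring]
    simp only [List.replicate_succ, List.cons_append]
    have hM : rowAdd a b₀ (n + 1 : ℕ) (rowAdd a b₁ (n + 1 : ℕ) (rowAdd a b₂ (n + 1 : ℕ) M)) =
        rowAdd a b₀ 1 (rowAdd a b₁ 1 (rowAdd a b₂ 1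
          (rowAdd a b₀ n (rowAdd a b₁ n (rowAdd a b₂ n M))))) := by
      ext i j
      simp only [rowAdd, ha₀, ha₁, ha₂, if_false]
      push_cast
      split_ifs <;> ring
    rw [hM]
    exact ((ih.cons_arrow h₂).cons_arrow h₁).cons_arrow h₀

/-- The loop with names `D^{3m+1} B C^n B D C^p D`. -/
lemma RauzyPath.loop {c₀ c₁ c₂ c₃ : Comb 𝒜 d} {ε : Fin 2} {A B C D : 𝒜}
    (h₀ : c₀.Arrow ε D A c₁) (h₁ : c₁.Arrow ε D B c₂) (h₂ : c₂.Arrow ε D C c₀)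
    (h₃ : c₁.Arrow (1 - ε) B D c₃) (h₄ : c₃.Arrow ε C B c₃) (h₅ : c₃.Arrow (1 - ε) B C c₁)
    (h₆ : c₂.Arrow (1 - ε) C D c₂)
    (hAD : A ≠ D) (hBD : B ≠ D) (hCD : C ≠ D) (hBC : B ≠ C) (m n p : ℕ) :
    RauzyPath c₀ (List.replicate (3 * m + 1) D ++ [B] ++ List.replicate n C ++ [B, D] ++
      List.replicate p C ++ [D]) c₀
      (rowAdd D A m (rowAdd D B m (rowAdd D C m (rowAdd D A 1 (rowAdd B D 1 (rowAdd C B n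
        (rowAdd B C 1 (rowAdd D B 1 (rowAdd C D p (rowAdd D C 1 1)))))))))) := by
  have := RauzyPath.replicate_three h₀ h₁ h₂ hAD hBD hCD
    (((((((((RauzyPath.nil c₀).cons_arrow h₂).replicate_arrow h₆ hCD.symm p).cons_arrow
      h₁).cons_arrow h₅).replicate_arrow h₄ hBC n).cons_arrow h₃).cons_arrow h₀)) m
  simpa [List.replicate_succ', List.append_assoc] using this

end Paths

/-! ### The seven-vertex Rauzy class of `abcd` and the two families of loops. -/

section Four

def comb1 (ε : Fin 2) : Comb (Fin 4) 4 := abcd.rauzy ε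
def comb2 (ε : Fin 2) : Comb (Fin 4) 4 := (comb1 ε).rauzy ε
def comb3 (ε : Fin 2) : Comb (Fin 4) 4 := (comb1 ε).rauzy (1 - ε)

/-- The Rauzy class of `abcd`. -/
def rauzyClass : Set (Comb (Fin 4) 4) :=
  {π | π = abcd ∨ ∃ ε, π = comb1 ε ∨ π = comb2 ε ∨ π = comb3 ε}

lemma comb_ext {π π' : Comb (Fin 4) 4} (h : ∀ ε α, π ε α = π' ε α) : π = π' :=
  funext fun ε => Equiv.ext (h ε)

lemma comb2_rauzy (ε : Fin 2) : (comb2 ε).rauzy ε = abcd :=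
  comb_ext (by revert ε; decide)

lemma comb2_rauzy' (ε : Fin 2) : (comb2 ε).rauzy (1 - ε) = comb2 ε :=
  comb_ext (by revert ε; decide)

lemma comb3_rauzy (ε : Fin 2) : (comb3 ε).rauzy ε = comb3 ε :=
  comb_ext (by revert ε; decide)

lemma comb3_rauzy' (ε : Fin 2) : (comb3 ε).rauzy (1 - ε) = comb1 ε :=
  comb_ext (by revert ε; decide)

lemma rowAdd_of (a b : Fin 4) (t : ℝ) (f : Fin 4 → Fin 4 → ℝ) :
    rowAdd a b t (Matrix.of f) = Matrix.of (Function.update f a (f a + t • f b)) := by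
  ext i j
  by_cases h : i = a
  · subst h; simp [rowAdd]
  · simp [rowAdd, h]

lemma update_vec_zero {β : Type*} (w x y z v : β) :
    Function.update ![w, x, y, z] 0 v = ![v, x, y, z] := by
  ext i; fin_cases i <;> rfl

lemma update_vec_one {β : Type*} (w x y z v : β) :
    Function.update ![w, x, y, z] 1 v = ![w, v, y, z] := by
  ext i; fin_cases i <;> rfl

lemma update_vec_two {β : Type*} (w x y z v : β) :
    Function.update ![w, x, y, z] 2 v = ![w, x, v, z] := by
  ext i; fin_cases i <;> rfl

lemma update_vec_three {β : Type*} (w x y z v : β) :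
    Function.update ![w, x, y, z] 3 v = ![w, x, y, v] := by
  ext i; fin_cases i <;> rfl

lemma one_eq_of : (1 : Matrix (Fin 4) (Fin 4) ℝ) =
    Matrix.of ![![1, 0, 0, 0], ![0, 1, 0, 0], ![0, 0, 1, 0], ![0, 0, 0, 1]] := by
  ext i j; fin_cases i <;> fin_cases j <;> rfl

lemma vec_four_apply {β : Type*} (w x y z : β) :
    ![w, x, y, z] 0 = w ∧ ![w, x, y, z] 1 = x ∧ ![w, x, y, z] 2 = y ∧ ![w, x, y, z] 3 = z :=
  ⟨rfl, rfl, rfl, rfl⟩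

lemma vec_four_add (a b c d a' b' c' d' t : ℝ) :
    ![a, b, c, d] + t • ![a', b', c', d'] =
      ![a + t * a', b + t * b', c + t * c', d + t * d'] := by
  ext i; fin_cases i <;> rfl

lemma rauzyPath_word0 (m n p : ℕ) : RauzyPath abcd (word0 m n p) abcd (Z0 m n p) := by
  have h := RauzyPath.loop (c₀ := abcd) (c₁ := comb1 0) (c₂ := comb2 0) (c₃ := comb3 0) (ε := 0)
    (A := lA) (B := lB) (C := lC) (D := lD) ⟨by decide, by decide, rfl⟩ ⟨by decide, by decide, rfl⟩
    ⟨by decide, by decide, comb2_rauzy 0⟩ ⟨by decide, by decide, rfl⟩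
    ⟨by decide, by decide, comb3_rauzy 0⟩ ⟨by decide, by decide, comb3_rauzy' 0⟩
    ⟨by decide, by decide, comb2_rauzy' 0⟩ (by decide) (by decide) (by decide) (by decide)
    m n p
  have hZ : Z0 m n p = rowAdd lD lA m (rowAdd lD lB m (rowAdd lD lC m (rowAdd lD lA 1
      (rowAdd lB lD 1 (rowAdd lC lB n (rowAdd lB lC 1 (rowAdd lD lB 1 (rowAdd lC lD p
        (rowAdd lD lC 1 1))))))))) := by
    rw [one_eq_of]
    simp only [rowAdd_of, update_vec_one, update_vec_two, update_vec_three, vec_four_apply,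
      vec_four_add]
    ext i j
    fin_cases i <;> fin_cases j <;> simp [Z0] <;> ring
  rw [hZ]
  exact h

/-- This is the image of the first family under the symmetry exchanging the two rows and the letters
`A ↔ D`, `B ↔ C`. -/
lemma rauzyPath_word1 (m n p : ℕ) : RauzyPath abcd (word1 m n p) abcd (Z1 m n p) := by
  have h := RauzyPath.loop (c₀ := abcd) (c₁ := comb1 1) (c₂ := comb2 1) (c₃ := comb3 1) (ε := 1)
    (A := lD) (B := lC) (C := lB) (D := lA) ⟨by decide, by decide, rfl⟩ ⟨by decide, by decide, rfl⟩
    ⟨by decide, by decide, comb2_rauzy 1⟩ ⟨by decide, by decide, rfl⟩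
    ⟨by decide, by decide, comb3_rauzy 1⟩ ⟨by decide, by decide, comb3_rauzy' 1⟩
    ⟨by decide, by decide, comb2_rauzy' 1⟩ (by decide) (by decide) (by decide) (by decide)
    m n p
  have hZ : Z1 m n p = rowAdd lA lD m (rowAdd lA lC m (rowAdd lA lB m (rowAdd lA lD 1
      (rowAdd lC lA 1 (rowAdd lB lC n (rowAdd lC lB 1 (rowAdd lA lC 1 (rowAdd lB lA p
        (rowAdd lA lB 1 1))))))))) := by
    rw [one_eq_of]
    simp only [rowAdd_of, update_vec_zero, update_vec_one, update_vec_two, vec_four_apply,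
      vec_four_add]
    ext i j
    fin_cases i <;> fin_cases j <;> simp [Z1] <;> ring
  rw [hZ]
  exact h

lemma rauzy_mem_rauzyClass {π : Comb (Fin 4) 4} (h : π ∈ rauzyClass) (δ : Fin 2) :
    π.rauzy δ ∈ rauzyClass := by
  rcases h with rfl | ⟨ε, rfl | rfl | rfl⟩
  · exact Or.inr ⟨δ, Or.inl rfl⟩
  all_goals rcases fin_two_cases ε δ with rfl | rfl
  · exact Or.inr ⟨_, Or.inr (Or.inl rfl)⟩
  · exact Or.inr ⟨ε, Or.inr (Or.inr rfl)⟩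
  · exact Or.inl (comb2_rauzy _)
  · rw [comb2_rauzy']
    exact Or.inr ⟨ε, Or.inr (Or.inl rfl)⟩
  · rw [comb3_rauzy]
    exact Or.inr ⟨_, Or.inr (Or.inr rfl)⟩
  · rw [comb3_rauzy']
    exact Or.inr ⟨ε, Or.inl rfl⟩

lemma lastLetter_ne {π : Comb (Fin 4) 4} (h : π ∈ rauzyClass) (ε : Fin 2) :
    π.lastLetter ε ≠ π.lastLetter (1 - ε) := by
  rcases h with rfl | ⟨δ, rfl | rfl | rfl⟩ <;> revert ε
  · decide
  all_goals revert δ; decide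

end Four

/-! ### Recovering a Rauzy path from lengths, and lengths from a path. -/

lemma V_mulVec (π : Comb (Fin 4) 4) (ε : Fin 2) (x : Fin 4 → ℝ) (i : Fin 4) :
    (π.V ε).mulVec x i =
      x i + if i = π.lastLetter ε then x (π.lastLetter (1 - ε)) else 0 := by
  simp only [Matrix.mulVec, dotProduct, Comb.V, V_apply, add_mul, Finset.sum_add_distrib]
  by_cases h : i = π.lastLetter ε <;> simp [h]

namespace Data

/-- After applying `V`, the winner has length `x_win + x_lose`, which exceeds the loser's `x_lose`;
the type is therefore forced. -/
lemma type_mk_mulVec {π : Comb (Fin 4) 4} (hπ : π ∈ rauzyClass) (ε : Fin 2) {x : Fin 4 → ℝ}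
    (hx : ∀ i, 0 < x i) : (Data.mk π ((π.V ε).mulVec x)).type = ε := by
  have hne := lastLetter_ne hπ 0
  have hne' := lastLetter_ne hπ 1
  simp only [sub_zero, sub_self] at hne hne'
  rcases (by omega : ε = 0 ∨ ε = 1) with rfl | rfl
  · rw [type, if_pos]
    simp only [V_mulVec, if_neg hne', if_true, sub_zero]
    linarith [hx (π.lastLetter 0)]
  · rw [type, if_neg]
    simp only [V_mulVec, if_neg hne, if_true, sub_self]
    linarith [hx (π.lastLetter 1)]

lemma step_mk_mulVec {π : Comb (Fin 4) 4} (hπ : π ∈ rauzyClass) (ε : Fin 2) {x : Fin 4 → ℝ}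
    (hx : ∀ i, 0 < x i) : (Data.mk π ((π.V ε).mulVec x)).step = ⟨π.rauzy ε, x⟩ := by
  simp only [step, type_mk_mulVec hπ ε hx, Data.mk.injEq, true_and]
  funext i
  simp only [V_mulVec, if_true, if_neg (lastLetter_ne hπ ε).symm]
  by_cases h : i = π.lastLetter ε <;> simp [h]

lemma mulVec_V_pos (π : Comb (Fin 4) 4) (ε : Fin 2) {x : Fin 4 → ℝ}
    (hx : ∀ i, 0 < x i) (i : Fin 4) : 0 < (π.V ε).mulVec x i := by
  rw [V_mulVec]
  have := hx i
  have := hx (π.lastLetter (1 - ε))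
  split_ifs <;> linarith

lemma steppable_mk_mulVec {π : Comb (Fin 4) 4} (hπ : π ∈ rauzyClass) (ε : Fin 2) {x : Fin 4 → ℝ}
    (hx : ∀ i, 0 < x i) : (Data.mk π ((π.V ε).mulVec x)).Steppable where
  ne := by simpa using lastLetter_ne hπ 0
  pos := mulVec_V_pos π ε hx
  lt := by
    simp only [win, lose, type_mk_mulVec hπ ε hx, V_mulVec, if_true,
      if_neg (lastLetter_ne hπ ε).symm]
    linarith [hx (π.lastLetter ε)]

/-- The basic operation undoes the matrices of a Rauzy path, applied to positive lengths. -/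
structure Follows (T : Data (Fin 4) 4) (w : List (Fin 4)) (T' : Data (Fin 4) 4)
    (M : Matrix (Fin 4) (Fin 4) ℝ) : Prop where
  pos : ∀ α, 0 < T.len α
  iter : T.iter w.length = T'
  names : T.StartsWith w
  prod : ((List.range w.length).map T.arrowV).prod = M
  steppable : ∀ n < w.length, (T.iter n).Steppable

lemma follows_of_rauzyPath {π π' : Comb (Fin 4) 4} {w : List (Fin 4)}
    {M : Matrix (Fin 4) (Fin 4) ℝ} (h : RauzyPath π w π' M) (hπ : π ∈ rauzyClass)
    {x : Fin 4 → ℝ} (hx : ∀ i, 0 < x i) : Follows ⟨π, M.mulVec x⟩ w ⟨π', x⟩ M := by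
  induction h with
  | nil π => exact ⟨by simpa using hx, by simp [Data.iter], by simp [StartsWith], by simp, by simp⟩
  | cons π π' ε w M h ih =>
    have ih := ih (rauzy_mem_rauzyClass hπ ε)
    rw [← Matrix.mulVec_mulVec]
    set T := Data.mk π ((π.V ε).mulVec (M.mulVec x)) with hT
    have ht : T.type = ε := type_mk_mulVec hπ ε ih.pos
    have hs : T.step = ⟨π.rauzy ε, M.mulVec x⟩ := step_mk_mulVec hπ ε ih.pos
    have hit : ∀ n, T.iter (n + 1) = (Data.mk (π.rauzy ε) (M.mulVec x)).iter n := fun n => by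
      rw [← hs]; rfl
    have h0 : T.iter 0 = T := rfl
    refine ⟨mulVec_V_pos π ε ih.pos, ?_, ?_, ?_, ?_⟩
    · rw [List.length_cons, hit, ih.iter]
    · rw [StartsWith, List.length_cons, List.range_succ_eq_map, List.map_cons, List.map_map]
      congr 1
      · rw [arrowName, h0, ht]
      · refine Eq.trans (congrArg (fun f => List.map f _) ?_) ih.names
        funext n
        simp only [Function.comp, arrowName, Nat.succ_eq_add_one, hit]
    · rw [List.length_cons, List.range_succ_eq_map, List.map_cons, List.map_map, List.prod_cons]
      congr 1
      · rw [arrowV, h0, ht]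
      · refine Eq.trans (congrArg (fun f => (List.map f _).prod) ?_) ih.prod
        funext n
        simp only [Function.comp, arrowV, Nat.succ_eq_add_one, hit]
    · intro n hn
      rcases n with _ | n
      · exact steppable_mk_mulVec hπ ε ih.pos
      · rw [hit]
        exact ih.steppable n (by simpa using hn)

/-- The last letters of the two rows differ, so the name of an arrow determines its type; the type
gives the weak inequality between the two lengths and the basic operation can be undone. Ties are
possible here, which is why only nonnegativity is propagated. -/
lemma exists_of_startsWith {π π' : Comb (Fin 4) 4} {w : List (Fin 4)}
    {M : Matrix (Fin 4) (Fin 4) ℝ} (h : RauzyPath π w π' M) (hπ : π ∈ rauzyClass)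
    {x : Fin 4 → ℝ} (hx : ∀ i, 0 ≤ x i) (hw : (Data.mk π x).StartsWith w) :
    ∃ y : Fin 4 → ℝ, (∀ i, 0 ≤ y i) ∧ x = M.mulVec y := by
  induction h generalizing x with
  | nil π => exact ⟨x, hx, by simp⟩
  | cons π π' ε w M h ih =>
    set T := Data.mk π x with hT
    rw [StartsWith, List.length_cons, List.range_succ_eq_map, List.map_cons, List.map_map,
      List.cons.injEq] at hw
    obtain ⟨hw0, hw1⟩ := hw
    have ht : T.type = ε := by
      have h1 : π.lastLetter T.type = π.lastLetter ε := hw0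
      rcases fin_two_cases ε T.type with h2 | h2
      · exact h2
      · rw [h2] at h1
        exact absurd h1.symm (lastLetter_ne hπ ε)
    have hle : x (π.lastLetter (1 - ε)) ≤ x (π.lastLetter ε) := by
      have h1 := ht
      rw [type] at h1
      split_ifs at h1 with h2
      · rw [← h1]; exact h2.le
      · rw [← h1]; exact not_lt.1 h2
    have hs : T.step = ⟨π.rauzy ε, T.step.len⟩ := by
      rw [step, ht]
    have hlen : ∀ i, T.step.len i = if i = π.lastLetter ε then
        x (π.lastLetter ε) - x (π.lastLetter (1 - ε)) else x i := by
      intro i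
      rw [step, ht]
    have hnn : ∀ i, 0 ≤ T.step.len i := by
      intro i
      rw [hlen]
      split_ifs
      · linarith
      · exact hx i
    obtain ⟨y, hy, hxy⟩ := ih (rauzy_mem_rauzyClass hπ ε) (x := T.step.len) hnn (by
      rw [← hs, StartsWith]
      exact hw1)
    refine ⟨y, hy, ?_⟩
    rw [← Matrix.mulVec_mulVec, ← hxy]
    funext i
    simp only [V_mulVec, hlen, if_neg (lastLetter_ne hπ ε).symm]
    split_ifs with h1
    · rw [h1]; ring
    · ring

end Data

/-! ### The infinite path `Γ` and its decomposition into blocks. -/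

lemma rauzyPath_loop (n₀ k : ℕ) : RauzyPath abcd (loopWord n₀ k) abcd (loopZ n₀ k) := by
  unfold loopWord loopZ
  split_ifs
  · exact rauzyPath_word0 _ _ _
  · exact rauzyPath_word1 _ _ _

lemma gammaWord_succ (n₀ k : ℕ) : gammaWord n₀ (k + 1) = gammaWord n₀ k ++ loopWord n₀ k := by
  simp [gammaWord, List.range_succ]

lemma loopQ_succ (n₀ k : ℕ) : loopQ n₀ (k + 1) = loopQ n₀ k * loopZ n₀ k := by
  simp [loopQ, List.range_succ]

lemma rauzyPath_gamma (n₀ k : ℕ) : RauzyPath abcd (gammaWord n₀ k) abcd (loopQ n₀ k) := by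
  induction k with
  | zero => simpa [gammaWord, loopQ] using RauzyPath.nil abcd
  | succ k ih =>
    rw [gammaWord_succ, loopQ_succ]
    exact ih.append (rauzyPath_loop n₀ k)

lemma abcd_mem : abcd ∈ rauzyClass := Or.inl rfl

/-- The letters of the `k`-th loop. -/
def loopLetters (k : ℕ) : Finset (Fin 4) := if Even k then {lB, lC, lD} else {lA, lB, lC}

lemma loopWord_toFinset_subset (n₀ k : ℕ) : (loopWord n₀ k).toFinset ⊆ loopLetters k := by
  intro a
  unfold loopWord loopLetters
  split_ifs
  · simp only [word0, List.mem_toFinset, List.mem_append, List.mem_replicate, List.mem_cons,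
      List.not_mem_nil, Finset.mem_insert, Finset.mem_singleton]
    tauto
  · simp only [word1, List.mem_toFinset, List.mem_append, List.mem_replicate, List.mem_cons,
      List.not_mem_nil, Finset.mem_insert, Finset.mem_singleton]
    tauto

lemma loopLetters_subset (n₀ k : ℕ) (hn : nPar n₀ k ≠ 0) :
    loopLetters k ⊆ (loopWord n₀ k).toFinset := by
  intro a
  unfold loopWord loopLetters
  split_ifs
  · simp only [word0, List.mem_toFinset, List.mem_append, List.mem_replicate, List.mem_cons,
      List.not_mem_nil, Finset.mem_insert, Finset.mem_singleton]
    tauto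
  · simp only [word1, List.mem_toFinset, List.mem_append, List.mem_replicate, List.mem_cons,
      List.not_mem_nil, Finset.mem_insert, Finset.mem_singleton]
    tauto

lemma nPar_ne_zero {n₀ : ℕ} (h : n₀ ≠ 0) (k : ℕ) : nPar n₀ k ≠ 0 := by
  rcases k with _ | k
  · exact h
  · simp only [nPar]; positivity

lemma loopWord_head (n₀ k : ℕ) : ∃ w, loopWord n₀ k = (if Even k then lD else lA) :: w := by
  unfold loopWord
  split_ifs
  · exact ⟨_, by simp only [word0, List.replicate_succ, List.cons_append]; rfl⟩
  · exact ⟨_, by simp only [word1, List.replicate_succ, List.cons_append]; rfl⟩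

/-- Positive length vectors whose Rauzy path is the infinite path `Γ`. -/
structure GammaLengths (n₀ : ℕ) (u : Fin 4 → ℝ) (x : ℕ → Fin 4 → ℝ) : Prop where
  pos : ∀ k i, 0 < x k i
  eq : ∀ k, u = (loopQ n₀ k).mulVec (x k)
  succ : ∀ k, x k = (loopZ n₀ k).mulVec (x (k + 1))

namespace GammaLengths

open Data

variable {n₀ : ℕ} {u : Fin 4 → ℝ} {x : ℕ → Fin 4 → ℝ} (h : GammaLengths n₀ u x)
include h

lemma follows (k : ℕ) :
    Follows ⟨abcd, u⟩ (gammaWord n₀ k) ⟨abcd, x k⟩ (loopQ n₀ k) := by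
  have := follows_of_rauzyPath (rauzyPath_gamma n₀ k) abcd_mem (h.pos k)
  rwa [← h.eq] at this

lemma follows_loop (k : ℕ) :
    Follows ⟨abcd, x k⟩ (loopWord n₀ k) ⟨abcd, x (k + 1)⟩ (loopZ n₀ k) := by
  have := follows_of_rauzyPath (rauzyPath_loop n₀ k) abcd_mem (h.pos (k + 1))
  rwa [← h.succ] at this

lemma iter_add (k n : ℕ) : (Data.mk abcd u).iter ((gammaWord n₀ k).length + n) =
    (Data.mk abcd (x k)).iter n := by
  rw [← (h.follows k).iter, Data.iter, add_comm, Function.iterate_add_apply]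
  rfl

end GammaLengths

lemma le_length_gammaWord (n₀ k : ℕ) : k ≤ (gammaWord n₀ k).length := by
  induction k with
  | zero => simp
  | succ k ih =>
    obtain ⟨w, hw⟩ := loopWord_head n₀ k
    rw [gammaWord_succ, List.length_append, hw, List.length_cons]
    omega

namespace GammaLengths

open Data

variable {n₀ : ℕ} {u : Fin 4 → ℝ} {x : ℕ → Fin 4 → ℝ} (h : GammaLengths n₀ u x)
include h

lemma steppable (n : ℕ) : ((Data.mk abcd u).iter n).Steppable :=
  (h.follows (n + 1)).steppable n (le_length_gammaWord n₀ (n + 1))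

lemma map_range' (k : ℕ) : (List.range' (gammaWord n₀ k).length (loopWord n₀ k).length).map
    (Data.mk abcd u).arrowName = loopWord n₀ k := by
  conv_rhs => rw [← (h.follows_loop k).names]
  rw [List.range'_eq_map_range, List.map_map]
  congr 1
  funext n
  simp only [Function.comp, arrowName, h.iter_add]

lemma image_Ico (k : ℕ) : (Finset.Ico (gammaWord n₀ k).length (gammaWord n₀ (k + 1)).length).image
    (Data.mk abcd u).arrowName = (loopWord n₀ k).toFinset := by
  conv_rhs => rw [← h.map_range' k]
  ext a
  simp only [Finset.mem_image, Finset.mem_Ico, List.mem_toFinset, List.mem_map, List.mem_range'_1,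
    gammaWord_succ, List.length_append]

lemma arrowName_length (k : ℕ) : (Data.mk abcd u).arrowName (gammaWord n₀ k).length =
    if Even k then lD else lA := by
  obtain ⟨w, hw⟩ := loopWord_head n₀ k
  have := h.map_range' k
  rw [hw, List.length_cons, List.range'_succ, List.map_cons, List.cons.injEq] at this
  exact this.1

/-- A loop uses exactly three letters (`n_k ≠ 0` guarantees that none is missing), and the next loop
starts with the fourth one: `A` after `B, C, D` and `D` after `A, B, C`. Hence a maximal block ends
precisely where the loop ends. -/
lemma zorichTime_eq (hn₀ : n₀ ≠ 0) (k : ℕ) :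
    (Data.mk abcd u).zorichTime k = (gammaWord n₀ k).length := by
  induction k with
  | zero => simp [zorichTime, gammaWord]
  | succ k ih =>
    rw [zorichTime, ih]
    refine IsGreatest.csSup_eq ⟨⟨?_, ?_⟩, ?_⟩
    · rw [gammaWord_succ, List.length_append]
      omega
    · rw [h.image_Ico]
      refine (Finset.card_le_card (loopWord_toFinset_subset n₀ k)).trans ?_
      unfold loopLetters
      split_ifs <;> decide
    · rintro N ⟨hN1, hN2⟩
      by_contra! hlt
      have hle : (gammaWord n₀ k).length ≤ (gammaWord n₀ (k + 1)).length := by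
        rw [gammaWord_succ, List.length_append]
        omega
      have hsub : (Finset.univ : Finset (Fin 4)) ⊆
          (Finset.Ico (gammaWord n₀ k).length N).image (Data.mk abcd u).arrowName := by
        have h1 : insert (if Even (k + 1) then lD else lA) (loopLetters k) ⊆
            (Finset.Ico (gammaWord n₀ k).length N).image (Data.mk abcd u).arrowName := by
          refine Finset.insert_subset ?_ ?_
          · rw [← h.arrowName_length]
            exact Finset.mem_image_of_mem _ (Finset.mem_Ico.2 ⟨hle, hlt⟩)
          · refine (loopLetters_subset n₀ k (nPar_ne_zero hn₀ k)).trans ?_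
            rw [← h.image_Ico]
            exact Finset.image_subset_image (Finset.Ico_subset_Ico_right hlt.le)
        refine subset_trans ?_ h1
        unfold loopLetters
        by_cases hk : Even k
        · rw [if_pos hk, if_neg (by simpa [Nat.even_add_one] using hk)]
          decide
        · rw [if_neg hk, if_pos (by simpa [Nat.even_add_one] using hk)]
          decide
      have h2 := Finset.card_le_card hsub
      have h3 : (Finset.univ : Finset (Fin 4)).card = 4 := rfl
      omega

lemma zorichZ_eq (hn₀ : n₀ ≠ 0) (k : ℕ) : (Data.mk abcd u).zorichZ k = loopZ n₀ k := by
  rw [zorichZ, h.zorichTime_eq hn₀, h.zorichTime_eq hn₀, gammaWord_succ, List.length_append,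
    Nat.add_sub_cancel_left, ← (h.follows_loop k).prod, List.range'_eq_map_range, List.map_map]
  congr 2
  funext n
  simp only [Function.comp, arrowV, h.iter_add]

lemma zorichQ_eq (hn₀ : n₀ ≠ 0) (k : ℕ) : (Data.mk abcd u).zorichQ k = loopQ n₀ k := by
  rw [zorichQ, loopQ]
  congr 2
  funext n
  exact h.zorichZ_eq hn₀ n

lemma comb_mem (n : ℕ) : ((Data.mk abcd u).iter n).comb ∈ rauzyClass := by
  induction n with
  | zero => exact abcd_mem
  | succ n ih =>
    rw [Data.iter, Function.iterate_succ_apply']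
    exact rauzy_mem_rauzyClass ih _

lemma parallel {v : Fin 4 → ℝ} {y : ℕ → Fin 4 → ℝ} (h' : GammaLengths n₀ v y) :
    Parallel (Data.mk abcd u) (Data.mk abcd v) := by
  have hname : ∀ n, (Data.mk abcd u).arrowName n = (Data.mk abcd v).arrowName n := by
    intro n
    have h1 := (h.follows (n + 1)).names
    rw [StartsWith, ← (h'.follows (n + 1)).names, List.length_map, List.length_range] at h1
    have h2 := le_length_gammaWord n₀ (n + 1)
    exact List.map_inj_left.1 h1 n (List.mem_range.2 (by omega))
  have htype : ∀ n, ((Data.mk abcd u).iter n).comb = ((Data.mk abcd v).iter n).comb →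
      ((Data.mk abcd u).iter n).type = ((Data.mk abcd v).iter n).type := by
    intro n hn
    have h1 := hname n
    rw [arrowName, arrowName, ← hn] at h1
    rcases fin_two_cases ((Data.mk abcd v).iter n).type ((Data.mk abcd u).iter n).type with h2 | h2
    · exact h2
    · rw [h2] at h1
      exact absurd h1.symm (lastLetter_ne (h.comb_mem n) _)
  have hcomb : ∀ n, ((Data.mk abcd u).iter n).comb = ((Data.mk abcd v).iter n).comb := by
    intro n
    induction n with
    | zero => rfl
    | succ n ih =>
      rw [Data.iter, Data.iter, Function.iterate_succ_apply', Function.iterate_succ_apply']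
      change ((Data.mk abcd u).iter n).comb.rauzy ((Data.mk abcd u).iter n).type =
        ((Data.mk abcd v).iter n).comb.rauzy ((Data.mk abcd v).iter n).type
      rw [htype n ih, ih]
  exact ⟨h.steppable, h'.steppable, hcomb, fun n => htype n (hcomb n)⟩

/-- Total lengths decrease along the path, so it is enough to control them at the ends of the loops.
-/
lemma tendsto_total (hx : Tendsto (fun k => ∑ i, x k i) atTop (𝓝 0)) :
    Tendsto (fun n => ((Data.mk abcd u).iter n).total) atTop (𝓝 0) := by
  have hanti : Antitone fun n => ((Data.mk abcd u).iter n).total := by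
    refine antitone_nat_of_succ_le fun n => ?_
    have h1 := step_total ((Data.mk abcd u).iter n)
    have h2 := (h.steppable n).pos ((Data.mk abcd u).iter n).lose
    rw [Data.iter, Function.iterate_succ_apply']
    rw [Data.iter] at h1 h2
    rw [Data.iter, h1]
    linarith
  refine tendsto_order.2 ⟨?_, ?_⟩
  · intro a ha
    exact Eventually.of_forall fun n => ha.trans_le (total_nonneg (h.steppable n).pos)
  · intro a ha
    obtain ⟨k, hk⟩ := (hx.eventually (gt_mem_nhds ha)).exists
    refine eventually_atTop.2 ⟨(gammaWord n₀ k).length, fun n hn => (hanti hn).trans_lt ?_⟩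
    change ((Data.mk abcd u).iter (gammaWord n₀ k).length).total < a
    rw [(h.follows k).iter]
    exact hk

end GammaLengths

/-! ### The recursion for the columns of `Q(k)`. -/

/-- The columns of `Q(k)`, in the order `A, B, C, D` for even `k` and `D, C, B, A` for odd `k`. -/
def altCol (n₀ k : ℕ) (j i : Fin 4) : ℝ := loopQ n₀ k i (if Even k then j else Fin.rev j)

/-- `Z1` is `Z0` with rows and columns reversed; reversing the order of the columns at each step
makes the recursion independent of the parity of `k`. -/
lemma altCol_succ_zero (n₀ k : ℕ) (i : Fin 4) : altCol n₀ (k + 1) 0 i =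
    (pPar n₀ k + 1) * altCol n₀ k 1 i + pPar n₀ k * (nPar n₀ k + 1) * altCol n₀ k 2 i +
      (pPar n₀ k * mPar n₀ k * (nPar n₀ k + 2) + mPar n₀ k + 1) * altCol n₀ k 3 i := by
  rcases Nat.even_or_odd k with hk | hk
  · simp [altCol, loopQ_succ, Matrix.mul_apply, loopZ, Z0, Fin.sum_univ_four, hk, Nat.even_add_one,
      Fin.rev]
    ring
  · have hk' := Nat.not_even_iff_odd.2 hk
    simp [altCol, loopQ_succ, Matrix.mul_apply, loopZ, Z1, Fin.sum_univ_four, hk',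
      Nat.even_add_one, Fin.rev]
    ring

lemma altCol_succ_one (n₀ k : ℕ) (i : Fin 4) : altCol n₀ (k + 1) 1 i =
    (pPar n₀ k + 2) * altCol n₀ k 1 i + (nPar n₀ k + 1) * (pPar n₀ k + 1) * altCol n₀ k 2 i +
      (mPar n₀ k * (nPar n₀ k + 2) * (pPar n₀ k + 1) + mPar n₀ k + 1) * altCol n₀ k 3 i := by
  rcases Nat.even_or_odd k with hk | hk
  · simp [altCol, loopQ_succ, Matrix.mul_apply, loopZ, Z0, Fin.sum_univ_four, hk, Nat.even_add_one,
      Fin.rev]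
    ring
  · have hk' := Nat.not_even_iff_odd.2 hk
    simp [altCol, loopQ_succ, Matrix.mul_apply, loopZ, Z1, Fin.sum_univ_four, hk',
      Nat.even_add_one, Fin.rev]
    ring

lemma altCol_succ_two (n₀ k : ℕ) (i : Fin 4) : altCol n₀ (k + 1) 2 i =
    2 * altCol n₀ k 1 i + nPar n₀ k * altCol n₀ k 2 i +
      (mPar n₀ k * (nPar n₀ k + 2) + 1) * altCol n₀ k 3 i := by
  rcases Nat.even_or_odd k with hk | hk
  · simp [altCol, loopQ_succ, Matrix.mul_apply, loopZ, Z0, Fin.sum_univ_four, hk, Nat.even_add_one,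
      Fin.rev]
    ring
  · have hk' := Nat.not_even_iff_odd.2 hk
    simp [altCol, loopQ_succ, Matrix.mul_apply, loopZ, Z1, Fin.sum_univ_four, hk',
      Nat.even_add_one, Fin.rev]
    ring

lemma altCol_succ_three (n₀ k : ℕ) (i : Fin 4) : altCol n₀ (k + 1) 3 i =
    altCol n₀ k 0 i + (mPar n₀ k + 1) * altCol n₀ k 3 i := by
  rcases Nat.even_or_odd k with hk | hk
  · simp [altCol, loopQ_succ, Matrix.mul_apply, loopZ, Z0, Fin.sum_univ_four, hk, Nat.even_add_one,
      Fin.rev]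
    ring
  · have hk' := Nat.not_even_iff_odd.2 hk
    simp [altCol, loopQ_succ, Matrix.mul_apply, loopZ, Z1, Fin.sum_univ_four, hk',
      Nat.even_add_one, Fin.rev]
    ring

/-! ### The scales and their relation to the parameters. -/

lemma cScale_neg_two (n₀ : ℕ) : cScale n₀ (-2) = 1 := by simp [cScale]

lemma cScale_neg_one {n₀ : ℕ} (h : n₀ ≠ 0) : cScale n₀ (-1) = n₀ := by
  obtain ⟨n, rfl⟩ := Nat.exists_eq_succ_of_ne_zero h
  have h1 : (((n + 1 : ℕ) : ℤ) + -1).toNat = n := by omega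
  have h2 : ((n.factorial : ℕ) : ℝ) ≠ 0 := by positivity
  rw [cScale, if_neg (by norm_num), Nat.succ_eq_add_one, h1, Nat.factorial_succ]
  push_cast
  field_simp

lemma cScale_natCast {n₀ : ℕ} (h : n₀ ≠ 0) (j : ℕ) :
    cScale n₀ j = cScale n₀ ((j : ℤ) - 1) * ((n₀ : ℝ) + j) ^ 2 := by
  obtain ⟨n, rfl⟩ := Nat.exists_eq_succ_of_ne_zero h
  have h1 : (((n + 1 : ℕ) : ℤ) + (j - 1)).toNat = n + j := by omega
  have h2 : (((n + 1 : ℕ) : ℤ) + j).toNat = n + j + 1 := by omega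
  rw [cScale, cScale, if_neg (by omega), if_neg (by omega), Nat.succ_eq_add_one, h1, h2,
    Nat.factorial_succ (n + j)]
  push_cast
  ring

/-- The scale of the main columns of `Q(k)`. -/
def scaleS (n₀ k : ℕ) : ℝ := cScale n₀ (3 * k - 2)

/-- The scale of the third column of `Q(k + 1)`. -/
def scaleC (n₀ k : ℕ) : ℝ := cScale n₀ (3 * k - 1)

/-- The ratio `scaleC / scaleS`. -/
def ratioQ (n₀ k : ℕ) : ℝ := if k = 0 then n₀ else ((n₀ : ℝ) + 3 * k - 1) ^ 2

lemma scaleC_eq {n₀ : ℕ} (h : n₀ ≠ 0) (k : ℕ) : scaleC n₀ k = scaleS n₀ k * ratioQ n₀ k := by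
  rcases k with _ | k
  · simp [scaleC, scaleS, ratioQ, cScale_neg_two, cScale_neg_one h]
  · have h1 := cScale_natCast h (3 * k + 2)
    rw [scaleC, scaleS, ratioQ, if_neg (by omega)]
    convert h1 using 2 <;> push_cast <;> ring_nf

lemma scaleS_succ {n₀ : ℕ} (h : n₀ ≠ 0) (k : ℕ) : scaleS n₀ (k + 1) =
    scaleC n₀ k * ((n₀ : ℝ) + 3 * k) ^ 2 * ((n₀ : ℝ) + 3 * k + 1) ^ 2 := by
  have h1 := cScale_natCast h (3 * k)
  have h2 := cScale_natCast h (3 * k + 1)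
  rw [show ((3 * k + 1 : ℕ) : ℤ) - 1 = (3 * k : ℕ) by push_cast; ring, h1] at h2
  rw [scaleC, scaleS]
  rw [show (3 * ((k + 1 : ℕ) : ℤ) - 2) = ((3 * k + 1 : ℕ) : ℤ) by push_cast; ring, h2]
  push_cast
  ring

lemma scaleC_succ {n₀ : ℕ} (h : n₀ ≠ 0) (k : ℕ) : scaleC n₀ (k + 1) =
    scaleS n₀ (k + 1) * ((n₀ : ℝ) + 3 * k + 2) ^ 2 := by
  rw [scaleC_eq h, ratioQ, if_neg (by omega)]
  push_cast
  ring

lemma one_le_ratioQ {n₀ : ℕ} (h : n₀ ≠ 0) (k : ℕ) : 1 ≤ ratioQ n₀ k := by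
  have h0 : (1 : ℝ) ≤ n₀ := by exact_mod_cast Nat.one_le_iff_ne_zero.2 h
  unfold ratioQ
  split_ifs with hk
  · exact h0
  · have : (1 : ℝ) ≤ k := by exact_mod_cast Nat.one_le_iff_ne_zero.2 hk
    nlinarith

lemma scaleS_pos (n₀ k : ℕ) (h : n₀ ≠ 0) : 0 < scaleS n₀ k := by
  have : (0 : ℝ) < n₀ := by exact_mod_cast Nat.pos_of_ne_zero h
  unfold scaleS cScale
  split_ifs <;> positivity

lemma scaleC_pos (n₀ k : ℕ) (h : n₀ ≠ 0) : 0 < scaleC n₀ k := by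
  have := one_le_ratioQ h k
  rw [scaleC_eq h]
  exact mul_pos (scaleS_pos n₀ k h) (by linarith)

/-- The definition `m_1 = n₀³` is what makes this hold at `k = 0`, where the ratio is `n₀` instead
of a square. -/
lemma mPar_succ (n₀ k : ℕ) : (mPar n₀ (k + 1) : ℝ) = ratioQ n₀ k * ((n₀ : ℝ) + 3 * k) ^ 2 := by
  rcases k with _ | k
  · simp [mPar, ratioQ]; ring
  · simp only [mPar, ratioQ, if_neg (Nat.succ_ne_zero k)]
    push_cast
    ring

lemma nPar_succ (n₀ k : ℕ) : (nPar n₀ (k + 1) : ℝ) =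
    ((n₀ : ℝ) + 3 * k + 1) ^ 2 * ((n₀ : ℝ) + 3 * k + 2) ^ 2 := by
  simp [nPar]

lemma pPar_succ (n₀ k : ℕ) : (pPar n₀ (k + 1) : ℝ) =
    ((n₀ : ℝ) + 3 * k + 3) ^ 2 * ((n₀ : ℝ) + 3 * k + 4) ^ 2 := by
  simp only [pPar]
  push_cast
  ring

/-- The scales of the columns of `Q(k + 1)`. -/
def scale (n₀ k : ℕ) : Fin 4 → ℝ :=
  ![scaleS n₀ (k + 1), scaleS n₀ (k + 1), scaleC n₀ k, scaleS n₀ k]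

lemma scale_pos {n₀ : ℕ} (h : n₀ ≠ 0) (k : ℕ) (j : Fin 4) : 0 < scale n₀ k j := by
  fin_cases j
  · exact scaleS_pos _ _ h
  · exact scaleS_pos _ _ h
  · exact scaleC_pos _ _ h
  · exact scaleS_pos _ _ h

/-! ### Normalized columns and the propagation of their directions. -/

/-- The columns of `Q(k + 1)`, normalized by their expected size. -/
def nrm (n₀ k : ℕ) (j i : Fin 4) : ℝ := altCol n₀ (k + 1) j i / scale n₀ k j

lemma altCol_eq {n₀ : ℕ} (h : n₀ ≠ 0) (k : ℕ) (j i : Fin 4) :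
    altCol n₀ (k + 1) j i = scale n₀ k j * nrm n₀ k j i := by
  rw [nrm, mul_div_cancel₀ _ (scale_pos h k j).ne']

/-- Form of each normalized recursion: one dominant column with coefficient `1 + c`, the other
coefficients small and the columns bounded a priori. -/
lemma abs_sub_le_of_coeff {x y z a b c t : ℝ} (hx : |x| ≤ 2) (hy : |y| ≤ 2) (hz : |z| ≤ 2)
    (ha : 0 ≤ a) (hb : 0 ≤ b) (hc : 0 ≤ c) (ht : a + b + c ≤ t) :
    |a * x + b * y + (1 + c) * z - z| ≤ 2 * t := by
  have h1 : |a * x + b * y + c * z| ≤ a * 2 + b * 2 + c * 2 := by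
    refine (abs_add_three _ _ _).trans ?_
    rw [abs_mul, abs_mul, abs_mul, abs_of_nonneg ha, abs_of_nonneg hb, abs_of_nonneg hc]
    gcongr
  rw [show a * x + b * y + (1 + c) * z - z = a * x + b * y + c * z by ring]
  linarith

section Step

variable {n₀ : ℕ} (h : n₀ ≠ 0) (k : ℕ) (i : Fin 4)
include h

lemma one_le_base : 1 ≤ (n₀ : ℝ) + 3 * k := by
  have h0 : (1 : ℝ) ≤ n₀ := by exact_mod_cast Nat.one_le_iff_ne_zero.2 h
  have : (0 : ℝ) ≤ k := Nat.cast_nonneg k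
  linarith

/-- The competing term `m_{k+1} c_{3k-2} = c_{3k}` is smaller than the size `c_{3k+1}` of the first
column by `(n₀+3k+1)²`. -/
lemma nrm_succ_three_sub (hb : ∀ j, |nrm n₀ k j i| ≤ 2) :
    |nrm n₀ (k + 1) 3 i - nrm n₀ k 0 i| ≤ 28 / ((n₀ : ℝ) + 3 * k) ^ 2 := by
  have hz := one_le_base h k
  have hq := one_le_ratioQ h k
  have hS := scaleS_pos n₀ k h
  have e : nrm n₀ (k + 1) 3 i = 0 * nrm n₀ k 2 i + (ratioQ n₀ k * ((n₀ : ℝ) + 3 * k) ^ 2 + 1) /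
      (ratioQ n₀ k * ((n₀ : ℝ) + 3 * k) ^ 2 * ((n₀ : ℝ) + 3 * k + 1) ^ 2) * nrm n₀ k 3 i +
        (1 + 0) * nrm n₀ k 0 i := by
    rw [nrm, altCol_succ_three, altCol_eq h, altCol_eq h, mPar_succ]
    simp only [scale, vec_four_apply, scaleS_succ h, scaleC_eq h]
    field_simp
    ring
  rw [e]
  refine (abs_sub_le_of_coeff (hb _) (hb _) (hb _) le_rfl (by positivity) le_rfl 
    (t := 2 / ((n₀ : ℝ) + 3 * k) ^ 2) ?_).trans ?_
  · rw [zero_add, add_zero, div_le_div_iff₀ (by positivity) (by positivity)]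
    generalize (n₀ : ℝ) + 3 * k = z at hz ⊢
    have h1 : 1 ≤ ratioQ n₀ k * z ^ 2 := by nlinarith
    have h2 : z ^ 2 ≤ (z + 1) ^ 2 := by nlinarith
    nlinarith [mul_le_mul_of_nonneg_left h2 (by linarith : 0 ≤ ratioQ n₀ k * z ^ 2)]
  · rw [← mul_div_assoc]
    gcongr
    norm_num

lemma inv_bounds : 0 < 1 / ((n₀ : ℝ) + 3 * k) ^ 2 ∧ 1 / ((n₀ : ℝ) + 3 * k) ^ 2 ≤ 1 ∧
    0 < 1 / (mPar n₀ (k + 1) : ℝ) ∧ 1 / (mPar n₀ (k + 1) : ℝ) ≤ 1 / ((n₀ : ℝ) + 3 * k) ^ 2 ∧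
    0 < 1 / (nPar n₀ (k + 1) : ℝ) ∧ 1 / (nPar n₀ (k + 1) : ℝ) ≤ 1 / ((n₀ : ℝ) + 3 * k) ^ 2 ∧
    0 < 1 / (pPar n₀ (k + 1) : ℝ) ∧ 1 / (pPar n₀ (k + 1) : ℝ) ≤ 1 / ((n₀ : ℝ) + 3 * k) ^ 2 ∧
    0 < 1 / ((n₀ : ℝ) + 3 * k + 2) ^ 2 ∧
    1 / ((n₀ : ℝ) + 3 * k + 2) ^ 2 ≤ 1 / ((n₀ : ℝ) + 3 * k) ^ 2 := by
  have hz := one_le_base h k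
  have hq := one_le_ratioQ h k
  rw [mPar_succ, nPar_succ, pPar_succ]
  generalize (n₀ : ℝ) + 3 * k = z at hz ⊢
  have h1 : 1 ≤ z ^ 2 := by nlinarith
  have h2 : ∀ t : ℝ, 0 ≤ t → z ^ 2 ≤ (z + t) ^ 2 := fun t ht => by nlinarith
  refine ⟨by positivity, by rw [div_le_one (by positivity)]; exact h1, by positivity, ?_,
    by positivity, ?_, by positivity, ?_, by positivity, ?_⟩ <;>
    refine one_div_le_one_div_of_le (by positivity) ?_
  · nlinarith
  · nlinarith [h2 1 (by norm_num), h2 2 (by norm_num)]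
  · nlinarith [h2 3 (by norm_num), h2 4 (by norm_num)]
  · exact h2 2 (by norm_num)

/-- Here `m_{k+1} n_{k+1} c_{3k-2} = c_{3k+2}` is exactly the new scale, so the old fourth column
dominates despite being the smallest in scale. The same product times `p_{k+1}` governs
`nrm_succ_zero_sub` and `nrm_succ_one_sub`. -/
lemma nrm_succ_two_sub (hb : ∀ j, |nrm n₀ k j i| ≤ 2) :
    |nrm n₀ (k + 1) 2 i - nrm n₀ k 3 i| ≤ 28 / ((n₀ : ℝ) + 3 * k) ^ 2 := by
  have hz := one_le_base h k
  have hq := one_le_ratioQ h k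
  have hS := scaleS_pos n₀ k h
  obtain ⟨hi, hi1, hm, hmi, hn, hni, hp, hpi, hw, hwi⟩ := inv_bounds h k
  have e : nrm n₀ (k + 1) 2 i = (2 * (1 / ((n₀ : ℝ) + 3 * k + 2) ^ 2)) * nrm n₀ k 1 i +
      (1 / ((n₀ : ℝ) + 3 * k) ^ 2) * nrm n₀ k 2 i +
      (1 + (2 * (1 / (nPar n₀ (k + 1) : ℝ)) +
        1 / (mPar n₀ (k + 1) : ℝ) * (1 / (nPar n₀ (k + 1) : ℝ)))) * nrm n₀ k 3 i := by
    rw [nrm, altCol_succ_two, altCol_eq h, altCol_eq h, altCol_eq h, mPar_succ, nPar_succ]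
    simp only [scale, vec_four_apply, scaleC_succ h, scaleS_succ h k, scaleC_eq h k]
    field_simp
    ring
  rw [e]
  refine (abs_sub_le_of_coeff (hb _) (hb _) (hb _) (by positivity) (by positivity) (by positivity)
    (t := 14 * (1 / ((n₀ : ℝ) + 3 * k) ^ 2)) ?_).trans (le_of_eq (by ring))
  generalize 1 / ((n₀ : ℝ) + 3 * k) ^ 2 = z at *
  generalize 1 / ((n₀ : ℝ) + 3 * k + 2) ^ 2 = w at *
  generalize 1 / (mPar n₀ (k + 1) : ℝ) = a at *
  generalize 1 / (nPar n₀ (k + 1) : ℝ) = b at *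
  have h1 : a * b ≤ z := by nlinarith
  linarith

lemma nrm_succ_zero_sub (hb : ∀ j, |nrm n₀ k j i| ≤ 2) :
    |nrm n₀ (k + 1) 0 i - nrm n₀ k 3 i| ≤ 28 / ((n₀ : ℝ) + 3 * k) ^ 2 := by
  have hz := one_le_base h k
  have hq := one_le_ratioQ h k
  have hS := scaleS_pos n₀ k h
  obtain ⟨hi, hi1, hm, hmi, hn, hni, hp, hpi, hw, hwi⟩ := inv_bounds h k
  have e : nrm n₀ (k + 1) 0 i =
      ((1 + 1 / (pPar n₀ (k + 1) : ℝ)) * (1 / ((n₀ : ℝ) + 3 * k + 2) ^ 2)) * nrm n₀ k 1 i +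
      ((1 + 1 / (nPar n₀ (k + 1) : ℝ)) * (1 / ((n₀ : ℝ) + 3 * k) ^ 2)) * nrm n₀ k 2 i +
      (1 + (2 * (1 / (nPar n₀ (k + 1) : ℝ)) +
        1 / (nPar n₀ (k + 1) : ℝ) * (1 / (pPar n₀ (k + 1) : ℝ)) +
        1 / (mPar n₀ (k + 1) : ℝ) * (1 / (nPar n₀ (k + 1) : ℝ) * (1 / (pPar n₀ (k + 1) : ℝ))))) *
          nrm n₀ k 3 i := by
    rw [nrm, altCol_succ_zero, altCol_eq h, altCol_eq h, altCol_eq h, mPar_succ, nPar_succ,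
      pPar_succ]
    simp only [scale, vec_four_apply, scaleS_succ h (k + 1), scaleC_succ h, scaleS_succ h k,
      scaleC_eq h k]
    push_cast
    rw [show (n₀ : ℝ) + 3 * (k + 1) = n₀ + 3 * k + 3 by ring,
      show (n₀ : ℝ) + 3 * k + 3 + 1 = n₀ + 3 * k + 4 by ring]
    field_simp
    ring
  rw [e]
  refine (abs_sub_le_of_coeff (hb _) (hb _) (hb _) (by positivity) (by positivity) (by positivity)
    (t := 14 * (1 / ((n₀ : ℝ) + 3 * k) ^ 2)) ?_).trans (le_of_eq (by ring))
  generalize 1 / ((n₀ : ℝ) + 3 * k) ^ 2 = z at *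
  generalize 1 / ((n₀ : ℝ) + 3 * k + 2) ^ 2 = w at *
  generalize 1 / (mPar n₀ (k + 1) : ℝ) = a at *
  generalize 1 / (nPar n₀ (k + 1) : ℝ) = b at *
  generalize 1 / (pPar n₀ (k + 1) : ℝ) = c at *
  have h1 : b * c ≤ z := by nlinarith
  have h2 : a * (b * c) ≤ z := by nlinarith
  have h3 : c * w ≤ z := by nlinarith
  have h4 : b * z ≤ z := by nlinarith
  linarith

lemma nrm_succ_one_sub (hb : ∀ j, |nrm n₀ k j i| ≤ 2) :
    |nrm n₀ (k + 1) 1 i - nrm n₀ k 3 i| ≤ 28 / ((n₀ : ℝ) + 3 * k) ^ 2 := by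
  have hz := one_le_base h k
  have hq := one_le_ratioQ h k
  have hS := scaleS_pos n₀ k h
  obtain ⟨hi, hi1, hm, hmi, hn, hni, hp, hpi, hw, hwi⟩ := inv_bounds h k
  have e : nrm n₀ (k + 1) 1 i =
      ((1 + 2 * (1 / (pPar n₀ (k + 1) : ℝ))) * (1 / ((n₀ : ℝ) + 3 * k + 2) ^ 2)) * nrm n₀ k 1 i +
      ((1 + 1 / (nPar n₀ (k + 1) : ℝ)) * (1 + 1 / (pPar n₀ (k + 1) : ℝ)) *
        (1 / ((n₀ : ℝ) + 3 * k) ^ 2)) * nrm n₀ k 2 i +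
      (1 + (2 * (1 / (nPar n₀ (k + 1) : ℝ)) + 1 / (pPar n₀ (k + 1) : ℝ) +
        3 * (1 / (nPar n₀ (k + 1) : ℝ) * (1 / (pPar n₀ (k + 1) : ℝ))) +
        1 / (mPar n₀ (k + 1) : ℝ) * (1 / (nPar n₀ (k + 1) : ℝ) * (1 / (pPar n₀ (k + 1) : ℝ))))) *
          nrm n₀ k 3 i := by
    rw [nrm, altCol_succ_one, altCol_eq h, altCol_eq h, altCol_eq h, mPar_succ, nPar_succ,
      pPar_succ]
    simp only [scale, vec_four_apply, scaleS_succ h (k + 1), scaleC_succ h, scaleS_succ h k,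
      scaleC_eq h k]
    push_cast
    rw [show (n₀ : ℝ) + 3 * (k + 1) = n₀ + 3 * k + 3 by ring,
      show (n₀ : ℝ) + 3 * k + 3 + 1 = n₀ + 3 * k + 4 by ring]
    field_simp
    ring
  rw [e]
  refine (abs_sub_le_of_coeff (hb _) (hb _) (hb _) (by positivity) (by positivity) (by positivity)
    (t := 14 * (1 / ((n₀ : ℝ) + 3 * k) ^ 2)) ?_).trans (le_of_eq (by ring))
  generalize 1 / ((n₀ : ℝ) + 3 * k) ^ 2 = z at *
  generalize 1 / ((n₀ : ℝ) + 3 * k + 2) ^ 2 = w at *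
  generalize 1 / (mPar n₀ (k + 1) : ℝ) = a at *
  generalize 1 / (nPar n₀ (k + 1) : ℝ) = b at *
  generalize 1 / (pPar n₀ (k + 1) : ℝ) = c at *
  have h1 : b * c ≤ z := by nlinarith
  have h2 : a * (b * c) ≤ z := by nlinarith
  have h3 : c * w ≤ z := by nlinarith
  have h4 : b * z ≤ z := by nlinarith
  have h5 : c * z ≤ z := by nlinarith
  have h6 : b * (c * z) ≤ z := by nlinarith [mul_pos hp hi]
  linarith

end Step

/-- The two limit directions, and their order in `nrm`. -/
def tgt (k : ℕ) (j : Fin 4) : Fin 4 → ℝ :=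
  if (Even k ↔ j = 3) then ![1, 0, 0, 1] else ![0, 0, 1, 0]

lemma tgt_succ_three (k : ℕ) : tgt (k + 1) 3 = tgt k 0 := by
  simp only [tgt, Nat.even_add_one]
  by_cases h : Even k <;> simp [h]

lemma tgt_succ_of_ne (k : ℕ) {j : Fin 4} (hj : j ≠ 3) : tgt (k + 1) j = tgt k 3 := by
  simp only [tgt, Nat.even_add_one, hj]
  by_cases h : Even k <;> simp [h]

lemma nrm_succ_of_ne_sub {n₀ : ℕ} (h : n₀ ≠ 0) (k : ℕ) {j : Fin 4} (hj : j ≠ 3) (i : Fin 4)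
    (hb : ∀ j, |nrm n₀ k j i| ≤ 2) :
    |nrm n₀ (k + 1) j i - nrm n₀ k 3 i| ≤ 28 / ((n₀ : ℝ) + 3 * k) ^ 2 := by
  rcases (by omega : j = 0 ∨ j = 1 ∨ j = 2) with rfl | rfl | rfl
  · exact nrm_succ_zero_sub h k i hb
  · exact nrm_succ_one_sub h k i hb
  · exact nrm_succ_two_sub h k i hb

lemma scale_zero {n₀ : ℕ} (h : n₀ ≠ 0) :
    scale n₀ 0 = ![(n₀ : ℝ) * pPar n₀ 0, (n₀ : ℝ) * pPar n₀ 0, (n₀ : ℝ), 1] := by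
  have h0 : scaleS n₀ 0 = 1 := by simp [scaleS, cScale_neg_two]
  have h1 : scaleC n₀ 0 = n₀ := by simp [scaleC_eq h, h0, ratioQ]
  have h2 : scaleS n₀ 1 = n₀ * pPar n₀ 0 := by
    have := scaleS_succ h 0
    rw [this, h1, pPar]
    push_cast
    ring
  rw [scale, zero_add, h0, h1, h2]

lemma abs_div_sub_le {x y t e : ℝ} (hy : 0 < y) (h : |x - t * y| ≤ e * y) : |x / y - t| ≤ e := by
  rw [div_sub' hy.ne', abs_div, abs_of_pos hy, div_le_iff₀ hy, mul_comm y t]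
  exact h

/-- Direct inspection of `Q(1)`, which is `Z0 0 n₀ p₀`: the choice `m_0 = 0` keeps its columns close
to `v` and `w`. -/
lemma nrm_zero_sub {n₀ : ℕ} (h : n₀ ≠ 0) (j i : Fin 4) : |nrm n₀ 0 j i - tgt 0 j i| ≤ 3 / n₀ := by
  have h0 : (1 : ℝ) ≤ n₀ := by exact_mod_cast Nat.one_le_iff_ne_zero.2 h
  have hp : (n₀ : ℝ) ≤ pPar n₀ 0 := by
    rw [pPar]
    push_cast
    nlinarith
  refine abs_div_sub_le (scale_pos h 0 j) ?_
  rw [scale_zero h]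
  generalize hP : pPar n₀ 0 = p at hp
  have h1 : (n₀ : ℝ) ≠ 0 := by positivity
  have hn : (1 : ℝ) ≤ (n₀ : ℝ) * p := by nlinarith
  have e1 : 3 / (n₀ : ℝ) * (n₀ * p) = 3 * p := by field_simp
  have e2 : 3 / (n₀ : ℝ) * n₀ = 3 := by field_simp
  have e3 : 0 ≤ 3 / (n₀ : ℝ) := by positivity
  have hp1 : (1 : ℝ) ≤ p := h0.trans hp
  fin_cases j <;> fin_cases i <;>
    simp [altCol, loopQ, loopZ, Z0, tgt, mPar, nPar, hP, Fin.rev, e1, e2] <;>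
    first | linarith | (rw [abs_le]; constructor <;> nlinarith)

/-- The error bound for the normalized columns. -/
def err (n₀ k : ℕ) : ℝ := 3 / n₀ + 10 / ((n₀ : ℝ) - 3) - 10 / ((n₀ : ℝ) + 3 * k - 3)

lemma err_le {n₀ : ℕ} (h : 23 ≤ n₀) (k : ℕ) : err n₀ k ≤ 23 / n₀ := by
  have h0 : (23 : ℝ) ≤ n₀ := by exact_mod_cast h
  have hk : (0 : ℝ) ≤ k := Nat.cast_nonneg k
  have h1 : 10 / ((n₀ : ℝ) - 3) ≤ 20 / n₀ := by
    rw [div_le_div_iff₀ (by linarith) (by linarith)]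
    linarith
  have h2 : 0 ≤ 10 / ((n₀ : ℝ) + 3 * k - 3) := div_nonneg (by norm_num) (by linarith)
  have h3 : (23 : ℝ) / n₀ = 3 / n₀ + 20 / n₀ := by ring
  rw [err]
  linarith

/-- Telescoping majorant of the series of errors: with `z = n₀ + 3k`, one has `10/(z-3) - 10/z =
30/(z(z-3)) ≥ 28/z²`. -/
lemma err_add_le {n₀ : ℕ} (h : 23 ≤ n₀) (k : ℕ) :
    err n₀ k + 28 / ((n₀ : ℝ) + 3 * k) ^ 2 ≤ err n₀ (k + 1) := by
  have h0 : (23 : ℝ) ≤ n₀ := by exact_mod_cast h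
  have hk : (0 : ℝ) ≤ k := Nat.cast_nonneg k
  have h1 : 28 / ((n₀ : ℝ) + 3 * k) ^ 2 ≤
      10 / ((n₀ : ℝ) + 3 * k - 3) - 10 / ((n₀ : ℝ) + 3 * k) := by
    have hz : (23 : ℝ) ≤ n₀ + 3 * k := by linarith
    generalize (n₀ : ℝ) + 3 * k = z at hz ⊢
    rw [div_sub_div _ _ (by linarith) (by linarith), div_le_div_iff₀ (by positivity)
      (mul_pos (by linarith) (by linarith))]
    nlinarith
  rw [err, err]
  push_cast
  rw [show (n₀ : ℝ) + 3 * (k + 1) - 3 = n₀ + 3 * k by ring]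
  linarith

lemma abs_tgt_le (k : ℕ) (j i : Fin 4) : |tgt k j i| ≤ 1 := by
  unfold tgt
  split_ifs <;> fin_cases i <;> simp

/-- The bound `23 ≤ n₀` makes the accumulated error at most `1`, so the columns stay bounded by `2`,
which is the hypothesis needed for the next step. -/
lemma nrm_sub_tgt_err {n₀ : ℕ} (h : 23 ≤ n₀) (k : ℕ) (j i : Fin 4) :
    |nrm n₀ k j i - tgt k j i| ≤ err n₀ k := by
  have hn : n₀ ≠ 0 := by omega
  have h0 : (23 : ℝ) ≤ n₀ := by exact_mod_cast h
  induction k generalizing j with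
  | zero => exact (nrm_zero_sub hn j i).trans (by rw [err]; simp)
  | succ k ih =>
    have he := err_le h k
    have he' := err_add_le h k
    have h1 : (23 : ℝ) / n₀ ≤ 1 := by rw [div_le_one (by linarith)]; exact h0
    have hb : ∀ j, |nrm n₀ k j i| ≤ 2 := fun j => by
      have := abs_sub_abs_le_abs_sub (nrm n₀ k j i) (tgt k j i)
      linarith [ih j, abs_tgt_le k j i]
    by_cases hj : j = 3
    · subst hj
      rw [tgt_succ_three]
      refine (abs_sub_le _ (nrm n₀ k 0 i) _).trans ?_
      linarith [nrm_succ_three_sub hn k i hb, ih 0]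
    · rw [tgt_succ_of_ne k hj]
      refine (abs_sub_le _ (nrm n₀ k 3 i) _).trans ?_
      linarith [nrm_succ_of_ne_sub hn k hj i hb, ih 3]

lemma nrm_sub_tgt {n₀ : ℕ} (h : 23 ≤ n₀) (k : ℕ) (j i : Fin 4) :
    |nrm n₀ k j i - tgt k j i| ≤ 23 / n₀ :=
  (nrm_sub_tgt_err h k j i).trans (err_le h k)

lemma abs_nrm_le {n₀ : ℕ} (h : 23 ≤ n₀) (k : ℕ) (j i : Fin 4) : |nrm n₀ k j i| ≤ 2 := by
  have h0 : (23 : ℝ) ≤ n₀ := by exact_mod_cast h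
  have h1 : (23 : ℝ) / n₀ ≤ 1 := by rw [div_le_one (by linarith)]; exact h0
  have := abs_sub_abs_le_abs_sub (nrm n₀ k j i) (tgt k j i)
  linarith [nrm_sub_tgt h k j i, abs_tgt_le k j i]

lemma colApprox_altCol {n₀ : ℕ} (h : 23 ≤ n₀) {K : ℝ} (hK : 23 ≤ K) (k : ℕ) (j : Fin 4) :
    ColApprox K n₀ (k + 1) (if Even (k + 1) then j else Fin.rev j) (scale n₀ k j) (tgt k j) := by
  intro i
  have hn : n₀ ≠ 0 := by omega
  have hs := scale_pos hn k j
  have h1 := altCol_eq hn k j i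
  rw [altCol] at h1
  rw [h1, ← mul_sub, abs_mul, abs_of_pos hs]
  gcongr
  exact (nrm_sub_tgt h k j i).trans (by gcongr)

lemma colApprox_odd {n₀ : ℕ} (h : 23 ≤ n₀) {K : ℝ} (hK : 23 ≤ K) (l : ℕ) (j : Fin 4) :
    ColApprox K n₀ (2 * l + 1) (Fin.rev j) (scale n₀ (2 * l) j) (tgt (2 * l) j) := by
  have := colApprox_altCol h hK (2 * l) j
  rwa [if_neg (by simp)] at this

lemma colApprox_even {n₀ : ℕ} (h : 23 ≤ n₀) {K : ℝ} (hK : 23 ≤ K) (l : ℕ) (j : Fin 4) :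
    ColApprox K n₀ (2 * l + 2) j (scale n₀ (2 * l + 1) j) (tgt (2 * l + 1) j) := by
  have := colApprox_altCol h hK (2 * l + 1) j
  rwa [if_pos (by simp [Nat.even_add_one])] at this

lemma column_estimates {n₀ : ℕ} (h : 23 ≤ n₀) {K : ℝ} (hK : 23 ≤ K) {l : ℕ} (hl : 1 ≤ l) :
    ColApprox K n₀ (2 * l - 1) lA (cScale n₀ (6 * l - 8)) ![1, 0, 0, 1] ∧
    ColApprox K n₀ (2 * l - 1) lB (cScale n₀ (6 * l - 7)) ![0, 0, 1, 0] ∧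
    ColApprox K n₀ (2 * l - 1) lC (cScale n₀ (6 * l - 5)) ![0, 0, 1, 0] ∧
    ColApprox K n₀ (2 * l - 1) lD (cScale n₀ (6 * l - 5)) ![0, 0, 1, 0] ∧
    ColApprox K n₀ (2 * l) lD (cScale n₀ (6 * l - 5)) ![0, 0, 1, 0] ∧
    ColApprox K n₀ (2 * l) lC (cScale n₀ (6 * l - 4)) ![1, 0, 0, 1] ∧
    ColApprox K n₀ (2 * l) lB (cScale n₀ (6 * l - 2)) ![1, 0, 0, 1] ∧
    ColApprox K n₀ (2 * l) lA (cScale n₀ (6 * l - 2)) ![1, 0, 0, 1] := by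
  obtain ⟨k, rfl⟩ := Nat.exists_eq_succ_of_ne_zero (by omega : l ≠ 0)
  have ho := colApprox_odd h hK k
  have he := colApprox_even h hK k
  have t1 : ∀ j, tgt (2 * k) j = if j = 3 then ![1, 0, 0, 1] else ![0, 0, 1, 0] := fun j => by
    simp [tgt]
  have t2 : ∀ j, tgt (2 * k + 1) j = if j = 3 then ![0, 0, 1, 0] else ![1, 0, 0, 1] := fun j => by
    simp [tgt]
  simp only [t1, scale, scaleS, scaleC] at ho
  simp only [t2, scale, scaleS, scaleC] at he
  rw [show 2 * k.succ - 1 = 2 * k + 1 by omega, show 2 * k.succ = 2 * k + 2 by omega]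
  have c8 : (6 * (k.succ : ℤ) - 8) = 3 * ((2 * k : ℕ) : ℤ) - 2 := by push_cast; ring
  have c7 : (6 * (k.succ : ℤ) - 7) = 3 * ((2 * k : ℕ) : ℤ) - 1 := by push_cast; ring
  have c5 : (6 * (k.succ : ℤ) - 5) = 3 * ((2 * k + 1 : ℕ) : ℤ) - 2 := by push_cast; ring
  have c4 : (6 * (k.succ : ℤ) - 4) = 3 * ((2 * k + 1 : ℕ) : ℤ) - 1 := by push_cast; ring
  have c2 : (6 * (k.succ : ℤ) - 2) = 3 * ((2 * k + 1 + 1 : ℕ) : ℤ) - 2 := by push_cast; ring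
  rw [c8, c7, c5, c4, c2]
  exact ⟨ho 3, ho 2, ho 1, ho 0, he 3, he 2, he 1, he 0⟩

/-! ### Limits of the normalized columns. -/

/-- The normalization of a vector for the `ℓ¹` norm. -/
def unitVec (x : Fin 4 → ℝ) (i : Fin 4) : ℝ := x i / ∑ i', |x i'|

lemma normCol_altCol {n₀ : ℕ} (hn : n₀ ≠ 0) (k : ℕ) (j : Fin 4) :
    normCol n₀ (k + 1) (if Even (k + 1) then j else Fin.rev j) = unitVec (nrm n₀ k j) := by
  have hs := scale_pos hn k j
  have h1 : ∀ i, loopQ n₀ (k + 1) i (if Even (k + 1) then j else Fin.rev j) =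
      scale n₀ k j * nrm n₀ k j i := fun i => altCol_eq hn k j i
  funext i
  simp only [normCol, unitVec, h1, abs_mul, abs_of_pos hs, ← Finset.mul_sum]
  rw [mul_div_mul_left _ _ hs.ne']

lemma normCol_odd {n₀ : ℕ} (hn : n₀ ≠ 0) (l : ℕ) (j : Fin 4) :
    normCol n₀ (2 * l + 1) (Fin.rev j) = unitVec (nrm n₀ (2 * l) j) := by
  have := normCol_altCol hn (2 * l) j
  rwa [if_neg (by simp)] at this

lemma normCol_even {n₀ : ℕ} (hn : n₀ ≠ 0) (l : ℕ) (j : Fin 4) :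
    normCol n₀ (2 * l + 2) j = unitVec (nrm n₀ (2 * l + 1) j) := by
  have := normCol_altCol hn (2 * l + 1) j
  rwa [if_pos (by simp [Nat.even_add_one])] at this

lemma tendsto_unitVec {ι : Type*} {f : Filter ι} {x : ι → Fin 4 → ℝ} {y : Fin 4 → ℝ}
    (hx : Tendsto x f (𝓝 y)) (hy : ∑ i, |y i| ≠ 0) :
    Tendsto (fun k => unitVec (x k)) f (𝓝 (unitVec y)) := by
  rw [tendsto_pi_nhds] at hx ⊢
  exact fun i => (hx i).div (tendsto_finsetSum _ fun i' _ => (hx i').abs) hy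

lemma sum_abs_unitVec {y : Fin 4 → ℝ} (hy : ∑ i, |y i| ≠ 0) : ∑ i, |unitVec y i| = 1 := by
  have h : 0 ≤ ∑ i, |y i| := Finset.sum_nonneg fun i _ => abs_nonneg _
  simp only [unitVec, abs_div, abs_of_nonneg h, ← Finset.sum_div]
  exact div_self hy

/-- The normalized columns `A` (for `s = 0`) or `D` (for `s = 1`) of `Q(k + 1)`. -/
def mainCol (n₀ s k : ℕ) : Fin 4 → ℝ := nrm n₀ k (if Even (s + k) then 3 else 0)

lemma summable_err (n₀ : ℕ) : Summable fun k : ℕ => 28 / ((n₀ : ℝ) + 3 * k) ^ 2 := by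
  have h1 : Summable fun k : ℕ => 28 * (1 / (k : ℝ) ^ 2) :=
    (Real.summable_one_div_nat_pow.2 one_lt_two).mul_left 28
  rw [← summable_nat_add_iff 1] at h1 ⊢
  refine Summable.of_nonneg_of_le (fun k => by positivity) (fun k => ?_) h1
  rw [mul_one_div]
  have h2 : (0 : ℝ) ≤ n₀ := Nat.cast_nonneg _
  have h3 : (0 : ℝ) ≤ k := Nat.cast_nonneg _
  push_cast
  exact div_le_div_of_nonneg_left (by norm_num) (by positivity)
    (pow_le_pow_left₀ (by positivity) (by linarith) 2)

/-- A fixed letter `A` or `D` alternates between positions `3` and `0`, and each of these positions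
inherits its direction from the other; so its normalized column has summable increments. -/
lemma mainCol_succ_sub {n₀ : ℕ} (h : 23 ≤ n₀) (s k : ℕ) (i : Fin 4) :
    |mainCol n₀ s (k + 1) i - mainCol n₀ s k i| ≤ 28 / ((n₀ : ℝ) + 3 * k) ^ 2 := by
  have hn : n₀ ≠ 0 := by omega
  have hb := fun j => abs_nrm_le h k j i
  simp only [mainCol, ← add_assoc, Nat.even_add_one]
  by_cases hk : Even (s + k)
  · rw [if_neg (by simpa using hk), if_pos hk]
    exact nrm_succ_zero_sub hn k i hb
  · rw [if_pos (by simpa using hk), if_neg hk]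
    exact nrm_succ_three_sub hn k i hb

/-- The limits of the columns `A` (for `s = 0`) or `D` (for `s = 1`). -/
def limCol (n₀ s : ℕ) : Fin 4 → ℝ := limUnder atTop fun k => mainCol n₀ s k

lemma tendsto_mainCol {n₀ : ℕ} (h : 23 ≤ n₀) (s : ℕ) :
    Tendsto (fun k => mainCol n₀ s k) atTop (𝓝 (limCol n₀ s)) := by
  refine CauchySeq.tendsto_limUnder ?_
  refine cauchySeq_of_dist_le_of_summable _ (fun k => ?_) (summable_err n₀)
  rw [dist_pi_le_iff (by positivity)]
  intro i
  rw [dist_comm, Real.dist_eq]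
  exact mainCol_succ_sub h s k i

/-- The limit directions. -/
def dirCol (s : ℕ) : Fin 4 → ℝ := if Even s then ![1, 0, 0, 1] else ![0, 0, 1, 0]

lemma limCol_sub {n₀ : ℕ} (h : 23 ≤ n₀) (s : ℕ) (i : Fin 4) :
    |limCol n₀ s i - dirCol s i| ≤ 23 / n₀ := by
  have h1 := (tendsto_pi_nhds.1 (tendsto_mainCol h s) i).sub_const (dirCol s i)
  refine le_of_tendsto h1.abs (Eventually.of_forall fun k => ?_)
  have h2 : dirCol s = tgt k (if Even (s + k) then 3 else 0) := by
    simp only [dirCol, tgt, Nat.even_add]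
    by_cases hs : Even s <;> by_cases hk : Even k <;> simp [hs, hk]
  rw [h2]
  exact nrm_sub_tgt h k _ i

/-- Columns in the first three positions copy the column previously in position `3`, which is the
main column of the class `s` when `s + k` is even. -/
lemma tendsto_nrm_succ {n₀ : ℕ} (h : 23 ≤ n₀) {j : Fin 4} (hj : j ≠ 3) {s : ℕ} {φ : ℕ → ℕ}
    (hφ : Tendsto φ atTop atTop) (he : ∀ l, Even (s + φ l)) :
    Tendsto (fun l => nrm n₀ (φ l + 1) j) atTop (𝓝 (limCol n₀ s)) := by
  have hn : n₀ ≠ 0 := by omega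
  have h1 := (tendsto_mainCol h s).comp hφ
  rw [tendsto_pi_nhds] at h1 ⊢
  intro i
  have h2 := (summable_err n₀).tendsto_atTop_zero.comp hφ
  refine (h1 i).congr_dist (squeeze_zero (fun _ => dist_nonneg) (fun l => ?_) h2)
  simp only [Function.comp, mainCol, if_pos (he l)]
  rw [dist_comm, Real.dist_eq]
  exact nrm_succ_of_ne_sub hn _ hj i fun j => abs_nrm_le h _ j i

/-! ### Growth -/

lemma loopZ_nonneg (n₀ k : ℕ) (i j : Fin 4) : 0 ≤ loopZ n₀ k i j := by
  unfold loopZ Z0 Z1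
  split_ifs <;> exact Nat.cast_nonneg _

lemma loopQ_nonneg (n₀ k : ℕ) (i j : Fin 4) : 0 ≤ loopQ n₀ k i j := by
  induction k generalizing i j with
  | zero =>
    simp only [loopQ, List.range_zero, List.map_nil, List.prod_nil, Matrix.one_apply]
    split_ifs <;> norm_num
  | succ k ih =>
    rw [loopQ_succ, Matrix.mul_apply]
    exact Finset.sum_nonneg fun l _ => mul_nonneg (ih _ _) (loopZ_nonneg _ _ _ _)

lemma sumNorm_loopZ (n₀ k : ℕ) : sumNorm (loopZ n₀ k) =
    11 + 4 * pPar n₀ k + 2 * nPar n₀ k + 7 * mPar n₀ k + 2 * (nPar n₀ k * pPar n₀ k) +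
      4 * (mPar n₀ k * pPar n₀ k) + 2 * (mPar n₀ k * nPar n₀ k) +
      2 * (mPar n₀ k * nPar n₀ k * pPar n₀ k) := by
  simp only [sumNorm, abs_of_nonneg (loopZ_nonneg n₀ k _ _)]
  unfold loopZ
  split_ifs
  · simp [Z0, Fin.sum_univ_four]
    ring
  · simp [Z1, Fin.sum_univ_four]
    ring

lemma monomial_bounds {m n p : ℝ} (hm : 1 ≤ m) (hn : 1 ≤ n) (hp : 1 ≤ p) :
    m * n * p ≤ 11 + 4 * p + 2 * n + 7 * m + 2 * (n * p) + 4 * (m * p) + 2 * (m * n) +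
      2 * (m * n * p) ∧
    11 + 4 * p + 2 * n + 7 * m + 2 * (n * p) + 4 * (m * p) + 2 * (m * n) +
      2 * (m * n * p) ≤ 40 * (m * n * p) := by
  have h1 : m ≤ m * n := le_mul_of_one_le_right (by linarith) hn
  have h2 : m * n ≤ m * n * p := le_mul_of_one_le_right (by positivity) hp
  have h3 : n * p ≤ m * (n * p) := le_mul_of_one_le_left (by positivity) hm
  have h4 : p ≤ n * p := le_mul_of_one_le_left (by linarith) hn
  have h5 : n ≤ n * p := le_mul_of_one_le_right (by linarith) hp
  have h6 : m * p ≤ n * (m * p) := le_mul_of_one_le_left (by positivity) hn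
  have h7 : 0 ≤ m * p := by positivity
  rw [← mul_assoc] at h3 h6
  rw [mul_comm n m] at h6
  constructor <;> linarith

lemma sumNorm_loopZ_isTheta {n₀ : ℕ} (h : 23 ≤ n₀) :
    (fun k : ℕ => sumNorm (loopZ n₀ k)) =Θ[atTop] fun k : ℕ => ((n₀ : ℝ) + 3 * k) ^ 12 := by
  have h0 : (23 : ℝ) ≤ n₀ := by exact_mod_cast h
  -- From `k = 2` on the exceptional values `m_0`, `m_1`, `n_0` no longer occur. With `y = n₀ + 3k`,
  -- each of `m, n, p` lies between `(y/2)^4` and `(2y)^4`, whence the factors `4096 = 2^12`; the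
  -- factor `40` is that of `monomial_bounds`.
  have key : ∀ k, 2 ≤ k → ((n₀ : ℝ) + 3 * k) ^ 12 ≤ 4096 * sumNorm (loopZ n₀ k) ∧
      0 ≤ sumNorm (loopZ n₀ k) ∧ sumNorm (loopZ n₀ k) ≤ 4096 * 40 * ((n₀ : ℝ) + 3 * k) ^ 12 := by
    intro k hk
    obtain ⟨k, rfl⟩ : ∃ l, k = l + 2 := ⟨k - 2, by omega⟩
    rw [sumNorm_loopZ, mPar_succ, nPar_succ, pPar_succ, ratioQ, if_neg (by omega)]
    push_cast
    have hk : (0 : ℝ) ≤ k := Nat.cast_nonneg k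
    have hy : (23 : ℝ) ≤ n₀ + 3 * (k + 2) := by linarith
    have e1 : (n₀ : ℝ) + 3 * (k + 1) - 1 = (n₀ + 3 * (k + 2)) - 4 := by ring
    have e2 : (n₀ : ℝ) + 3 * (k + 1) = (n₀ + 3 * (k + 2)) - 3 := by ring
    have e3 : (n₀ : ℝ) + 3 * (k + 1) + 1 = (n₀ + 3 * (k + 2)) - 2 := by ring
    have e4 : (n₀ : ℝ) + 3 * (k + 1) + 2 = (n₀ + 3 * (k + 2)) - 1 := by ring
    have e5 : (n₀ : ℝ) + 3 * (k + 1) + 3 = (n₀ + 3 * (k + 2)) := by ring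
    have e6 : (n₀ : ℝ) + 3 * (k + 1) + 4 = (n₀ + 3 * (k + 2)) + 1 := by ring
    rw [e1, e3, e4, e5, e6, e2]
    generalize (n₀ : ℝ) + 3 * (k + 2) = y at hy
    have hm1 : (y / 2) ^ 2 * (y / 2) ^ 2 ≤ (y - 4) ^ 2 * (y - 3) ^ 2 := by gcongr <;> linarith
    have hm2 : (y - 4) ^ 2 * (y - 3) ^ 2 ≤ (2 * y) ^ 2 * (2 * y) ^ 2 := by gcongr <;> linarith
    have hn1 : (y / 2) ^ 2 * (y / 2) ^ 2 ≤ (y - 2) ^ 2 * (y - 1) ^ 2 := by gcongr <;> linarith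
    have hn2 : (y - 2) ^ 2 * (y - 1) ^ 2 ≤ (2 * y) ^ 2 * (2 * y) ^ 2 := by gcongr <;> linarith
    have hp1 : (y / 2) ^ 2 * (y / 2) ^ 2 ≤ y ^ 2 * (y + 1) ^ 2 := by gcongr <;> linarith
    have hp2 : y ^ 2 * (y + 1) ^ 2 ≤ (2 * y) ^ 2 * (2 * y) ^ 2 := by gcongr <;> linarith
    generalize (y - 4) ^ 2 * (y - 3) ^ 2 = m at *
    generalize (y - 2) ^ 2 * (y - 1) ^ 2 = n at *
    generalize y ^ 2 * (y + 1) ^ 2 = p at *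
    set t := (y / 2) ^ 2 * (y / 2) ^ 2 with ht
    set s := (2 * y) ^ 2 * (2 * y) ^ 2 with hs
    have e7 : y ^ 12 = 4096 * (t * t * t) := by rw [ht]; ring
    have e8 : s * s * s = 4096 * y ^ 12 := by rw [hs]; ring
    have ht1 : 1 ≤ t := by rw [ht]; nlinarith [sq_nonneg (y / 2), (by nlinarith : 1 ≤ (y / 2) ^ 2)]
    have hm0 : 1 ≤ m := ht1.trans hm1
    have hn0 : 1 ≤ n := ht1.trans hn1
    have hp0 : 1 ≤ p := ht1.trans hp1
    obtain ⟨h1, h2⟩ := monomial_bounds hm0 hn0 hp0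
    have hA : t * t * t ≤ m * n * p := by gcongr
    have hB : m * n * p ≤ s * s * s := by gcongr
    refine ⟨?_, by positivity, ?_⟩
    · rw [e7]
      linarith
    · linarith
  refine ⟨IsBigO.of_bound (4096 * 40) ?_, IsBigO.of_bound 4096 ?_⟩ <;>
    filter_upwards [eventually_ge_atTop 2] with k hk <;>
    obtain ⟨h1, h2, h3⟩ := key k hk <;>
    rw [Real.norm_of_nonneg h2, Real.norm_of_nonneg (by positivity)] <;> assumption

lemma scaleS_le_scaleC {n₀ : ℕ} (h : n₀ ≠ 0) (k : ℕ) : scaleS n₀ k ≤ scaleC n₀ k := by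
  rw [scaleC_eq h]
  exact le_mul_of_one_le_right (scaleS_pos _ _ h).le (one_le_ratioQ h k)

lemma scaleC_mul_le {n₀ : ℕ} (h : n₀ ≠ 0) (k : ℕ) :
    scaleC n₀ k * (k + 1) ≤ scaleS n₀ (k + 1) := by
  have hc := scaleC_pos n₀ k h
  have h0 : (1 : ℝ) ≤ n₀ := by exact_mod_cast Nat.one_le_iff_ne_zero.2 h
  have hk : (0 : ℝ) ≤ k := Nat.cast_nonneg k
  rw [scaleS_succ h, mul_assoc]
  refine mul_le_mul_of_nonneg_left ?_ hc.le
  have h1 : 1 ≤ ((n₀ : ℝ) + 3 * k) ^ 2 := by nlinarith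
  have h2 : (k : ℝ) + 1 ≤ ((n₀ : ℝ) + 3 * k + 1) ^ 2 := by nlinarith
  nlinarith

/-- A crude lower bound is sufficient: it already makes `log ‖Q(k)‖` grow faster than every multiple
of `k`. -/
lemma factorial_le_scaleS {n₀ : ℕ} (h : n₀ ≠ 0) (k : ℕ) : (k.factorial : ℝ) ≤ scaleS n₀ k := by
  induction k with
  | zero => simp [scaleS, cScale_neg_two]
  | succ k ih =>
    refine le_trans ?_ (scaleC_mul_le h k)
    rw [Nat.factorial_succ]
    push_cast
    rw [mul_comm]
    have := scaleS_le_scaleC h k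
    gcongr
    exact ih.trans this

lemma scale_le {n₀ : ℕ} (h : n₀ ≠ 0) (k : ℕ) (j : Fin 4) :
    scaleS n₀ k ≤ scale n₀ k j ∧ scale n₀ k j ≤ scaleS n₀ (k + 1) := by
  have h1 := scaleS_le_scaleC h k
  have h2 : scaleC n₀ k ≤ scaleS n₀ (k + 1) := by
    refine le_trans (le_mul_of_one_le_right (scaleC_pos n₀ k h).le ?_) (scaleC_mul_le h k)
    linarith [Nat.cast_nonneg (α := ℝ) k]
  fin_cases j
  · exact ⟨h1.trans h2, le_rfl⟩
  · exact ⟨h1.trans h2, le_rfl⟩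
  · exact ⟨h1, h2⟩
  · exact ⟨le_rfl, h1.trans h2⟩

lemma sum_altCol (n₀ k : ℕ) (i : Fin 4) (f : Fin 4 → ℝ → ℝ) :
    ∑ j, f (if Even k then j else Fin.rev j) (altCol n₀ k j i) = ∑ j, f j (loopQ n₀ k i j) := by
  unfold altCol
  split_ifs
  · rfl
  · exact Equiv.sum_comp Fin.revPerm fun j => f j (loopQ n₀ k i j)

lemma sumNorm_loopQ_le {n₀ : ℕ} (h : 23 ≤ n₀) (k : ℕ) :
    sumNorm (loopQ n₀ (k + 1)) ≤ 32 * scaleS n₀ (k + 1) := by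
  have hn : n₀ ≠ 0 := by omega
  have h1 : ∀ i j, |altCol n₀ (k + 1) j i| ≤ 2 * scaleS n₀ (k + 1) := fun i j => by
    rw [altCol_eq hn, abs_mul, abs_of_pos (scale_pos hn k j), mul_comm]
    have := (scale_le hn k j).2
    have := abs_nrm_le h k j i
    have := scale_pos hn k j
    gcongr
  calc sumNorm (loopQ n₀ (k + 1)) = ∑ i, ∑ j, |altCol n₀ (k + 1) j i| := by
        rw [sumNorm]
        exact Finset.sum_congr rfl fun i _ => (sum_altCol n₀ (k + 1) i fun _ => abs).symm
    _ ≤ ∑ _i : Fin 4, ∑ _j : Fin 4, 2 * scaleS n₀ (k + 1) :=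
        Finset.sum_le_sum fun i _ => Finset.sum_le_sum fun j _ => h1 i j
    _ = 32 * scaleS n₀ (k + 1) := by simp; ring

lemma exists_half_le_nrm {n₀ : ℕ} (h : 46 ≤ n₀) (k : ℕ) (j : Fin 4) :
    ∃ i, 1 / 2 ≤ nrm n₀ k j i := by
  have h0 : (46 : ℝ) ≤ n₀ := by exact_mod_cast h
  have h1 : ∃ i, tgt k j i = 1 := by
    unfold tgt
    split_ifs
    · exact ⟨0, rfl⟩
    · exact ⟨2, rfl⟩
  obtain ⟨i, hi⟩ := h1
  refine ⟨i, ?_⟩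
  have h2 := nrm_sub_tgt (by omega : 23 ≤ n₀) k j i
  have h3 : (23 : ℝ) / n₀ ≤ 1 / 2 := by
    rw [div_le_div_iff₀ (by linarith) (by norm_num)]
    linarith
  rw [hi] at h2
  linarith [(abs_le.1 h2).1]

lemma half_scale_le_sum {n₀ : ℕ} (h : 46 ≤ n₀) (k : ℕ) (j : Fin 4) :
    scale n₀ k j / 2 ≤ ∑ i, altCol n₀ (k + 1) j i := by
  have hn : n₀ ≠ 0 := by omega
  obtain ⟨i, hi⟩ := exists_half_le_nrm h k j
  have h1 : altCol n₀ (k + 1) j i ≤ ∑ i, altCol n₀ (k + 1) j i :=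
    Finset.single_le_sum (f := fun i => altCol n₀ (k + 1) j i)
      (fun i _ => loopQ_nonneg _ _ _ _) (Finset.mem_univ i)
  refine le_trans ?_ h1
  rw [altCol_eq hn]
  have := scale_pos hn k j
  nlinarith

lemma le_sumNorm_loopQ {n₀ : ℕ} (h : 46 ≤ n₀) (k : ℕ) :
    scaleS n₀ (k + 1) / 2 ≤ sumNorm (loopQ n₀ (k + 1)) := by
  have h1 := half_scale_le_sum h k 0
  refine h1.trans ?_
  rw [sumNorm]
  refine Finset.sum_le_sum fun i _ => ?_
  exact (le_abs_self _).trans (Finset.single_le_sum (f := fun j => |loopQ n₀ (k + 1) i j|)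
    (fun j _ => abs_nonneg _) (Finset.mem_univ _))

lemma sumNorm_nonneg (M : Matrix (Fin 4) (Fin 4) ℝ) : 0 ≤ sumNorm M :=
  Finset.sum_nonneg fun _ _ => Finset.sum_nonneg fun _ _ => abs_nonneg _

lemma sumNorm_loopQ_isTheta {n₀ : ℕ} (h : 46 ≤ n₀) :
    (fun k : ℕ => sumNorm (loopQ n₀ k)) =Θ[atTop] fun k : ℕ => cScale n₀ (3 * k - 2) := by
  have hn : n₀ ≠ 0 := by omega
  refine ⟨IsBigO.of_bound 32 ?_, IsBigO.of_bound 2 ?_⟩ <;>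
    filter_upwards [eventually_ge_atTop 1] with k hk <;>
    obtain ⟨k, rfl⟩ := Nat.exists_eq_succ_of_ne_zero (by omega : k ≠ 0) <;>
    rw [Real.norm_of_nonneg (sumNorm_nonneg _),
      show cScale n₀ (3 * (k.succ : ℤ) - 2) = scaleS n₀ (k + 1) from rfl,
      Real.norm_of_nonneg (scaleS_pos n₀ (k + 1) hn).le]
  · exact sumNorm_loopQ_le (by omega) k
  · have := le_sumNorm_loopQ h k
    simp only [Nat.succ_eq_add_one]
    linarith

lemma tendsto_scaleS {n₀ : ℕ} (h : n₀ ≠ 0) : Tendsto (scaleS n₀) atTop atTop := by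
  refine tendsto_atTop_mono (f := fun k : ℕ => (k : ℝ)) (fun k => ?_) tendsto_natCast_atTop_atTop
  exact le_trans (by exact_mod_cast Nat.self_le_factorial k) (factorial_le_scaleS h k)

lemma tendsto_sumNorm_loopQ {n₀ : ℕ} (h : 46 ≤ n₀) :
    Tendsto (fun k => sumNorm (loopQ n₀ k)) atTop atTop := by
  rw [← tendsto_add_atTop_iff_nat 1]
  have h1 := ((tendsto_add_atTop_iff_nat 1).2
    (tendsto_scaleS (by omega : n₀ ≠ 0))).atTop_div_const (two_pos : (0 : ℝ) < 2)
  exact tendsto_atTop_mono (fun k => le_sumNorm_loopQ h k) h1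

lemma natCast_isLittleO_log {n₀ : ℕ} (h : 46 ≤ n₀) :
    (fun k : ℕ => (n₀ : ℝ) + 3 * k) =o[atTop] fun k => Real.log (sumNorm (loopQ n₀ k)) := by
  have hn : n₀ ≠ 0 := by omega
  have h1 : (fun k : ℕ => (n₀ : ℝ) + 3 * k) =O[atTop] fun k : ℕ => (k : ℝ) := by
    refine IsBigO.of_bound (n₀ + 3) ?_
    filter_upwards [eventually_ge_atTop 1] with k hk
    have hk : (1 : ℝ) ≤ k := by exact_mod_cast hk
    rw [Real.norm_of_nonneg (by positivity), Real.norm_of_nonneg (by positivity)]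
    have : (0 : ℝ) ≤ n₀ := Nat.cast_nonneg _
    nlinarith
  refine h1.trans_isLittleO (isLittleO_iff.2 fun c hc => ?_)
  -- Factorials outrun the geometric sequence `e^{k/c}`, so eventually `log ‖Q(k)‖ ≥ k/c`.
  have h2 := FloorSemiring.tendsto_pow_div_factorial_atTop (Real.exp (1 / c))
  filter_upwards [h2.eventually (gt_mem_nhds (show (0 : ℝ) < 1 / 2 by norm_num)),
    eventually_ge_atTop 1] with k hk hk1
  have hf : (0 : ℝ) < k.factorial := by positivity
  rw [div_lt_iff₀ hf] at hk
  obtain ⟨l, rfl⟩ := Nat.exists_eq_succ_of_ne_zero (by omega : k ≠ 0)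
  have h3 := le_sumNorm_loopQ h l
  have h4 := factorial_le_scaleS hn (l + 1)
  have h5 : Real.exp (1 / c) ^ (l + 1) ≤ sumNorm (loopQ n₀ (l + 1)) := by
    refine hk.le.trans ?_
    simp only [Nat.succ_eq_add_one]
    linarith
  rw [← Real.exp_nat_mul] at h5
  have h6 := Real.log_le_log (Real.exp_pos _) h5
  rw [Real.log_exp, mul_one_div, div_le_iff₀ hc] at h6
  rw [Real.norm_of_nonneg (by positivity), mul_comm]
  exact h6.trans (mul_le_mul_of_nonneg_right (le_abs_self _) hc.le)

lemma loopZ_isLittleO_log {n₀ : ℕ} (h : 46 ≤ n₀) :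
    (fun k : ℕ => sumNorm (loopZ n₀ k)) =o[atTop]
      fun k : ℕ => Real.log (sumNorm (loopQ n₀ k)) ^ 12 :=
  (sumNorm_loopZ_isTheta (by omega)).1.trans_isLittleO
    ((natCast_isLittleO_log h).pow (by norm_num))

lemma one_le_sumNorm_loopQ {n₀ : ℕ} (h : 46 ≤ n₀) (k : ℕ) : 1 / 2 ≤ sumNorm (loopQ n₀ k) := by
  have hn : n₀ ≠ 0 := by omega
  rcases k with _ | k
  · simp [loopQ, sumNorm, Fin.sum_univ_four, Matrix.one_apply]
    norm_num
  · have h1 := le_sumNorm_loopQ h k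
    have h2 := factorial_le_scaleS hn (k + 1)
    have h3 : (1 : ℝ) ≤ (k + 1).factorial := by exact_mod_cast Nat.factorial_pos _
    linarith

/-- A power of the logarithm is negligible against any power; the finitely many remaining `k` are
absorbed in the constant because the right-hand side never vanishes. -/
lemma exists_loopZ_le {n₀ : ℕ} (h : 46 ≤ n₀) {ε : ℝ} (hε : 0 < ε) : ∃ C : ℝ, 0 < C ∧
    ∀ k, sumNorm (loopZ n₀ k) ≤ C * sumNorm (loopQ n₀ k) ^ ε := by
  have h1 : (fun k : ℕ => sumNorm (loopZ n₀ k)) =O[atTop]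
      fun k => sumNorm (loopQ n₀ k) ^ ε := by
    refine ((loopZ_isLittleO_log h).trans ?_).isBigO
    have h2 := isLittleO_log_rpow_rpow_atTop 12 hε
    have h3 := h2.comp_tendsto (tendsto_sumNorm_loopQ h)
    refine h3.congr_left fun k => ?_
    simp only [Function.comp]
    exact_mod_cast Real.rpow_natCast _ 12
  have hpos : ∀ k, 0 < sumNorm (loopQ n₀ k) ^ ε := fun k =>
    Real.rpow_pos_of_pos (by linarith [one_le_sumNorm_loopQ h k]) ε
  rw [← Nat.cofinite_eq_atTop] at h1
  obtain ⟨C, hC, hb⟩ := bound_of_isBigO_cofinite h1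
  refine ⟨C, hC, fun k => ?_⟩
  have := hb (hpos k).ne'
  rwa [Real.norm_of_nonneg (sumNorm_nonneg _), Real.norm_of_nonneg (hpos k).le] at this

/-! ### Limit directions -/

/-- The limit of the normalized columns `A` (for `s = 0`) or `D` (for `s = 1`). -/
def limDir (n₀ s : ℕ) : Fin 4 → ℝ := unitVec (limCol n₀ s)

lemma half_le_sum_limCol {n₀ : ℕ} (h : 46 ≤ n₀) (s : ℕ) : 1 / 2 ≤ ∑ i, |limCol n₀ s i| := by
  have h0 : (46 : ℝ) ≤ n₀ := by exact_mod_cast h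
  have h1 : ∃ i, dirCol s i = 1 := by
    unfold dirCol
    split_ifs
    · exact ⟨0, rfl⟩
    · exact ⟨2, rfl⟩
  obtain ⟨i, hi⟩ := h1
  have h2 := limCol_sub (by omega : 23 ≤ n₀) s i
  have h3 : (23 : ℝ) / n₀ ≤ 1 / 2 := by
    rw [div_le_div_iff₀ (by linarith) (by norm_num)]
    linarith
  rw [hi] at h2
  have h4 := Finset.single_le_sum (f := fun i => |limCol n₀ s i|) (fun i _ => abs_nonneg _)
    (Finset.mem_univ i)
  refine le_trans ?_ h4
  exact le_trans (by linarith [(abs_le.1 h2).1]) (le_abs_self _)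

lemma sum_limCol_ne {n₀ : ℕ} (h : 46 ≤ n₀) (s : ℕ) : ∑ i, |limCol n₀ s i| ≠ 0 := by
  linarith [half_le_sum_limCol h s]

lemma limCol_nonneg {n₀ : ℕ} (h : 46 ≤ n₀) (s : ℕ) (i : Fin 4) : 0 ≤ limCol n₀ s i := by
  have h1 := tendsto_pi_nhds.1 (tendsto_mainCol (by omega : 23 ≤ n₀) s) i
  exact ge_of_tendsto' h1 fun k =>
    div_nonneg (loopQ_nonneg _ _ _ _) (scale_pos (by omega) k _).le

lemma sum_abs_limDir {n₀ : ℕ} (h : 46 ≤ n₀) (s : ℕ) : ∑ i, |limDir n₀ s i| = 1 :=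
  sum_abs_unitVec (sum_limCol_ne h s)

lemma limDir_nonneg {n₀ : ℕ} (h : 46 ≤ n₀) (s : ℕ) (i : Fin 4) : 0 ≤ limDir n₀ s i :=
  div_nonneg (limCol_nonneg h s i) (Finset.sum_nonneg fun _ _ => abs_nonneg _)

lemma sum_limDir {n₀ : ℕ} (h : 46 ≤ n₀) (s : ℕ) : ∑ i, limDir n₀ s i = 1 := by
  rw [← sum_abs_limDir h s]
  exact Finset.sum_congr rfl fun i _ => (abs_of_nonneg (limDir_nonneg h s i)).symm

lemma unitVec_sub_le {y z : Fin 4 → ℝ} {e : ℝ} (hyz : ∀ i, |y i - z i| ≤ e)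
    (hy : 1 / 2 ≤ ∑ i, |y i|) (hz : 1 ≤ ∑ i, |z i|) (hz1 : ∀ i, |z i| ≤ 1) (i : Fin 4) :
    |unitVec y i - unitVec z i| ≤ 10 * e := by
  have hS : |(∑ i, |z i|) - (∑ i, |y i|)| ≤ 4 * e := by
    rw [← Finset.sum_sub_distrib]
    refine (Finset.abs_sum_le_sum_abs _ _).trans ?_
    refine (Finset.sum_le_card_nsmul _ _ e fun i _ => ?_).trans (by simp)
    exact (abs_abs_sub_abs_le_abs_sub _ _).trans (by rw [abs_sub_comm]; exact hyz i)
  have he : 0 ≤ e := (abs_nonneg _).trans (hyz i)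
  simp only [unitVec]
  set S := ∑ i, |y i|
  set R := ∑ i, |z i|
  have e1 : y i / S - z i / R = (y i - z i) / S + z i * ((R - S) / (S * R)) := by
    field_simp
    ring
  rw [e1]
  refine (abs_add_le _ _).trans ?_
  have h1 : |(y i - z i) / S| ≤ 2 * e := by
    rw [abs_div, abs_of_pos (by linarith : 0 < S), div_le_iff₀ (by linarith)]
    nlinarith [hyz i]
  have h2 : |z i * ((R - S) / (S * R))| ≤ 8 * e := by
    have hSR : 1 / 2 ≤ S * R := by nlinarith
    rw [abs_mul]
    refine (mul_le_of_le_one_left (abs_nonneg _) (hz1 i)).trans ?_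
    rw [abs_div, abs_of_pos (by linarith : 0 < S * R), div_le_iff₀ (by linarith)]
    nlinarith
  linarith

lemma limDir_sub {n₀ : ℕ} (h : 46 ≤ n₀) (s : ℕ) (i : Fin 4) :
    |limDir n₀ s i - unitVec (dirCol s) i| ≤ 230 / n₀ := by
  have h1 := unitVec_sub_le (fun i => limCol_sub (by omega : 23 ≤ n₀) s i)
    (half_le_sum_limCol h s) (z := dirCol s)
    (by unfold dirCol; split_ifs <;> simp [Fin.sum_univ_four])
    (fun i => by unfold dirCol; split_ifs <;> fin_cases i <;> simp) i
  refine h1.trans (le_of_eq ?_)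
  ring

lemma unitVec_dirCol_zero : unitVec (dirCol 0) = ![1 / 2, 0, 0, 1 / 2] := by
  ext i
  fin_cases i <;> simp [unitVec, dirCol, Fin.sum_univ_four] <;> norm_num

lemma unitVec_dirCol_one : unitVec (dirCol 1) = ![0, 0, 1, 0] := by
  ext i
  fin_cases i <;> simp [unitVec, dirCol, Fin.sum_univ_four]

lemma limDir_ne {n₀ : ℕ} (h : 1000 ≤ n₀) : limDir n₀ 0 ≠ limDir n₀ 1 := by
  intro heq
  have h0 : (1000 : ℝ) ≤ n₀ := by exact_mod_cast h
  have h1 := limDir_sub (by omega : 46 ≤ n₀) 0 2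
  have h2 := limDir_sub (by omega : 46 ≤ n₀) 1 2
  rw [heq, unitVec_dirCol_zero] at h1
  rw [unitVec_dirCol_one] at h2
  -- This places the third coordinate of one limit below `1/4` and that of the other above `3/4`.
  have h3 : (230 : ℝ) / n₀ ≤ 1 / 4 := by
    rw [div_le_div_iff₀ (by linarith) (by norm_num)]
    linarith
  simp only [vec_four_apply] at h1 h2
  have h4 := (abs_le.1 h1).2
  have h5 := (abs_le.1 h2).1
  linarith

lemma tendsto_normCol_main {n₀ : ℕ} (h : 46 ≤ n₀) (s : ℕ) :
    Tendsto (fun l => normCol n₀ l (if Even s then lA else lD)) atTop (𝓝 (limDir n₀ s)) := by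
  rw [← tendsto_add_atTop_iff_nat 1]
  refine (tendsto_unitVec (tendsto_mainCol (by omega) s) (sum_limCol_ne h s)).congr fun l => ?_
  rw [mainCol, ← normCol_altCol (by omega)]
  congr 1
  by_cases hs : Even s <;> by_cases hl : Even l <;> simp [hs, hl, Nat.even_add, Fin.rev]

lemma tendsto_normCol_even {n₀ : ℕ} (h : 46 ≤ n₀) {j : Fin 4} (hj : j ≠ 3) :
    Tendsto (fun l => normCol n₀ (2 * l) j) atTop (𝓝 (limDir n₀ 0)) := by
  rw [← tendsto_add_atTop_iff_nat 1]
  have h1 := tendsto_nrm_succ (by omega : 23 ≤ n₀) hj (s := 0) (φ := fun l => 2 * l)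
    (tendsto_id.const_mul_atTop' two_pos) (fun l => by simp)
  refine (tendsto_unitVec h1 (sum_limCol_ne h 0)).congr fun l => ?_
  rw [mul_add, mul_one, normCol_even (by omega)]

lemma tendsto_normCol_odd {n₀ : ℕ} (h : 46 ≤ n₀) {j : Fin 4} (hj : j ≠ 0) :
    Tendsto (fun l => normCol n₀ (2 * l + 1) j) atTop (𝓝 (limDir n₀ 1)) := by
  rw [← tendsto_add_atTop_iff_nat 1]
  have hφ : Tendsto (fun l : ℕ => 2 * l + 1) atTop atTop :=
    tendsto_atTop_mono (fun l => by omega : ∀ l : ℕ, l ≤ 2 * l + 1) tendsto_id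
  have hj' : Fin.rev j ≠ 3 := fun h3 => hj (by rw [← Fin.rev_rev j, h3]; rfl)
  have he : ∀ l : ℕ, Even (1 + (2 * l + 1)) := fun l => ⟨l + 1, by ring⟩
  have h1 := tendsto_nrm_succ (by omega : 23 ≤ n₀) hj' (s := 1) (φ := fun l => 2 * l + 1) hφ he
  refine (tendsto_unitVec h1 (sum_limCol_ne h 1)).congr fun l => ?_
  have h2 := normCol_odd (by omega : n₀ ≠ 0) (l + 1) (Fin.rev j)
  rw [Fin.rev_rev] at h2
  rw [h2]
  rfl

/-! ### The cone of length vectors -/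

/-- Each `V` is a transvection, since winner and loser are distinct throughout the Rauzy class. -/
lemma det_of_rauzyPath {π π' : Comb (Fin 4) 4} {w : List (Fin 4)} {M : Matrix (Fin 4) (Fin 4) ℝ}
    (h : RauzyPath π w π' M) (hπ : π ∈ rauzyClass) : M.det = 1 := by
  induction h with
  | nil => simp
  | cons π π' ε w M h ih =>
    rw [Matrix.det_mul, ih (rauzy_mem_rauzyClass hπ ε), mul_one, Comb.V]
    exact Matrix.det_transvection_of_ne _ _ (lastLetter_ne hπ ε) 1

lemma isUnit_det_loopQ (n₀ k : ℕ) : IsUnit (loopQ n₀ k).det := by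
  rw [det_of_rauzyPath (rauzyPath_gamma n₀ k) abcd_mem]
  exact isUnit_one

lemma inv_loopQ_mul_nonneg (n₀ : ℕ) {k l : ℕ} (hkl : k ≤ l) (i j : Fin 4) :
    0 ≤ ((loopQ n₀ k)⁻¹ * loopQ n₀ l) i j := by
  induction l, hkl using Nat.le_induction generalizing j with
  | base =>
    rw [Matrix.nonsing_inv_mul _ (isUnit_det_loopQ n₀ k), Matrix.one_apply]
    split_ifs <;> norm_num
  | succ l _ ih =>
    rw [loopQ_succ, ← Matrix.mul_assoc, Matrix.mul_apply]
    exact Finset.sum_nonneg fun m _ => mul_nonneg (ih m) (loopZ_nonneg _ _ _ _)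

/-- For `l ≥ k`, the columns of `Q(k)⁻¹ Q(l)` are those of a product of nonnegative matrices `Z`;
nonnegativity passes to the limit of the normalized columns. -/
lemma inv_loopQ_mulVec_limDir_nonneg {n₀ : ℕ} (h : 46 ≤ n₀) (s k : ℕ) (i : Fin 4) :
    0 ≤ (loopQ n₀ k)⁻¹.mulVec (limDir n₀ s) i := by
  have hc : Continuous fun y : Fin 4 → ℝ => (loopQ n₀ k)⁻¹.mulVec y i := by
    simp only [Matrix.mulVec, dotProduct]
    fun_prop
  refine ge_of_tendsto ((hc.tendsto _).comp (tendsto_normCol_main h s)) ?_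
  filter_upwards [eventually_ge_atTop k] with l hl
  have h1 := inv_loopQ_mul_nonneg n₀ hl i (if Even s then lA else lD)
  rw [Matrix.mul_apply] at h1
  simp only [Function.comp, Matrix.mulVec, dotProduct, normCol, ← mul_div_assoc, ← Finset.sum_div]
  exact div_nonneg h1 (Finset.sum_nonneg fun _ _ => abs_nonneg _)

/-- A single loop leaves zero entries, but two consecutive loops fill the whole matrix; this
upgrades nonnegative lengths to positive ones. -/
lemma loopZ_mul_pos {n₀ : ℕ} (h : n₀ ≠ 0) (k : ℕ) (i j : Fin 4) :
    0 < (loopZ n₀ k * loopZ n₀ (k + 1)) i j := by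
  have hn : 0 < nPar n₀ (k + 1) := Nat.pos_of_ne_zero (nPar_ne_zero h (k + 1))
  have hn' : 0 < nPar n₀ k := Nat.pos_of_ne_zero (nPar_ne_zero h k)
  have hp : ∀ l, 0 < pPar n₀ l := fun l => by
    have := Nat.pos_of_ne_zero h
    rw [pPar]; positivity
  have hp' := hp k
  have hp'' := hp (k + 1)
  rw [Matrix.mul_apply, Fin.sum_univ_four]
  unfold loopZ
  by_cases hk : Even k
  · rw [if_pos hk, if_neg (by simpa [Nat.even_add_one] using hk)]
    fin_cases i <;> fin_cases j <;> simp [Z0, Z1] <;> positivity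
  · rw [if_neg hk, if_pos (by simpa [Nat.even_add_one] using hk)]
    fin_cases i <;> fin_cases j <;> simp [Z0, Z1] <;> positivity

/-- The successive length vectors of the points of the segment. -/
def lens (n₀ : ℕ) (u : Fin 4 → ℝ) (k : ℕ) : Fin 4 → ℝ := (loopQ n₀ k)⁻¹.mulVec u

lemma sum_of_mem_segment {n₀ : ℕ} (h : 46 ≤ n₀) {u : Fin 4 → ℝ}
    (hu : u ∈ segment ℝ (limDir n₀ 0) (limDir n₀ 1)) : ∑ i, u i = 1 := by
  obtain ⟨a, b, -, -, hab, rfl⟩ := hu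
  simp only [Pi.add_apply, Pi.smul_apply, smul_eq_mul, Finset.sum_add_distrib, ← Finset.mul_sum,
    sum_limDir h]
  linarith

lemma gammaLengths_of_mem_segment {n₀ : ℕ} (h : 46 ≤ n₀) {u : Fin 4 → ℝ}
    (hu : u ∈ segment ℝ (limDir n₀ 0) (limDir n₀ 1)) : GammaLengths n₀ u (lens n₀ u) := by
  have hsum := sum_of_mem_segment h hu
  have hnn : ∀ k i, 0 ≤ lens n₀ u k i := by
    obtain ⟨a, b, ha, hb, -, rfl⟩ := hu
    intro k i
    rw [lens, Matrix.mulVec_add, Matrix.mulVec_smul, Matrix.mulVec_smul]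
    exact add_nonneg (mul_nonneg ha (inv_loopQ_mulVec_limDir_nonneg h 0 k i))
      (mul_nonneg hb (inv_loopQ_mulVec_limDir_nonneg h 1 k i))
  have heq : ∀ k, u = (loopQ n₀ k).mulVec (lens n₀ u k) := fun k => by
    rw [lens, Matrix.mulVec_mulVec, Matrix.mul_nonsing_inv _ (isUnit_det_loopQ n₀ k),
      Matrix.one_mulVec]
  have hsucc : ∀ k, lens n₀ u k = (loopZ n₀ k).mulVec (lens n₀ u (k + 1)) := fun k => by
    conv_lhs => rw [lens, heq (k + 1), loopQ_succ, Matrix.mulVec_mulVec, ← Matrix.mul_assoc,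
      Matrix.nonsing_inv_mul _ (isUnit_det_loopQ n₀ k), Matrix.one_mul]
  refine ⟨fun k i => ?_, heq, hsucc⟩
  rw [hsucc, hsucc, Matrix.mulVec_mulVec]
  have hne : ∃ j, lens n₀ u (k + 1 + 1) j ≠ 0 := by
    by_contra! h0
    have h1 := heq (k + 1 + 1)
    rw [show lens n₀ u (k + 1 + 1) = 0 from funext h0, Matrix.mulVec_zero] at h1
    rw [h1] at hsum
    simp at hsum
  obtain ⟨j, hj⟩ := hne
  refine Finset.sum_pos' (fun j _ => mul_nonneg (loopZ_mul_pos (by omega) k i j).le (hnn _ j))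
    ⟨j, Finset.mem_univ j, mul_pos (loopZ_mul_pos (by omega) k i j) ?_⟩
  exact lt_of_le_of_ne (hnn _ j) hj.symm

lemma half_scaleS_le_sum_loopQ {n₀ : ℕ} (h : 46 ≤ n₀) (k : ℕ) (j : Fin 4) :
    scaleS n₀ k / 2 ≤ ∑ i, loopQ n₀ (k + 1) i j := by
  have h1 := half_scale_le_sum h k (if Even (k + 1) then j else Fin.rev j)
  have h2 := (scale_le (by omega : n₀ ≠ 0) k (if Even (k + 1) then j else Fin.rev j)).1
  have h3 : (if Even (k + 1) then (if Even (k + 1) then j else Fin.rev j) else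
      Fin.rev (if Even (k + 1) then j else Fin.rev j)) = j := by
    split_ifs
    · rfl
    · exact Fin.rev_rev j
  simp only [altCol, h3] at h1
  linarith

/-- The total of `u` is the sum of the `x (k+1) j` weighted by the column sums of `Q(k+1)`, all at
least half of `scaleS n₀ k`, which tends to infinity. -/
lemma GammaLengths.tendsto_sum {n₀ : ℕ} (h : 46 ≤ n₀) {u : Fin 4 → ℝ} {x : ℕ → Fin 4 → ℝ}
    (hx : GammaLengths n₀ u x) : Tendsto (fun k => ∑ i, x k i) atTop (𝓝 0) := by
  rw [← tendsto_add_atTop_iff_nat 1]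
  have h1 : Tendsto (fun k => (∑ i, u i) * 2 / scaleS n₀ k) atTop (𝓝 0) :=
    tendsto_const_nhds.div_atTop (tendsto_scaleS (by omega))
  refine squeeze_zero (fun k => Finset.sum_nonneg fun i _ => (hx.pos _ i).le) (fun k => ?_) h1
  rw [le_div_iff₀ (scaleS_pos n₀ k (by omega))]
  have h2 : ∑ i, u i = ∑ j, (∑ i, loopQ n₀ (k + 1) i j) * x (k + 1) j := by
    conv_lhs => rw [hx.eq (k + 1)]
    simp only [Matrix.mulVec, dotProduct, Finset.sum_mul]
    exact Finset.sum_comm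
  have h3 : ∑ j, scaleS n₀ k / 2 * x (k + 1) j ≤ ∑ i, u i := by
    rw [h2]
    exact Finset.sum_le_sum fun j _ =>
      mul_le_mul_of_nonneg_right (half_scaleS_le_sum_loopQ h k j) (hx.pos _ j).le
  rw [← Finset.mul_sum] at h3
  linarith

lemma isClosed_segment_real {E : Type*} [AddCommGroup E] [Module ℝ E] [TopologicalSpace E]
    [T2Space E] [ContinuousAdd E] [ContinuousSMul ℝ E] (x y : E) : IsClosed (segment ℝ x y) := by
  rw [segment_eq_image]
  exact (isCompact_Icc.image (by fun_prop)).isClosed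

lemma mem_segment_of_startsWith {n₀ : ℕ} (h : 46 ≤ n₀) {u : Fin 4 → ℝ} (hu : ∀ i, 0 < u i)
    (hsum : ∑ i, u i = 1) (hw : ∀ k, (Data.mk abcd u).StartsWith (gammaWord n₀ k)) :
    u ∈ segment ℝ (limDir n₀ 0) (limDir n₀ 1) := by
  have h1 : ∀ k, ∃ y : Fin 4 → ℝ, (∀ i, 0 ≤ y i) ∧ u = (loopQ n₀ k).mulVec y := fun k =>
    Data.exists_of_startsWith (rauzyPath_gamma n₀ k) abcd_mem (fun i => (hu i).le) (hw k)
  choose y hy huy using h1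
  let S : ℕ → Fin 4 → ℝ := fun k j => ∑ i, |loopQ n₀ k i j|
  have hS : ∀ k j, S (k + 1) j ≠ 0 := fun k j => by
    have h2 := half_scaleS_le_sum_loopQ h k j
    have h3 := scaleS_pos n₀ k (by omega : n₀ ≠ 0)
    simp only [S, abs_of_nonneg (loopQ_nonneg n₀ _ _ _)]
    linarith
  -- Weights expressing `u` as a convex combination of the normalized columns.
  let t : ℕ → Fin 4 → ℝ := fun k j => y k j * S k j
  have ht : ∀ k j, 0 ≤ t k j := fun k j =>
    mul_nonneg (hy k j) (Finset.sum_nonneg fun _ _ => abs_nonneg _)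
  have htsum : ∀ k, ∑ j, t k j = 1 := fun k => by
    rw [← hsum]
    conv_rhs => rw [huy k]
    simp only [t, S, abs_of_nonneg (loopQ_nonneg n₀ _ _ _), Matrix.mulVec, dotProduct,
      Finset.mul_sum]
    rw [Finset.sum_comm]
    exact Finset.sum_congr rfl fun i _ => Finset.sum_congr rfl fun j _ => mul_comm _ _
  have ht1 : ∀ k j, t k j ≤ 1 := fun k j => by
    rw [← htsum k]
    exact Finset.single_le_sum (fun j _ => ht k j) (Finset.mem_univ j)
  have hut : ∀ k i, u i = ∑ j, t (k + 1) j * normCol n₀ (k + 1) j i := fun k i => by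
    conv_lhs => rw [huy (k + 1)]
    simp only [Matrix.mulVec, dotProduct]
    refine Finset.sum_congr rfl fun j _ => ?_
    have := hS k j
    simp only [t, normCol]
    change _ = y (k + 1) j * S (k + 1) j * (_ / S (k + 1) j)
    field_simp
  let lim : Fin 4 → Fin 4 → ℝ := fun j => if j = 3 then limDir n₀ 1 else limDir n₀ 0
  have hlim : ∀ j i, Tendsto (fun l => |normCol n₀ (2 * (l + 1)) j i - lim j i|) atTop (𝓝 0) := by
    intro j i
    have h2 : Tendsto (fun l => normCol n₀ (2 * (l + 1)) j) atTop (𝓝 (lim j)) := by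
      by_cases hj : j = 3
      · subst hj
        exact (tendsto_normCol_main h 1).comp
          ((tendsto_add_atTop_nat 1).const_mul_atTop' two_pos)
      · simp only [lim, if_neg hj]
        exact (tendsto_normCol_even h hj).comp (tendsto_add_atTop_nat 1)
    have h3 := ((tendsto_pi_nhds.1 h2 i).sub_const (lim j i)).abs
    simpa using h3
  -- Along even indices the columns `A, B, C` tend to one endpoint and `D` to the other. Replacing
  -- each column by its limit gives points of the segment converging to `u`; the weights themselves
  -- need not converge.
  refine (isClosed_segment_real _ _).mem_of_tendsto (f := fun l i =>
    ∑ j, t (2 * (l + 1)) j * lim j i) (b := atTop) ?_ (Eventually.of_forall fun l => ?_)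
  · rw [tendsto_pi_nhds]
    intro i
    have h2 : Tendsto (fun l => ∑ j, |normCol n₀ (2 * (l + 1)) j i - lim j i|) atTop (𝓝 0) := by
      simpa using tendsto_finsetSum Finset.univ fun j _ => hlim j i
    refine tendsto_iff_dist_tendsto_zero.2 (squeeze_zero (fun _ => dist_nonneg) (fun l => ?_) h2)
    rw [dist_comm, Real.dist_eq, hut (2 * l + 1) i, ← Finset.sum_sub_distrib]
    refine (Finset.abs_sum_le_sum_abs _ _).trans (Finset.sum_le_sum fun j _ => ?_)
    change |t (2 * (l + 1)) j * normCol n₀ (2 * (l + 1)) j i - _| ≤ _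
    rw [← mul_sub, abs_mul, abs_of_nonneg (ht _ j)]
    exact mul_le_of_le_one_left (abs_nonneg _) (ht1 _ j)
  · have h2 := htsum (2 * (l + 1))
    rw [Fin.sum_univ_four] at h2
    refine ⟨t (2 * (l + 1)) 0 + t (2 * (l + 1)) 1 + t (2 * (l + 1)) 2, t (2 * (l + 1)) 3,
      add_nonneg (add_nonneg (ht _ _) (ht _ _)) (ht _ _), ht _ _, h2, ?_⟩
    funext i
    simp only [Fin.sum_univ_four, lim, Pi.add_apply, Pi.smul_apply, smul_eq_mul]
    simp
    ring

/-! ### Condition (b) -/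

/-- The difference `w` of the limit directions, minus the constant that makes it orthogonal to `u`.
If it vanished on both limits it would vanish on `w`, whose coordinates sum to zero, giving `⟨w, w⟩
= 0`. -/
lemma exists_test_vector {n₀ : ℕ} (h : 1000 ≤ n₀) {u : Fin 4 → ℝ} (hu : ∑ i, u i = 1) :
    ∃ φ : Fin 4 → ℝ, ∑ i, u i * φ i = 0 ∧ ∃ s, ∑ i, limCol n₀ s i * φ i ≠ 0 := by
  have h' : 46 ≤ n₀ := by omega
  let w : Fin 4 → ℝ := fun i => limDir n₀ 0 i - limDir n₀ 1 i
  let c : ℝ := ∑ i, u i * w i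
  refine ⟨fun i => w i - c, ?_, ?_⟩
  · simp only [mul_sub, Finset.sum_sub_distrib, ← Finset.sum_mul, hu]
    simp [c]
  · by_contra! h0
    have h1 : ∀ s, ∑ i, limDir n₀ s i * (w i - c) = 0 := fun s => by
      simp only [limDir, unitVec, div_mul_eq_mul_div, ← Finset.sum_div, h0, zero_div]
    have h2 : ∑ i, w i = 0 := by
      simp only [w, Finset.sum_sub_distrib, sum_limDir h', sub_self]
    have h3 : ∑ i, w i * w i = 0 := by
      have h4 : ∑ i, w i * (w i - c) = 0 := by
        have : ∀ i, w i * (w i - c) = limDir n₀ 0 i * (w i - c) - limDir n₀ 1 i * (w i - c) :=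
          fun i => by simp only [w]; ring
        simp only [this, Finset.sum_sub_distrib, h1, sub_self]
      simpa only [mul_sub, Finset.sum_sub_distrib, ← Finset.sum_mul, h2, zero_mul, sub_zero]
        using h4
    rw [Finset.sum_eq_zero_iff_of_nonneg fun i _ => mul_self_nonneg _] at h3
    apply limDir_ne h
    funext i
    exact sub_eq_zero.1 (mul_self_eq_zero.1 (h3 i (Finset.mem_univ i)))

lemma not_loop_bound {n₀ : ℕ} (h : 1000 ≤ n₀) {u : Fin 4 → ℝ} (hu : ∑ i, u i = 1)
    {θ C : ℝ} (hθ : 0 < θ) (hb : ∀ (k : ℕ) (φ : Fin 4 → ℝ), ∑ i, u i * φ i = 0 →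
      ‖Matrix.mulVec (loopQ n₀ k).transpose φ‖ ≤ C * sumNorm (loopQ n₀ k) ^ (1 - θ) * ‖φ‖) :
    False := by
  have h' : 46 ≤ n₀ := by omega
  obtain ⟨φ, hφ, s, hs⟩ := exists_test_vector h hu
  set δ := ∑ i, limCol n₀ s i * φ i with hδ
  have h1 : Tendsto (fun k => |∑ i, mainCol n₀ s k i * φ i|) atTop (𝓝 |δ|) :=
    (tendsto_finsetSum _ fun i _ =>
      (tendsto_pi_nhds.1 (tendsto_mainCol (by omega : 23 ≤ n₀) s) i).mul_const (φ i)).abs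
  have hδ' : |δ| / 2 < |δ| := by
    have := abs_pos.2 hs
    linarith
  have h2 : Tendsto (fun k => sumNorm (loopQ n₀ (k + 1)) ^ θ) atTop atTop :=
    (tendsto_rpow_atTop hθ).comp ((tendsto_add_atTop_iff_nat 1).2 (tendsto_sumNorm_loopQ h'))
  obtain ⟨N, hN⟩ := eventually_atTop.1 ((h1.eventually (lt_mem_nhds hδ')).and
    (h2.eventually (eventually_gt_atTop (C * ‖φ‖ * 64 / |δ|))))
  -- The index makes `s + k` odd, so the main column sits in position `0`, where its size is
  -- comparable to `‖Q(k+1)‖`; for the other parity it is of the smaller size `scaleS n₀ k`.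
  obtain ⟨hN1, hN2⟩ := hN (2 * N + 1 + s) (by omega)
  set k := 2 * N + 1 + s with hk
  have hodd : ¬ Even (s + k) := by
    rw [hk, Nat.not_even_iff_odd]
    exact ⟨N + s, by ring⟩
  have hQ := one_le_sumNorm_loopQ h' (k + 1)
  have hS := scaleS_pos n₀ (k + 1) (by omega : n₀ ≠ 0)
  have h3 : |∑ i, altCol n₀ (k + 1) 0 i * φ i| ≤
      ‖Matrix.mulVec (loopQ n₀ (k + 1)).transpose φ‖ := by
    refine le_trans (le_of_eq ?_) (norm_le_pi_norm _ (if Even (k + 1) then 0 else Fin.rev 0))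
    rw [Real.norm_eq_abs]
    rfl
  have h4 : |∑ i, altCol n₀ (k + 1) 0 i * φ i| =
      scaleS n₀ (k + 1) * |∑ i, mainCol n₀ s k i * φ i| := by
    simp only [mainCol, if_neg hodd, altCol_eq (by omega : n₀ ≠ 0), mul_assoc, ← Finset.mul_sum]
    rw [abs_mul, abs_of_pos (scale_pos (by omega) k 0)]
    rfl
  have h5 := hb (k + 1) φ hφ
  have h6 := sumNorm_loopQ_le (by omega : 23 ≤ n₀) k
  set Q := sumNorm (loopQ n₀ (k + 1)) with hQdef
  have h7 : Q ^ (1 - θ) * Q ^ θ = Q := by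
    rw [← Real.rpow_add (by linarith), sub_add_cancel, Real.rpow_one]
  have h8 : 0 < Q ^ (1 - θ) := Real.rpow_pos_of_pos (by linarith) _
  rw [div_lt_iff₀ (abs_pos.2 hs)] at hN2
  -- The factor `64` combines `‖Q‖ ≤ 32 · scaleS` with the loss of `1/2` in the convergence to
  -- `|δ|`.
  have h9 : Q * |δ| ≤ Q ^ (1 - θ) * (C * ‖φ‖ * 64) := by
    have h10 : scaleS n₀ (k + 1) * (|δ| / 2) ≤ C * Q ^ (1 - θ) * ‖φ‖ := by
      refine le_trans ?_ (h3.trans h5)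
      rw [h4]
      exact mul_le_mul_of_nonneg_left hN1.le hS.le
    have h11 : Q * |δ| ≤ 32 * scaleS n₀ (k + 1) * |δ| :=
      mul_le_mul_of_nonneg_right h6 (abs_nonneg δ)
    linarith
  have h12 := mul_lt_mul_of_pos_left hN2 h8
  rw [← mul_assoc (Q ^ (1 - θ)) (Q ^ θ), h7] at h12
  linarith

/-! ### Conjugacy and failure of unique ergodicity on the segment. -/

lemma topConj_of_mem_segment {n₀ : ℕ} (h : 46 ≤ n₀) {u v : Fin 4 → ℝ}
    (hu : u ∈ segment ℝ (limDir n₀ 0) (limDir n₀ 1))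
    (hv : v ∈ segment ℝ (limDir n₀ 0) (limDir n₀ 1)) :
    (Data.mk abcd u).TopConj (Data.mk abcd v) := by
  have hU := gammaLengths_of_mem_segment h hu
  have hV := gammaLengths_of_mem_segment h hv
  exact (hU.parallel hV).topConj (hU.tendsto_total (hU.tendsto_sum h))
    (hV.tendsto_total (hV.tendsto_sum h))

lemma not_uniquelyErgodic_of_mem_segment {n₀ : ℕ} (h : 1000 ≤ n₀) {u : Fin 4 → ℝ}
    (hu : u ∈ segment ℝ (limDir n₀ 0) (limDir n₀ 1)) : ¬ (Data.mk abcd u).UniquelyErgodic := by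
  have h' : 46 ≤ n₀ := by omega
  have hne : ∃ v ∈ segment ℝ (limDir n₀ 0) (limDir n₀ 1), u ≠ v := by
    by_cases h0 : u = limDir n₀ 0
    · exact ⟨_, right_mem_segment ℝ _ _, h0 ▸ limDir_ne h⟩
    · exact ⟨_, left_mem_segment ℝ _ _, h0⟩
  obtain ⟨v, hv, huv⟩ := hne
  have hU := gammaLengths_of_mem_segment h' hu
  have hV := gammaLengths_of_mem_segment h' hv
  exact (hU.parallel hV).not_uniquelyErgodic (hU.tendsto_total (hU.tendsto_sum h'))
    (hV.tendsto_total (hV.tendsto_sum h')) (sum_of_mem_segment h' hu) (sum_of_mem_segment h' hv) huv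

end IEM

theorem mainTheorem10 :
    (∀ m n p : ℕ,
      IEM.RauzyPath IEM.abcd (IEM.word0 m n p) IEM.abcd (IEM.Z0 m n p) ∧
      IEM.RauzyPath IEM.abcd (IEM.word1 m n p) IEM.abcd (IEM.Z1 m n p)) ∧
    ∃ (N : ℕ) (K : ℝ), 0 < K ∧ ∀ n₀ : ℕ, N ≤ n₀ →
      -- size and direction of the columns of `Q(k)`
      (∀ l : ℕ, 1 ≤ l →
        IEM.ColApprox K n₀ (2 * l - 1) IEM.lA (IEM.cScale n₀ (6 * l - 8)) ![1, 0, 0, 1] ∧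
        IEM.ColApprox K n₀ (2 * l - 1) IEM.lB (IEM.cScale n₀ (6 * l - 7)) ![0, 0, 1, 0] ∧
        IEM.ColApprox K n₀ (2 * l - 1) IEM.lC (IEM.cScale n₀ (6 * l - 5)) ![0, 0, 1, 0] ∧
        IEM.ColApprox K n₀ (2 * l - 1) IEM.lD (IEM.cScale n₀ (6 * l - 5)) ![0, 0, 1, 0] ∧
        IEM.ColApprox K n₀ (2 * l) IEM.lD (IEM.cScale n₀ (6 * l - 5)) ![0, 0, 1, 0] ∧
        IEM.ColApprox K n₀ (2 * l) IEM.lC (IEM.cScale n₀ (6 * l - 4)) ![1, 0, 0, 1] ∧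
        IEM.ColApprox K n₀ (2 * l) IEM.lB (IEM.cScale n₀ (6 * l - 2)) ![1, 0, 0, 1] ∧
        IEM.ColApprox K n₀ (2 * l) IEM.lA (IEM.cScale n₀ (6 * l - 2)) ![1, 0, 0, 1]) ∧
      -- growth of the matrices
      ((fun k : ℕ => IEM.sumNorm (IEM.loopZ n₀ k)) =Θ[atTop]
        fun k : ℕ => ((n₀ : ℝ) + 3 * k) ^ 12) ∧
      ((fun k : ℕ => IEM.sumNorm (IEM.loopQ n₀ k)) =Θ[atTop]
        fun k : ℕ => IEM.cScale n₀ (3 * k - 2)) ∧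
      ((fun k : ℕ => IEM.sumNorm (IEM.loopZ n₀ k)) =o[atTop]
        fun k : ℕ => Real.log (IEM.sumNorm (IEM.loopQ n₀ k)) ^ 12) ∧
      -- the limit directions and the segment
      ∃ uA uD : Fin 4 → ℝ,
        (∑ i, |uA i| = 1) ∧ (∑ i, |uD i| = 1) ∧ uA ≠ uD ∧
        (∀ i, |uA i - (![1 / 2, 0, 0, 1 / 2] : Fin 4 → ℝ) i| ≤ K / n₀) ∧
        (∀ i, |uD i - (![0, 0, 1, 0] : Fin 4 → ℝ) i| ≤ K / n₀) ∧
        Tendsto (fun l => IEM.normCol n₀ l IEM.lA) atTop (𝓝 uA) ∧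
        Tendsto (fun l => IEM.normCol n₀ (2 * l) IEM.lB) atTop (𝓝 uA) ∧
        Tendsto (fun l => IEM.normCol n₀ (2 * l) IEM.lC) atTop (𝓝 uA) ∧
        Tendsto (fun l => IEM.normCol n₀ l IEM.lD) atTop (𝓝 uD) ∧
        Tendsto (fun l => IEM.normCol n₀ (2 * l + 1) IEM.lC) atTop (𝓝 uD) ∧
        Tendsto (fun l => IEM.normCol n₀ (2 * l + 1) IEM.lB) atTop (𝓝 uD) ∧
        -- the interval exchange maps whose Rauzy path is `Γ` are exactly those of the segment
        {u : Fin 4 → ℝ | (∀ i, 0 < u i) ∧ ∑ i, u i = 1 ∧ (IEM.Data.mk IEM.abcd u).Keane ∧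
          ∀ k, (IEM.Data.mk IEM.abcd u).StartsWith (IEM.gammaWord n₀ k)} = segment ℝ uA uD ∧
        (∀ u ∈ segment ℝ uA uD,
          (∀ k, (IEM.Data.mk IEM.abcd u).zorichTime k = (IEM.gammaWord n₀ k).length) ∧
          (∀ k, (IEM.Data.mk IEM.abcd u).zorichZ k = IEM.loopZ n₀ k) ∧
          (IEM.Data.mk IEM.abcd u).CondA ∧
          ¬ (IEM.Data.mk IEM.abcd u).UniquelyErgodic ∧
          ¬ (IEM.Data.mk IEM.abcd u).CondB) ∧
        (∀ u ∈ segment ℝ uA uD, ∀ v ∈ segment ℝ uA uD,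
          (IEM.Data.mk IEM.abcd u).TopConj (IEM.Data.mk IEM.abcd v)) := by
  refine ⟨fun m n p => ⟨IEM.rauzyPath_word0 m n p, IEM.rauzyPath_word1 m n p⟩, 1000, 1000,
    by norm_num, fun n₀ h => ?_⟩
  have h' : 46 ≤ n₀ := by omega
  have hK : (230 : ℝ) / n₀ ≤ 1000 / n₀ :=
    div_le_div_of_nonneg_right (by norm_num) (Nat.cast_nonneg n₀)
  refine ⟨fun l hl => IEM.column_estimates (by omega) (by norm_num) hl,
    IEM.sumNorm_loopZ_isTheta (by omega), IEM.sumNorm_loopQ_isTheta h',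
    IEM.loopZ_isLittleO_log h', IEM.limDir n₀ 0, IEM.limDir n₀ 1, IEM.sum_abs_limDir h' 0,
    IEM.sum_abs_limDir h' 1, IEM.limDir_ne h, fun i => ?_, fun i => ?_, ?_,
    IEM.tendsto_normCol_even h' (by decide), IEM.tendsto_normCol_even h' (by decide), ?_,
    IEM.tendsto_normCol_odd h' (by decide), IEM.tendsto_normCol_odd h' (by decide), ?_,
    fun u hu => ?_, fun u hu v hv => IEM.topConj_of_mem_segment h' hu hv⟩
  · rw [← IEM.unitVec_dirCol_zero]
    exact (IEM.limDir_sub h' 0 i).trans hK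
  · rw [← IEM.unitVec_dirCol_one]
    exact (IEM.limDir_sub h' 1 i).trans hK
  · simpa using IEM.tendsto_normCol_main h' 0
  · simpa using IEM.tendsto_normCol_main h' 1
  · ext u
    refine ⟨fun ⟨hpos, hsum, _, hw⟩ => IEM.mem_segment_of_startsWith h' hpos hsum hw, fun hu => ?_⟩
    have hG := IEM.gammaLengths_of_mem_segment h' hu
    exact ⟨(hG.follows 0).pos, IEM.sum_of_mem_segment h' hu,
      IEM.Data.keane_of_steppable hG.steppable (hG.tendsto_total (hG.tendsto_sum h')),
      fun k => (hG.follows k).names⟩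
  · have hn₀ : n₀ ≠ 0 := by omega
    have hG := IEM.gammaLengths_of_mem_segment h' hu
    refine ⟨hG.zorichTime_eq hn₀, hG.zorichZ_eq hn₀, fun ε hε => ?_,
      IEM.not_uniquelyErgodic_of_mem_segment h hu, ?_⟩
    · simp only [hG.zorichZ_eq hn₀, hG.zorichQ_eq hn₀]
      exact IEM.exists_loopZ_le h' hε
    · rintro ⟨θ, C, hθ, -, hb⟩
      simp only [hG.zorichQ_eq hn₀] at hb
      exact IEM.not_loop_bound h (IEM.sum_of_mem_segment h' hu) hθ hb

end
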